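/- Let $n\ge 1$ and $1<p<\infty$. There is a constant $C=C(n,p)>0$, depending only on $n$ and $p$, with the following property. Write $\mathbb{R}^{n+1}_+=\mathbb{R}^n\times(0,\infty)$ and $\overline{\mathbb{R}}^{n+1}_+=\mathbb{R}^n\times[0,\infty)$. Let $F$ be a finite-dimensional Euclidean space, let $\mathfrak{o}(F)$ be the Lie algebra of skew-adjoint endomorphisms of $F$, let $\Gamma\in C^1(\overline{\mathbb{R}}^{n+1}_+,\mathrm{Lin}(\mathbb{R}^{n+1},\mathfrak{o}(F)))$, and let $\beta\ge 0$ be such that the curvature $$\mathscr K_\Gamma(z)[v,w]=D\Gamma(z)[v,w]-D\Gamma(z)[w,v]+\Gamma(z)[v]\Gamma(z)[w]-\Gamma(z)[w]\Gamma(z)[v],\qquad D\Gamma(z)[v,w]=\tfrac{d}{dt}\Big|_{t=0}\Gamma(z+tv)[w],$$ satisfies $\|\mathscr K_\Gamma\|_\infty=\sup_{z}\sup_{|v|,|w|\le 1}|\mathscr K_\Gamma(z)[v,w]|\le\beta$, with the operator norm on $\mathrm{Lin}(F,F)$. Put $\nabla_\Gamma U(z)[v]=DU(z)[v]+\Gamma(z)[v]U(z)$,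 measured in the Hilbert–Schmidt norm on $\mathrm{Lin}(\mathbb{R}^{n+1},F)$, and $\Gamma_\shortparallel(x)[v]=\Gamma(x,0)[(v,0)]$ for $x,v\in\mathbb{R}^n$. For $x,y\in\mathbb{R}^n$ let $R(x,y)=P(0)$, where $P:[0,1]\to\mathrm{Lin}(F,F)$ solves $P'(t)+\Gamma_\shortparallel((1-t)x+ty)[y-x]\,P(t)=0$, $P(1)=\mathrm{id}_F$ (parallel transport from $y$ to $x$ along the segment), and let $$|u|_{W^{1-1/p,p}_{\Gamma_\shortparallel}}=\left(\iint_{\mathbb{R}^n\times\mathbb{R}^n}\frac{|u(x)-R(x,y)u(y)|^p}{|x-y|^{n+p-1}}\,dx\,dy\right)^{1/p}.$$ Then: (i) for every $U\in C^1_c(\overline{\mathbb{R}}^{n+1}_+,F)$, $$|U(\cdot,0)|_{W^{1-1/p,p}_{\Gamma_\shortparallel}}+\beta^{\frac{p-1}{2p}}\|U(\cdot,0)\|_{L^p(\mathbb{R}^n)}\le C\left(\|\nabla_\Gamma U\|_{L^p(\mathbb{R}^{n+1}_+)}+\beta^{1/2}\|U\|_{L^p(\mathbb{R}^{n+1}_+)}\right);$$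 (ii) there is a linear map $u\mapsto U$ from $C^1_c(\mathbb{R}^n,F)$ to $C^1_c(\overline{\mathbb{R}}^{n+1}_+,F)$ (which may depend on $\Gamma$ and $\beta$) such that for every $u$ one has $U(x,0)=u(x)$ for all $x\in\mathbb{R}^n$ and $$\|\nabla_\Gamma U\|_{L^p(\mathbb{R}^{n+1}_+)}+\beta^{1/2}\|U\|_{L^p(\mathbb{R}^{n+1}_+)}\le C\left(|u|_{W^{1-1/p,p}_{\Gamma_\shortparallel}}+\beta^{\frac{p-1}{2p}}\|u\|_{L^p(\mathbb{R}^n)}\right).$$ Here $C^1_c(\overline{\mathbb{R}}^{n+1}_+,F)$ denotes the functions that are $C^1$ up to the boundary and have compact support in the closed half-space. -/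

import Mathlib

open MeasureTheory Set
open scoped NNReal ENNReal

noncomputable section

namespace GaugeTrace

/-- The Lie algebra `𝔬(F)` of skew-adjoint endomorphisms of the Euclidean space `F`. -/
def orthogonalLieAlgebra (F : Type*) [NormedAddCommGroup F] [InnerProductSpace ℝ F] :
    Submodule ℝ (F →L[ℝ] F) where
  carrier := {A | ∀ a b : F, inner ℝ (A a) b = -inner ℝ a (A b)}
  add_mem' := by
    intro A B hA hB a b
    simp only [add_apply, inner_add_left, inner_add_right, hA a b, hB a b]
    ring
  zero_mem' := by
    intro a b
    simp
  smul_mem' := by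
    intro c A hA a b
    simp only [smul_apply, real_inner_smul_left, real_inner_smul_right, hA a b]
    ring

/-- The closed half-space `ℝⁿ × [0, ∞)` in `ℝⁿ⁺¹`. -/
def closedHalfSpace (n : ℕ) : Set (EuclideanSpace ℝ (Fin (n + 1))) :=
  {z | 0 ≤ z (Fin.last n)}

/-- The open half-space `ℝⁿ × (0, ∞)` in `ℝⁿ⁺¹`. -/
def openHalfSpace (n : ℕ) : Set (EuclideanSpace ℝ (Fin (n + 1))) :=
  {z | 0 < z (Fin.last n)}

/-- The inclusion `x ↦ (x, 0)` of `ℝⁿ` in `ℝⁿ⁺¹` as the boundary of the half-space. -/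
def boundaryIncl (n : ℕ) : EuclideanSpace ℝ (Fin n) →L[ℝ] EuclideanSpace ℝ (Fin (n + 1)) :=
  LinearMap.toContinuousLinearMap
    { toFun := fun x => WithLp.toLp 2 (Fin.snoc (α := fun _ => ℝ) (WithLp.ofLp x) 0)
      map_add' := by
        intro x y
        ext i
        refine Fin.lastCases ?_ (fun j => ?_) i <;> simp
      map_smul' := by
        intro c x
        ext i
        refine Fin.lastCases ?_ (fun j => ?_) i <;> simp }

variable {n : ℕ} {F : Type*} [NormedAddCommGroup F] [InnerProductSpace ℝ F]

/-- `Γ` is a metric connection form of class `C¹` on the closed half-space: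
`Γ ∈ C¹(ℝⁿ × [0, ∞), Lin(ℝⁿ⁺¹, 𝔬(F)))`. Only the values on the closed half-space matter. -/
structure IsMetricConnectionForm
    (Γ : EuclideanSpace ℝ (Fin (n + 1)) → EuclideanSpace ℝ (Fin (n + 1)) →L[ℝ] F →L[ℝ] F) :
    Prop where
  contDiffOn : ContDiffOn ℝ 1 Γ (closedHalfSpace n)
  mem_orthogonal : ∀ z ∈ closedHalfSpace n, ∀ v, Γ z v ∈ orthogonalLieAlgebra F

/-- The curvature `K_Γ = dΓ + Γ ∧ Γ`, that is,
`K_Γ(z)[v, w] = DΓ(z)[v, w] - DΓ(z)[w, v] + Γ(z)[v] Γ(z)[w] - Γ(z)[w] Γ(z)[v]`,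
where `DΓ(z)[v, w]` is the derivative of `Γ[w]` at `z` in the direction `v`. -/
def curvature
    (Γ : EuclideanSpace ℝ (Fin (n + 1)) → EuclideanSpace ℝ (Fin (n + 1)) →L[ℝ] F →L[ℝ] F)
    (z v w : EuclideanSpace ℝ (Fin (n + 1))) : F →L[ℝ] F :=
  fderivWithin ℝ Γ (closedHalfSpace n) z v w - fderivWithin ℝ Γ (closedHalfSpace n) z w v
    + (Γ z v).comp (Γ z w) - (Γ z w).comp (Γ z v)

/-- The supremum norm of the curvature over the half-space, the supremum of the operator norms of
`K_Γ(z)[v, w]` over `z` and over all vectors `v`, `w` of norm at most `1`. -/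
def curvatureSupNorm
    (Γ : EuclideanSpace ℝ (Fin (n + 1)) → EuclideanSpace ℝ (Fin (n + 1)) →L[ℝ] F →L[ℝ] F) :
    ℝ≥0∞ :=
  ⨆ z ∈ closedHalfSpace n, ⨆ v ∈ Metric.closedBall (0 : EuclideanSpace ℝ (Fin (n + 1))) 1,
    ⨆ w ∈ Metric.closedBall (0 : EuclideanSpace ℝ (Fin (n + 1))) 1, ‖curvature Γ z v w‖ₑ

/-- The covariant derivative `∇_Γ U(z)[v] = DU(z)[v] + Γ(z)[v] U(z)` on the half-space. -/
def covDeriv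
    (Γ : EuclideanSpace ℝ (Fin (n + 1)) → EuclideanSpace ℝ (Fin (n + 1)) →L[ℝ] F →L[ℝ] F)
    (U : EuclideanSpace ℝ (Fin (n + 1)) → F) (z : EuclideanSpace ℝ (Fin (n + 1))) :
    EuclideanSpace ℝ (Fin (n + 1)) →L[ℝ] F :=
  fderivWithin ℝ U (closedHalfSpace n) z + (Γ z).flip (U z)

/-- The Hilbert-Schmidt (Frobenius) norm on `Lin(ℝᵏ, F)`. -/
def hilbertSchmidtNorm {k : ℕ} (T : EuclideanSpace ℝ (Fin k) →L[ℝ] F) : ℝ :=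
  √(∑ i, ‖T (EuclideanSpace.single i 1)‖ ^ 2)

/-- The connection form `Γ_∥(x)[v] = Γ(x, 0)[(v, 0)]` induced on the boundary. -/
def boundaryForm
    (Γ : EuclideanSpace ℝ (Fin (n + 1)) → EuclideanSpace ℝ (Fin (n + 1)) →L[ℝ] F →L[ℝ] F)
    (x : EuclideanSpace ℝ (Fin n)) : EuclideanSpace ℝ (Fin n) →L[ℝ] F →L[ℝ] F :=
  (Γ (boundaryIncl n x)).comp (boundaryIncl n)

/-- `P` solves the parallel transport equation of the connection form `A` along the segment
`γ(t) = (1 - t) x + t y`: `P'(t) + A(γ(t))[γ'(t)] P(t) = 0` for `t ∈ [0, 1]`, and `P(1) = id`. -/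
structure IsParallelTransport
    (A : EuclideanSpace ℝ (Fin n) → EuclideanSpace ℝ (Fin n) →L[ℝ] F →L[ℝ] F)
    (x y : EuclideanSpace ℝ (Fin n)) (P : ℝ → F →L[ℝ] F) : Prop where
  hasDeriv : ∀ t ∈ Icc (0 : ℝ) 1, HasDerivWithinAt P
    (-(A ((1 - t) • x + t • y) (y - x)).comp (P t)) (Icc 0 1) t
  final : P 1 = ContinuousLinearMap.id ℝ F

open Classical in
/-- The parallel transport `R^A(x, y) = P(0)` from `y` to `x` along the segment from `x` to `y`,
with `P` the solution of the parallel transport equation. The solution exists (so that the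
alternative never occurs) and is unique on `[0, 1]` for every continuous `A`, see
`exists_isParallelTransport` and `parallelTransport_eq`. -/
def parallelTransport
    (A : EuclideanSpace ℝ (Fin n) → EuclideanSpace ℝ (Fin n) →L[ℝ] F →L[ℝ] F)
    (x y : EuclideanSpace ℝ (Fin n)) : F →L[ℝ] F :=
  if h : ∃ P : ℝ → F →L[ℝ] F, IsParallelTransport A x y P then h.choose 0
  else ContinuousLinearMap.id ℝ F

/-- The gauge-covariant Gagliardo seminorm of `W^{s,p}_A(ℝⁿ, F)`, possibly infinite. -/
def gagliardoSeminorm (s p : ℝ)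
    (A : EuclideanSpace ℝ (Fin n) → EuclideanSpace ℝ (Fin n) →L[ℝ] F →L[ℝ] F)
    (u : EuclideanSpace ℝ (Fin n) → F) : ℝ≥0∞ :=
  (∫⁻ x, ∫⁻ y, ‖u x - parallelTransport A x y (u y)‖ₑ ^ p / ‖x - y‖ₑ ^ ((n : ℝ) + s * p))
    ^ (1 / p)

variable (n F)

/-- `C¹_c(ℝⁿ, F)`: compactly supported functions of class `C¹`. -/
def C1c : Submodule ℝ (EuclideanSpace ℝ (Fin n) → F) where
  carrier := {u | ContDiff ℝ 1 u ∧ HasCompactSupport u}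
  add_mem' := fun hu hv => ⟨hu.1.add hv.1, hu.2.add hv.2⟩
  zero_mem' := ⟨contDiff_const, HasCompactSupport.zero⟩
  smul_mem' := fun c _ hu => ⟨contDiff_const.smul hu.1, hu.2.smul_left (f := fun _ => c)⟩

/-- `C¹_c(ℝⁿ × [0, ∞), F)`: functions of class `C¹` up to the boundary of the half-space, vanishing
outside a compact subset of the closed half-space. They are represented by functions on `ℝⁿ⁺¹`
whose values outside the closed half-space are irrelevant. -/
def C1cHalfSpace : Submodule ℝ (EuclideanSpace ℝ (Fin (n + 1)) → F) where
  carrier := {U | ContDiffOn ℝ 1 U (closedHalfSpace n) ∧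
    ∃ K ⊆ closedHalfSpace n, IsCompact K ∧ ∀ z ∈ closedHalfSpace n, z ∉ K → U z = 0}
  add_mem' := by
    rintro U V ⟨hU, K, hKs, hK, hUK⟩ ⟨hV, L, hLs, hL, hVL⟩
    refine ⟨hU.add hV, K ∪ L, union_subset hKs hLs, hK.union hL, fun z hz hzKL => ?_⟩
    simp only [mem_union, not_or] at hzKL
    simp [hUK z hz hzKL.1, hVL z hz hzKL.2]
  zero_mem' := ⟨contDiffOn_const, ∅, empty_subset _, isCompact_empty, fun _ _ _ => rfl⟩
  smul_mem' := by
    rintro c U ⟨hU, K, hKs, hK, hUK⟩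
    exact ⟨contDiffOn_const.smul hU, K, hKs, hK, fun z hz hzK => by simp [hUK z hz hzK]⟩

variable {n F}

/-- The sum `‖∇_Γ U‖_{L^p} + β^{1/2} ‖U‖_{L^p}` of norms over the open half-space. -/
def interiorNorm (p : ℝ) (β : ℝ≥0)
    (Γ : EuclideanSpace ℝ (Fin (n + 1)) → EuclideanSpace ℝ (Fin (n + 1)) →L[ℝ] F →L[ℝ] F)
    (U : EuclideanSpace ℝ (Fin (n + 1)) → F) : ℝ≥0∞ :=
  eLpNorm (fun z => hilbertSchmidtNorm (covDeriv Γ U z)) (ENNReal.ofReal p)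
      (volume.restrict (openHalfSpace n))
    + ((β ^ (1 / 2 : ℝ) : ℝ≥0) : ℝ≥0∞) *
      eLpNorm U (ENNReal.ofReal p) (volume.restrict (openHalfSpace n))

/-- The sum `|u|_{W^{1-1/p,p}} + β^{(p-1)/(2p)} ‖u‖_{L^p}` on the boundary, the first term being
the gauge-covariant seminorm for the boundary form of `Γ`. -/
def boundaryNorm (p : ℝ) (β : ℝ≥0)
    (Γ : EuclideanSpace ℝ (Fin (n + 1)) → EuclideanSpace ℝ (Fin (n + 1)) →L[ℝ] F →L[ℝ] F)
    (u : EuclideanSpace ℝ (Fin n) → F) : ℝ≥0∞ :=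
  gagliardoSeminorm (1 - 1 / p) p (boundaryForm Γ) u
    + ((β ^ ((p - 1) / (2 * p)) : ℝ≥0) : ℝ≥0∞) * eLpNorm u (ENNReal.ofReal p) volume

/-! Well-posedness of the parallel transport equation. -/

section WellPosed

/-- A linear differential equation with continuous coefficients has a solution on `[0, 1]`. -/
theorem exists_linear_ode [CompleteSpace F] {B : ℝ → F →L[ℝ] F} (hB : Continuous B) :
    ∃ Q : ℝ → F →L[ℝ] F, Q 0 = ContinuousLinearMap.id ℝ F ∧
      ∀ t ∈ Icc (0 : ℝ) 1, HasDerivWithinAt Q ((B t).comp (Q t)) (Icc 0 1) t := by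
  obtain ⟨M', hM'⟩ := (isCompact_Icc (a := (0 : ℝ)) (b := 1)).exists_bound_of_continuousOn
    hB.continuousOn
  set M : ℝ≥0 := ⟨max M' 0, le_max_right _ _⟩ with hMdef
  have hM : ∀ t ∈ Icc (0 : ℝ) 1, ‖B t‖ ≤ M := fun t ht => (hM' t ht).trans (le_max_left _ _)
  set ρ : ℝ≥0 := ⟨Real.exp M, (Real.exp_pos _).le⟩ with hρdef
  have hρ : (0 : ℝ) < ρ := Real.exp_pos _
  -- truncated vector field
  let g : (F →L[ℝ] F) → ℝ := fun y => (ρ : ℝ) / max (ρ : ℝ) ‖y‖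
  have hmax : ∀ y : F →L[ℝ] F, (0 : ℝ) < max (ρ : ℝ) ‖y‖ := fun y => lt_max_of_lt_left hρ
  have hg0 : ∀ y, 0 ≤ g y := fun y => div_nonneg hρ.le (hmax y).le
  have hg1 : ∀ y, g y ≤ 1 := fun y => (div_le_one (hmax y)).2 (le_max_left _ _)
  have hgy : ∀ y, g y * ‖y‖ ≤ ρ := fun y => by
    simp only [g]
    rw [div_mul_eq_mul_div, div_le_iff₀ (hmax y)]
    exact mul_le_mul_of_nonneg_left (le_max_right _ _) hρ.le
  have hgl : ∀ y z, |g y - g z| ≤ ‖y - z‖ / ρ := fun y z => by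
    have h1 : g y - g z = ρ * (max (ρ : ℝ) ‖z‖ - max (ρ : ℝ) ‖y‖) /
        (max (ρ : ℝ) ‖y‖ * max (ρ : ℝ) ‖z‖) := by
      simp only [g]
      have := (hmax y).ne'
      have := (hmax z).ne'
      field_simp
    have h2 : |max (ρ : ℝ) ‖z‖ - max (ρ : ℝ) ‖y‖| ≤ ‖y - z‖ := by
      have := abs_max_sub_max_le_abs (‖z‖) (‖y‖) (ρ : ℝ)
      rw [max_comm (ρ : ℝ), max_comm (ρ : ℝ)]
      refine this.trans ?_
      rw [← norm_sub_rev z y]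
      exact abs_norm_sub_norm_le z y
    rw [h1, abs_div, abs_mul, abs_of_pos hρ, abs_of_pos (mul_pos (hmax y) (hmax z)),
      div_le_div_iff₀ (mul_pos (hmax y) (hmax z)) hρ]
    have h3 : (ρ : ℝ) * ρ ≤ max (ρ : ℝ) ‖y‖ * max (ρ : ℝ) ‖z‖ :=
      mul_le_mul (le_max_left _ _) (le_max_left _ _) hρ.le (hmax y).le
    calc (ρ : ℝ) * |max (ρ : ℝ) ‖z‖ - max (ρ : ℝ) ‖y‖| * ρ
        = |max (ρ : ℝ) ‖z‖ - max (ρ : ℝ) ‖y‖| * ((ρ : ℝ) * ρ) := by ring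
      _ ≤ ‖y - z‖ * (max (ρ : ℝ) ‖y‖ * max (ρ : ℝ) ‖z‖) :=
        mul_le_mul h2 h3 (by positivity) (norm_nonneg _)
  let x₀ : F →L[ℝ] F := ContinuousLinearMap.id ℝ F
  let a : ℝ≥0 := M * ρ
  let b : ℝ≥0 := ‖x₀‖₊ + a
  let t₀ : Icc (0 : ℝ) 1 := ⟨0, by simp⟩
  have hpl : IsPicardLindelof (fun t y => g y • (B t).comp y) t₀ x₀ a 0 (M * ρ)
      (M * b / ρ + M) := by
    refine ⟨fun t ht => ?_, fun y _ => ?_, fun t ht y _ => ?_, ?_⟩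
    · refine LipschitzOnWith.of_dist_le_mul fun y hy z hz => ?_
      rw [dist_eq_norm, dist_eq_norm]
      have hyb : ‖y‖ ≤ b := by
        have := norm_le_norm_add_norm_sub' y x₀
        rw [mem_closedBall_iff_norm] at hy
        simp only [b, NNReal.coe_add, coe_nnnorm]
        linarith
      have h : g y • (B t).comp y - g z • (B t).comp z
          = (g y - g z) • (B t).comp y + g z • (B t).comp (y - z) := by
        rw [ContinuousLinearMap.comp_sub, sub_smul, smul_sub]
        abel
      rw [h]
      refine (norm_add_le _ _).trans ?_
      rw [norm_smul, norm_smul, Real.norm_eq_abs, Real.norm_eq_abs, abs_of_nonneg (hg0 z)]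
      have e1 : ‖(B t).comp y‖ ≤ M * b := (ContinuousLinearMap.opNorm_comp_le _ _).trans
        (mul_le_mul (hM t ht) hyb (norm_nonneg _) M.2)
      have e2 : ‖(B t).comp (y - z)‖ ≤ M * ‖y - z‖ :=
        (ContinuousLinearMap.opNorm_comp_le _ _).trans
        (mul_le_mul_of_nonneg_right (hM t ht) (norm_nonneg _))
      have e3 : |g y - g z| * ‖(B t).comp y‖ ≤ ‖y - z‖ / ρ * (M * b) :=
        mul_le_mul (hgl y z) e1 (norm_nonneg _) (by positivity)
      have e4 : g z * ‖(B t).comp (y - z)‖ ≤ 1 * (M * ‖y - z‖) :=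
        mul_le_mul (hg1 z) e2 (norm_nonneg _) zero_le_one
      push_cast
      calc _ ≤ ‖y - z‖ / ρ * (M * b) + 1 * (M * ‖y - z‖) := add_le_add e3 e4
        _ = _ := by ring
    · exact (Continuous.const_smul (hB.clm_comp continuous_const) (g y)).continuousOn
    · rw [norm_smul, Real.norm_eq_abs, abs_of_nonneg (hg0 y)]
      have := (B t).opNorm_comp_le y
      push_cast
      calc g y * ‖(B t).comp y‖ ≤ g y * (M * ‖y‖) :=
            mul_le_mul_of_nonneg_left (this.trans
              (mul_le_mul_of_nonneg_right (hM t ht) (norm_nonneg _))) (hg0 y)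
        _ = M * (g y * ‖y‖) := by ring
        _ ≤ M * ρ := mul_le_mul_of_nonneg_left (hgy y) M.2
    · simp [t₀, a]
  obtain ⟨Q, hQ0, hQ⟩ := hpl.exists_eq_forall_mem_Icc_hasDerivWithinAt₀
  have hQ0' : Q 0 = x₀ := hQ0
  -- a priori bound: the truncation is inactive
  have hbd : ∀ t ∈ Icc (0 : ℝ) 1, ‖Q t‖ ≤ ρ := by
    intro t ht
    have := norm_le_gronwallBound_of_norm_deriv_right_le (f := Q) (δ := 1) (K := M) (ε := 0)
      (a := 0) (b := 1) (fun s hs => (hQ s hs).continuousWithinAt)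
      (fun s hs => (hQ s ⟨hs.1, hs.2.le⟩).mono_of_mem_nhdsWithin
        (Icc_mem_nhdsGE_of_mem hs))
      (by rw [hQ0']; exact ContinuousLinearMap.norm_id_le)
      (fun s hs => by
        rw [norm_smul, Real.norm_eq_abs, abs_of_nonneg (hg0 _), add_zero]
        have h1 := ((B s).opNorm_comp_le (Q s)).trans
          (mul_le_mul_of_nonneg_right (hM s ⟨hs.1, hs.2.le⟩) (norm_nonneg _))
        calc g (Q s) * ‖(B s).comp (Q s)‖ ≤ 1 * ((M : ℝ) * ‖Q s‖) := mul_le_mul (hg1 _) h1 (norm_nonneg _) zero_le_one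
          _ = _ := one_mul _) t ht
    rw [gronwallBound_ε0, one_mul, sub_zero] at this
    refine this.trans (Real.exp_le_exp.2 ?_)
    exact mul_le_of_le_one_right M.2 ht.2
  refine ⟨Q, hQ0', fun t ht => ?_⟩
  have h := hQ t ht
  have hg : g (Q t) = 1 := by
    simp only [g]
    rw [max_eq_left (hbd t ht), div_self hρ.ne']
  rwa [hg, one_smul] at h

/-- Existence of parallel transport for a continuous connection form. -/
theorem exists_isParallelTransport [CompleteSpace F]
    {A : EuclideanSpace ℝ (Fin n) → EuclideanSpace ℝ (Fin n) →L[ℝ] F →L[ℝ] F}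
    (hA : Continuous A) (x y : EuclideanSpace ℝ (Fin n)) :
    ∃ P : ℝ → F →L[ℝ] F, IsParallelTransport A x y P := by
  obtain ⟨Q, hQ0, hQ⟩ := exists_linear_ode
    (B := fun t => A ((1 - (1 - t)) • x + (1 - t) • y) (y - x)) (by fun_prop)
  refine ⟨fun t => Q (1 - t), fun t ht => ?_, by simpa using hQ0⟩
  have ht' : 1 - t ∈ Icc (0 : ℝ) 1 := ⟨by linarith [ht.2], by linarith [ht.1]⟩
  have h1 : HasDerivWithinAt (fun s : ℝ => 1 - s) (-1) (Icc 0 1) t := by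
    simpa using (hasDerivWithinAt_id t (Icc (0 : ℝ) 1)).const_sub 1
  have h2 := (hQ (1 - t) ht').scomp t h1
    (fun s hs => ⟨by linarith [hs.2], by linarith [hs.1]⟩)
  refine h2.congr_deriv ?_
  simp only [sub_sub_cancel]
  rw [neg_one_smul]

/-- Uniqueness of parallel transport for a continuous connection form. -/
theorem parallelTransport_eq
    {A : EuclideanSpace ℝ (Fin n) → EuclideanSpace ℝ (Fin n) →L[ℝ] F →L[ℝ] F}
    (hA : Continuous A) {x y : EuclideanSpace ℝ (Fin n)} {P : ℝ → F →L[ℝ] F}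
    (hP : IsParallelTransport A x y P) : parallelTransport A x y = P 0 := by
  have hex : ∃ P : ℝ → F →L[ℝ] F, IsParallelTransport A x y P := ⟨P, hP⟩
  rw [parallelTransport, dif_pos hex]
  set R := hex.choose with hR
  have hR' : IsParallelTransport A x y R := hex.choose_spec
  have hc : Continuous fun t : ℝ => A ((1 - t) • x + t • y) (y - x) := by fun_prop
  obtain ⟨M, hM⟩ := (isCompact_Icc (a := (0 : ℝ)) (b := 1)).exists_bound_of_continuousOn
    hc.continuousOn
  have hD : ∀ t ∈ Icc (0 : ℝ) 1, HasDerivWithinAt (fun t => R (1 - t) - P (1 - t))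
      ((A ((1 - (1 - t)) • x + (1 - t) • y) (y - x)).comp (R (1 - t) - P (1 - t)))
      (Icc 0 1) t := by
    intro t ht
    have ht' : 1 - t ∈ Icc (0 : ℝ) 1 := ⟨by linarith [ht.2], by linarith [ht.1]⟩
    have h1 : HasDerivWithinAt (fun s : ℝ => 1 - s) (-1) (Icc 0 1) t := by
      simpa using (hasDerivWithinAt_id t (Icc (0 : ℝ) 1)).const_sub 1
    have h2 := ((hR'.hasDeriv (1 - t) ht').sub (hP.hasDeriv (1 - t) ht')).scomp t h1
      (fun s hs => ⟨by linarith [hs.2], by linarith [hs.1]⟩)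
    refine h2.congr_deriv ?_
    rw [ContinuousLinearMap.comp_sub, neg_one_smul]
    abel
  have h0 := eq_zero_of_abs_deriv_le_mul_abs_self_of_eq_zero_right (K := M)
    (fun t ht => (hD t ht).continuousWithinAt)
    (fun t ht => (hD t ⟨ht.1, ht.2.le⟩).mono_of_mem_nhdsWithin (Icc_mem_nhdsGE_of_mem ht))
    (by simp [hR'.final, hP.final])
    (fun t ht => ((ContinuousLinearMap.opNorm_comp_le _ _).trans
      (mul_le_mul_of_nonneg_right
        (hM (1 - t) ⟨by linarith [ht.2], by linarith [ht.1]⟩) (norm_nonneg _))))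
    1 ⟨zero_le_one, le_rfl⟩
  simpa [sub_eq_zero] using h0

end WellPosed

end GaugeTrace

end

noncomputable section

namespace GaugeTrace

/-! ### Linear equations with skew-adjoint coefficients -/

section LinearODE

variable {F : Type*} [NormedAddCommGroup F] [InnerProductSpace ℝ F] [FiniteDimensional ℝ F]

-- Parallel transport along segments is a linear isometry, so values of a section at two points can
-- be compared without loss; only curvature prevents these comparisons from being transitive. Two
-- estimates carry this principle. A section varies along a segment, up to transport, by at most the
-- integral of its covariant derivative (`IsSkewForm.norm_sub_transport_le_integral`). The covariant
-- derivative in `z` of the transport from a fixed `y` to `z` is an integral of curvature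
-- (`IsSkewForm.covDeriv_transport`), so going along two sides of a triangle instead of the third
-- costs at most `β` times a product of lengths (`IsSkewForm.norm_transport_sub_comp_le`). The form
-- is extended by reflection to the whole space, where transport is of class `C¹`; the curvature
-- bound is used only on the closed half-space, which is convex.
--
-- Trace. The boundary points `x` and `y` are joined to the point at height `‖x - y‖ / 2` above
-- their midpoint. The covariant difference of the boundary values is then at most two integrals of
-- the covariant derivative along slanted segments plus a holonomy term `min 2 (β * ‖x - y‖ ^ 2) *
-- ‖u y‖` (`HalfSpaceForm.osc_le`). After division by the Gagliardo kernel, Hölder's inequality and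
-- polar coordinates bound the slanted part by the energy (`lintegral_slantAverage_le`), and the
-- holonomy part integrates to `β ^ ((p - 1) / 2)` times the boundary mass
-- (`lintegral_holonomy_le`). That mass is controlled by vertical segments of length up to `β ^
-- (-1/2)` (`IsSkewForm.rpow_mul_lpEnergy_trace_le`).
--
-- Extension, `β > 0`. At height `t` one mollifies at scale `t` the values of `u` transported from
-- the boundary to the interior point, and cuts off at heights of order `β ^ (-1/2)`. The kernel has
-- integral one, so a fixed vector may be subtracted before differentiating; choosing the transport
-- of `u x` produces covariant differences of `u`, with curvature errors of size `β * t`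
-- (`HalfSpaceForm.enorm_covNorm_smul_le_osc`). Integration over all heights gives the Gagliardo
-- energy (`IsSkewForm.lintegral_ballAverage_osc_le`), and the cutoff height makes all other terms
-- match the weighted boundary mass.
--
-- Extension, `β = 0`. Compact support still requires a cutoff, but no scale is given: cutting off
-- at height `2 / r` costs `r ^ (p - 1)` times the mass of `u`, which is small only if `r` depends
-- on `u`, and that would destroy linearity. Instead there are linear localizations `S j`, bounded
-- from the seminorm to `L^p` and each `u` being fixed by `S j` for large `j`. With `X j` the
-- extension cut off at scale `r j`, the operators `X J ∘ S J + ∑ j < J, (X j - X (j + 1)) ∘ S j`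
-- are eventually constant on each `u`, and their pieces sum geometrically when `r j` decreases fast
-- enough (`HalfSpaceForm.exists_flat_extension`).

local instance : CompleteSpace F := FiniteDimensional.complete ℝ F

theorem star_eq_neg_of_mem_orthogonalLieAlgebra {A : F →L[ℝ] F}
    (hA : A ∈ orthogonalLieAlgebra F) : star A = -A := by
  rw [ContinuousLinearMap.star_eq_adjoint, eq_comm, ContinuousLinearMap.eq_adjoint_iff]
  intro x y
  have := hA x y
  simp only [neg_apply, inner_neg_left]
  linarith

/-- Finite dimension enters here: a left inverse of an endomorphism is a right inverse. -/
theorem mul_star_self_of_star_mul_self {Q : F →L[ℝ] F} (h : star Q * Q = 1) : Q * star Q = 1 := by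
  have h1 : (star Q : F →L[ℝ] F).toLinearMap * Q.toLinearMap = 1 := by
    ext x
    exact congrArg (fun T : F →L[ℝ] F => T x) h
  have h2 := mul_eq_one_comm.1 h1
  ext x
  exact congrArg (fun T : F →ₗ[ℝ] F => T x) h2

theorem norm_apply_of_star_mul_self {Q : F →L[ℝ] F} (h : star Q * Q = 1) (x : F) :
    ‖Q x‖ = ‖x‖ := by
  have h1 : inner ℝ (Q x) (Q x) = inner ℝ x x := by
    rw [← ContinuousLinearMap.adjoint_inner_right, ← ContinuousLinearMap.star_eq_adjoint]
    have : (star Q) (Q x) = x := congrArg (fun T : F →L[ℝ] F => T x) h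
    rw [this]
  rw [real_inner_self_eq_norm_sq, real_inner_self_eq_norm_sq] at h1
  exact (sq_eq_sq₀ (norm_nonneg _) (norm_nonneg _)).1 h1

theorem norm_le_one_of_star_mul_self {Q : F →L[ℝ] F} (h : star Q * Q = 1) : ‖Q‖ ≤ 1 :=
  Q.opNorm_le_bound zero_le_one fun x => by rw [norm_apply_of_star_mul_self h, one_mul]

theorem norm_star_endomorphism (Q : F →L[ℝ] F) : ‖star Q‖ = ‖Q‖ :=
  ContinuousLinearMap.adjoint.norm_map Q

theorem norm_mul_of_star_mul_self {Q : F →L[ℝ] F} (h : star Q * Q = 1) (A : F →L[ℝ] F) :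
    ‖Q * A‖ = ‖A‖ := by
  have h1 := norm_le_one_of_star_mul_self h
  have h2 : ‖star Q‖ ≤ 1 := by rwa [norm_star_endomorphism]
  refine le_antisymm ?_ ?_
  · exact (norm_mul_le _ _).trans (mul_le_of_le_one_left (norm_nonneg _) h1)
  · calc ‖A‖ = ‖star Q * (Q * A)‖ := by rw [← mul_assoc, h, one_mul]
      _ ≤ ‖star Q‖ * ‖Q * A‖ := norm_mul_le _ _
      _ ≤ _ := mul_le_of_le_one_left (norm_nonneg _) h2

/-- `Q` solves the linear differential equation `Q' = B Q` on `[0, 1]`. -/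
def SolvesLinear (B Q : ℝ → F →L[ℝ] F) : Prop :=
  ∀ s ∈ Icc (0 : ℝ) 1, HasDerivWithinAt Q (B s * Q s) (Icc 0 1) s

variable {B B₁ B₂ Q Q₁ Q₂ : ℝ → F →L[ℝ] F}

/-- Skewness of `B₁` makes `star Q₁` solve the equation with coefficient `-B₁` acting from the
right, so the product rule leaves only the difference of the coefficients. Orthogonality,
uniqueness, continuity and differentiability of transport all come from this identity. -/
theorem SolvesLinear.duhamel (hB : ∀ s ∈ Icc (0 : ℝ) 1, star (B₁ s) = -B₁ s)
    (h₁ : SolvesLinear B₁ Q₁) (h₂ : SolvesLinear B₂ Q₂) {s : ℝ} (hs : s ∈ Icc (0 : ℝ) 1) :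
    HasDerivWithinAt (fun s => star (Q₁ s) * Q₂ s) (star (Q₁ s) * ((B₂ s - B₁ s) * Q₂ s))
      (Icc 0 1) s := by
  refine ((h₁ s hs).star.mul (h₂ s hs)).congr_deriv ?_
  rw [star_mul, hB s hs]
  noncomm_ring

theorem eq_of_hasDerivWithinAt_zero {G : Type*} [NormedAddCommGroup G] [NormedSpace ℝ G]
    {f : ℝ → G} (h : ∀ s ∈ Icc (0 : ℝ) 1, HasDerivWithinAt f 0 (Icc 0 1) s) {s : ℝ}
    (hs : s ∈ Icc (0 : ℝ) 1) : f s = f 0 :=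
  constant_of_has_deriv_right_zero (fun t ht => (h t ht).continuousWithinAt)
    (fun t ht => (h t ⟨ht.1, ht.2.le⟩).mono_of_mem_nhdsWithin (Icc_mem_nhdsGE_of_mem ht)) s hs

/-- With equal coefficients the Duhamel derivative vanishes. The case `Q₁ = Q₂` says that solutions
are orthogonal; the general case gives uniqueness. -/
theorem SolvesLinear.star_mul_eq_one (hB : ∀ s ∈ Icc (0 : ℝ) 1, star (B s) = -B s)
    (h₁ : SolvesLinear B Q₁) (h₂ : SolvesLinear B Q₂) (h₁0 : Q₁ 0 = 1) (h₂0 : Q₂ 0 = 1)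
    {s : ℝ} (hs : s ∈ Icc (0 : ℝ) 1) : star (Q₁ s) * Q₂ s = 1 := by
  have := eq_of_hasDerivWithinAt_zero (f := fun s => star (Q₁ s) * Q₂ s)
    (fun t ht => (h₁.duhamel hB h₂ ht).congr_deriv (by simp)) hs
  simpa [h₁0, h₂0] using this

theorem SolvesLinear.unique (hB : ∀ s ∈ Icc (0 : ℝ) 1, star (B s) = -B s)
    (h₁ : SolvesLinear B Q₁) (h₂ : SolvesLinear B Q₂) (h₁0 : Q₁ 0 = 1) (h₂0 : Q₂ 0 = 1)
    {s : ℝ} (hs : s ∈ Icc (0 : ℝ) 1) : Q₁ s = Q₂ s := by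
  have h := h₁.star_mul_eq_one hB h₂ h₁0 h₂0 hs
  have h' := mul_star_self_of_star_mul_self (h₁.star_mul_eq_one hB h₁ h₁0 h₁0 hs)
  calc Q₁ s = Q₁ s * (star (Q₁ s) * Q₂ s) := by rw [h, mul_one]
    _ = Q₂ s := by rw [← mul_assoc, h', one_mul]

end LinearODE

/-! ### Parallel transport along segments -/

section Transport

variable {E : Type*} [NormedAddCommGroup E] [NormedSpace ℝ E]
variable {F : Type*} [NormedAddCommGroup F] [InnerProductSpace ℝ F] [FiniteDimensional ℝ F]

local instance : CompleteSpace F := FiniteDimensional.complete ℝ F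

/-- A skew-adjoint connection form of class `C¹` on a whole space. -/
structure IsSkewForm (Γ : E → E →L[ℝ] F →L[ℝ] F) : Prop where
  contDiff : ContDiff ℝ 1 Γ
  skew : ∀ z v, star (Γ z v) = -Γ z v

/-- The coefficient of the parallel transport equation along the segment from `p.1` to `p.2`. -/
def segCoeff (Γ : E → E →L[ℝ] F →L[ℝ] F) (q : (E × E) × ℝ) : F →L[ℝ] F :=
  -Γ (q.1.1 + q.2 • (q.1.2 - q.1.1)) (q.1.2 - q.1.1)

variable {Γ : E → E →L[ℝ] F →L[ℝ] F}

theorem IsSkewForm.contDiff_segCoeff (hΓ : IsSkewForm Γ) : ContDiff ℝ 1 (segCoeff Γ) := by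
  have := hΓ.contDiff
  unfold segCoeff
  fun_prop

theorem IsSkewForm.continuous_segCoeff (hΓ : IsSkewForm Γ) : Continuous (segCoeff Γ) :=
  hΓ.contDiff_segCoeff.continuous

theorem IsSkewForm.star_segCoeff (hΓ : IsSkewForm Γ) (q : (E × E) × ℝ) :
    star (segCoeff Γ q) = -segCoeff Γ q := by
  simp only [segCoeff, star_neg, hΓ.skew]

theorem IsSkewForm.exists_solvesLinear (hΓ : IsSkewForm Γ) (p : E × E) :
    ∃ Q : ℝ → F →L[ℝ] F, Q 0 = 1 ∧ SolvesLinear (fun s => segCoeff Γ (p, s)) Q := by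
  have hc := hΓ.continuous_segCoeff
  exact exists_linear_ode (B := fun s => segCoeff Γ (p, s)) (by fun_prop)

open Classical in
/-- Parallel transport from `p.1` to `p.1 + s • (p.2 - p.1)` along the segment, for `s ∈ [0, 1]`. -/
def segTransport (Γ : E → E →L[ℝ] F →L[ℝ] F) (p : E × E) : ℝ → F →L[ℝ] F :=
  if h : ∃ Q : ℝ → F →L[ℝ] F, Q 0 = 1 ∧ SolvesLinear (fun s => segCoeff Γ (p, s)) Q
  then h.choose else 1

/-- Parallel transport from `p.1` to `p.2` along the segment. -/
def transport (Γ : E → E →L[ℝ] F →L[ℝ] F) (p : E × E) : F →L[ℝ] F := segTransport Γ p 1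

theorem IsSkewForm.segTransport_zero (hΓ : IsSkewForm Γ) (p : E × E) :
    segTransport Γ p 0 = 1 := by
  rw [segTransport, dif_pos (hΓ.exists_solvesLinear p)]
  exact (hΓ.exists_solvesLinear p).choose_spec.1

theorem IsSkewForm.solvesLinear_segTransport (hΓ : IsSkewForm Γ) (p : E × E) :
    SolvesLinear (fun s => segCoeff Γ (p, s)) (segTransport Γ p) := by
  rw [segTransport, dif_pos (hΓ.exists_solvesLinear p)]
  exact (hΓ.exists_solvesLinear p).choose_spec.2

theorem IsSkewForm.segTransport_eq (hΓ : IsSkewForm Γ) {p : E × E} {Q : ℝ → F →L[ℝ] F}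
    (hQ : SolvesLinear (fun s => segCoeff Γ (p, s)) Q) (hQ0 : Q 0 = 1) {s : ℝ}
    (hs : s ∈ Icc (0 : ℝ) 1) : segTransport Γ p s = Q s :=
  (hΓ.solvesLinear_segTransport p).unique (fun _ _ => hΓ.star_segCoeff _) hQ
    (hΓ.segTransport_zero p) hQ0 hs

theorem IsSkewForm.star_mul_segTransport (hΓ : IsSkewForm Γ) (p : E × E) {s : ℝ}
    (hs : s ∈ Icc (0 : ℝ) 1) : star (segTransport Γ p s) * segTransport Γ p s = 1 :=
  (hΓ.solvesLinear_segTransport p).star_mul_eq_one (fun _ _ => hΓ.star_segCoeff _)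
    (hΓ.solvesLinear_segTransport p) (hΓ.segTransport_zero p) (hΓ.segTransport_zero p) hs

theorem IsSkewForm.star_mul_transport (hΓ : IsSkewForm Γ) (p : E × E) :
    star (transport Γ p) * transport Γ p = 1 :=
  hΓ.star_mul_segTransport p ⟨zero_le_one, le_rfl⟩

theorem IsSkewForm.transport_mul_star (hΓ : IsSkewForm Γ) (p : E × E) :
    transport Γ p * star (transport Γ p) = 1 :=
  mul_star_self_of_star_mul_self (hΓ.star_mul_transport p)

theorem IsSkewForm.norm_transport_apply (hΓ : IsSkewForm Γ) (p : E × E) (f : F) :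
    ‖transport Γ p f‖ = ‖f‖ :=
  norm_apply_of_star_mul_self (hΓ.star_mul_transport p) f

/-- Transport along the initial part of a segment. -/
theorem IsSkewForm.transport_initial (hΓ : IsSkewForm Γ) (y z : E) {s : ℝ}
    (hs : s ∈ Icc (0 : ℝ) 1) :
    transport Γ (y, y + s • (z - y)) = segTransport Γ (y, z) s := by
  refine (hΓ.segTransport_eq (Q := fun r => segTransport Γ (y, z) (s * r)) (fun r hr => ?_)
    (by simp [hΓ.segTransport_zero]) ⟨zero_le_one, le_rfl⟩).trans (by simp)
  have hsr : s * r ∈ Icc (0 : ℝ) 1 := ⟨mul_nonneg hs.1 hr.1, mul_le_one₀ hs.2 hr.1 hr.2⟩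
  have h1 : HasDerivWithinAt (fun r : ℝ => s * r) s (Icc 0 1) r := by
    simpa using (hasDerivWithinAt_id r (Icc (0 : ℝ) 1)).const_mul s
  have h2 := (hΓ.solvesLinear_segTransport (y, z) (s * r) hsr).scomp r h1
    (fun t ht => ⟨mul_nonneg hs.1 ht.1, mul_le_one₀ hs.2 ht.1 ht.2⟩)
  refine h2.congr_deriv ?_
  simp only [segCoeff, add_sub_cancel_left, map_smul, neg_mul, smul_neg, smul_mul_assoc, smul_smul]
  rw [mul_comm r s]

theorem IsSkewForm.transport_self (hΓ : IsSkewForm Γ) (y : E) : transport Γ (y, y) = 1 := by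
  have := hΓ.transport_initial y y (s := 0) ⟨le_rfl, zero_le_one⟩
  rwa [hΓ.segTransport_zero, sub_self, smul_zero, add_zero] at this

theorem IsSkewForm.hasDerivWithinAt_transport (hΓ : IsSkewForm Γ) (y z : E) {s : ℝ}
    (hs : s ∈ Icc (0 : ℝ) 1) :
    HasDerivWithinAt (fun s : ℝ => transport Γ (y, y + s • (z - y)))
      (-(Γ (y + s • (z - y)) (z - y)) * transport Γ (y, y + s • (z - y))) (Icc 0 1) s := by
  rw [hΓ.transport_initial y z hs]
  exact (hΓ.solvesLinear_segTransport (y, z) s hs).congr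
    (fun t ht => hΓ.transport_initial y z ht) (hΓ.transport_initial y z hs)

/-- Integrating Duhamel's formula, in which both solutions have norm at most one, avoids any
exponential Gronwall factor. -/
theorem IsSkewForm.norm_transport_sub_le (hΓ : IsSkewForm Γ) (p q : E × E) {C : ℝ}
    (hC : ∀ s ∈ Icc (0 : ℝ) 1, ‖segCoeff Γ (q, s) - segCoeff Γ (p, s)‖ ≤ C) :
    ‖transport Γ q - transport Γ p‖ ≤ C := by
  have h := norm_image_sub_le_of_norm_deriv_le_segment_01'
    (fun s hs => (hΓ.solvesLinear_segTransport p).duhamel (fun _ _ => hΓ.star_segCoeff _)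
      (hΓ.solvesLinear_segTransport q) hs) (C := C) (fun s hs => ?_)
  · simp only [hΓ.segTransport_zero, star_one, mul_one] at h
    have h1 := norm_mul_of_star_mul_self (hΓ.star_mul_transport p)
      (star (transport Γ p) * transport Γ q - 1)
    rw [mul_sub, ← mul_assoc, hΓ.transport_mul_star, one_mul, mul_one] at h1
    rw [h1]
    exact h
  · have hs' : s ∈ Icc (0 : ℝ) 1 := ⟨hs.1, hs.2.le⟩
    have h1 := norm_le_one_of_star_mul_self (hΓ.star_mul_segTransport p hs')
    have h2 := norm_le_one_of_star_mul_self (hΓ.star_mul_segTransport q hs')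
    rw [← norm_star_endomorphism] at h1
    calc _ ≤ ‖star (segTransport Γ p s)‖ *
          (‖segCoeff Γ (q, s) - segCoeff Γ (p, s)‖ * ‖segTransport Γ q s‖) :=
          (norm_mul_le _ _).trans (mul_le_mul_of_nonneg_left (norm_mul_le _ _) (norm_nonneg _))
      _ ≤ 1 * (C * 1) := by
          have := hC s hs'
          have h0 : 0 ≤ C := (norm_nonneg _).trans this
          gcongr
      _ = C := by ring

theorem IsSkewForm.continuous_transport (hΓ : IsSkewForm Γ) : Continuous (transport Γ) := by
  rw [continuous_iff_continuousAt]
  intro p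
  rw [Metric.continuousAt_iff']
  intro ε hε
  have hc := hΓ.continuous_segCoeff
  have hU : {q : (E × E) × ℝ | ‖segCoeff Γ q - segCoeff Γ (p, q.2)‖ < ε / 2} ∈
      nhdsSet ({p} ×ˢ Icc (0 : ℝ) 1) := by
    refine IsOpen.mem_nhdsSet (isOpen_lt (by fun_prop) (by fun_prop)) |>.2 ?_
    rintro ⟨q, s⟩ ⟨hq, -⟩
    obtain rfl : q = p := hq
    simpa using hε
  -- The tube lemma: by compactness of `[0, 1]`, the coefficients for nearby end points are close
  -- uniformly in time.
  rw [isCompact_singleton.nhdsSet_prod_eq isCompact_Icc, nhdsSet_singleton] at hU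
  obtain ⟨U, hU, V, hV, hUV⟩ := Filter.mem_prod_iff.1 hU
  filter_upwards [hU] with q hq
  rw [dist_eq_norm]
  refine (hΓ.norm_transport_sub_le p q (C := ε / 2) fun s hs => ?_).trans_lt (by linarith)
  exact le_of_lt (hUV (show (q, s) ∈ U ×ˢ V from ⟨hq, subset_of_mem_nhdsSet hV hs⟩))

theorem transport_def (Γ : E → E →L[ℝ] F →L[ℝ] F) (p : E × E) :
    transport Γ p = segTransport Γ p 1 := rfl

attribute [irreducible] segTransport transport

end Transport

/-! ### Differentiability of transport, curvature and holonomy -/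

section TransportC1

variable {E : Type*} [NormedAddCommGroup E] [NormedSpace ℝ E]
variable {F : Type*} [NormedAddCommGroup F] [InnerProductSpace ℝ F] [FiniteDimensional ℝ F]

local instance : CompleteSpace F := FiniteDimensional.complete ℝ F

/-- A difference quotient that is continuous at the base point yields the derivative. -/
theorem hasFDerivAt_of_continuousAt_slope {P G : Type*} [NormedAddCommGroup P] [NormedSpace ℝ P]
    [NormedAddCommGroup G] [NormedSpace ℝ G] {f : P → G} {M : P → P →L[ℝ] G} {p : P}
    (hM : ContinuousAt M p) (hf : ∀ q, f q - f p = M q (q - p)) : HasFDerivAt f (M p) p := by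
  rw [hasFDerivAt_iff_isLittleO, Asymptotics.isLittleO_iff]
  intro c hc
  filter_upwards [Metric.continuousAt_iff'.1 hM c hc] with q hq
  rw [hf q, ← sub_apply]
  rw [dist_eq_norm] at hq
  exact ((M q - M p).le_opNorm _).trans (mul_le_mul_of_nonneg_right hq.le (norm_nonneg _))

theorem sub_eq_integral_fderiv {P G : Type*} [NormedAddCommGroup P] [NormedSpace ℝ P]
    [NormedAddCommGroup G] [NormedSpace ℝ G] [CompleteSpace G] {f : P → G} (hf : ContDiff ℝ 1 f)
    (p q : P) : f q - f p = (∫ θ in (0 : ℝ)..1, fderiv ℝ f (p + θ • (q - p))) (q - p) := by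
  have hc := hf.continuous_fderiv one_ne_zero
  rw [ContinuousLinearMap.intervalIntegral_apply
    (Continuous.intervalIntegrable (by fun_prop) _ _)]
  have := intervalIntegral.integral_eq_sub_of_hasDerivAt (a := 0) (b := 1)
    (f := fun θ : ℝ => f (p + θ • (q - p)))
    (f' := fun θ => fderiv ℝ f (p + θ • (q - p)) (q - p)) (fun θ _ => ?_)
    (Continuous.intervalIntegrable (by fun_prop) _ _)
  · simpa using this.symm
  · have h1 : HasDerivAt (fun θ : ℝ => p + θ • (q - p)) (q - p) θ := by
      simpa using ((hasDerivAt_id θ).smul_const (q - p)).const_add p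
    exact ((hf.differentiable one_ne_zero _).hasFDerivAt).comp_hasDerivAt θ h1

theorem continuous_mulLeftRight_comp {Z P P' 𝔸 : Type*} [TopologicalSpace Z]
    [NormedAddCommGroup P] [NormedSpace ℝ P] [NormedAddCommGroup P'] [NormedSpace ℝ P']
    [NormedRing 𝔸] [NormedAlgebra ℝ 𝔸] {a b : Z → 𝔸}
    {D : Z → P →L[ℝ] 𝔸} (ι : P' →L[ℝ] P) (ha : Continuous a) (hb : Continuous b)
    (hD : Continuous D) :
    Continuous fun z => (ContinuousLinearMap.mulLeftRight ℝ 𝔸 (a z) (b z)) ∘L D z ∘L ι :=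
  (((ContinuousLinearMap.mulLeftRight ℝ 𝔸).continuous.comp ha).clm_apply hb).clm_comp
    (hD.clm_comp continuous_const)

theorem continuous_intervalIntegral_param {Z G : Type*} [TopologicalSpace Z]
    [NormedAddCommGroup G] [NormedSpace ℝ G] (f : Z → ℝ → G)
    (hf : Continuous fun a : Z × ℝ => f a.1 a.2) :
    Continuous fun z => ∫ t in (0 : ℝ)..1, f z t :=
  intervalIntegral.continuous_parametric_intervalIntegral_of_continuous' (f := f) hf 0 1

theorem continuous_star_endomorphism : Continuous fun A : F →L[ℝ] F => star A :=
  ContinuousLinearMap.adjoint.continuous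

variable {Γ : E → E →L[ℝ] F →L[ℝ] F}

/-- The integrand of the slope of the transport. -/
def transportSlope (Γ : E → E →L[ℝ] F →L[ℝ] F) (p q : E × E) (r : ℝ) :
    E × E →L[ℝ] F →L[ℝ] F :=
  (ContinuousLinearMap.mulLeftRight ℝ (F →L[ℝ] F)
    (transport Γ p * star (transport Γ (p.1, p.1 + r • (p.2 - p.1))))
    (transport Γ (q.1, q.1 + r • (q.2 - q.1)))) ∘L
    (∫ θ in (0 : ℝ)..1, fderiv ℝ (segCoeff Γ) ((p, r) + θ • ((q, r) - (p, r)))) ∘L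
    ContinuousLinearMap.inl ℝ (E × E) ℝ

theorem IsSkewForm.continuous_transportSlope (hΓ : IsSkewForm Γ) {Z : Type*} [TopologicalSpace Z]
    {p q : Z → E × E} {r : Z → ℝ} (hp : Continuous p) (hq : Continuous q) (hr : Continuous r) :
    Continuous fun a => transportSlope Γ (p a) (q a) (r a) := by
  have h1 := hΓ.continuous_transport
  have h2 := hΓ.contDiff_segCoeff.continuous_fderiv one_ne_zero
  have h3 := continuous_intervalIntegral_param (fun (a : Z) θ =>
    fderiv ℝ (segCoeff Γ) ((p a, r a) + θ • ((q a, r a) - (p a, r a)))) (h2.comp (by fun_prop))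
  have h4 := continuous_star_endomorphism (F := F)
  have h5 : Continuous fun a => transport Γ (p a) *
      star (transport Γ ((p a).1, (p a).1 + r a • ((p a).2 - (p a).1))) :=
    (h1.comp hp).mul (h4.comp (h1.comp (by fun_prop)))
  have h6 : Continuous fun a => transport Γ ((q a).1, (q a).1 + r a • ((q a).2 - (q a).1)) :=
    h1.comp (by fun_prop)
  exact continuous_mulLeftRight_comp _ h5 h6 h3

/-- Duhamel's formula is integrated, and the increment of the coefficient is written as an averaged
derivative applied to `q - p`. The resulting slope is jointly continuous because transport is
already known to be continuous, so the equation need not be differentiated with respect to its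
parameters. -/
theorem IsSkewForm.transport_sub (hΓ : IsSkewForm Γ) (p q : E × E) :
    transport Γ q - transport Γ p = (∫ r in (0 : ℝ)..1, transportSlope Γ p q r) (q - p) := by
  have hc := hΓ.continuous_transport
  have hA := hΓ.continuous_segCoeff
  have h4 := continuous_star_endomorphism (F := F)
  have hsl : Continuous fun r => transportSlope Γ p q r :=
    hΓ.continuous_transportSlope continuous_const continuous_const continuous_id
  rw [ContinuousLinearMap.intervalIntegral_apply (hsl.intervalIntegrable _ _)]
  let g : ℝ → F →L[ℝ] F := fun r => star (transport Γ (p.1, p.1 + r • (p.2 - p.1))) *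
    ((segCoeff Γ (q, r) - segCoeff Γ (p, r)) * transport Γ (q.1, q.1 + r • (q.2 - q.1)))
  have hgc : Continuous g := by fun_prop
  have hd : ∀ s ∈ Icc (0 : ℝ) 1, HasDerivWithinAt
      (fun s => star (segTransport Γ p s) * segTransport Γ q s) (g s) (Icc 0 1) s := by
    intro s hs
    have := (hΓ.solvesLinear_segTransport p).duhamel (fun t _ => hΓ.star_segCoeff _)
      (hΓ.solvesLinear_segTransport q) hs
    refine this.congr_deriv ?_
    simp only [g]
    rw [hΓ.transport_initial p.1 p.2 hs, hΓ.transport_initial q.1 q.2 hs]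
  have h := intervalIntegral.integral_eq_sub_of_hasDerivAt_of_le zero_le_one
    (fun s hs => (hd s hs).continuousWithinAt)
    (fun s hs => (hd s ⟨hs.1.le, hs.2.le⟩).hasDerivAt (Icc_mem_nhds hs.1 hs.2))
    (hgc.intervalIntegrable 0 1)
  rw [hΓ.segTransport_zero, hΓ.segTransport_zero, star_one, one_mul] at h
  have h5 : transport Γ p * (star (transport Γ p) * transport Γ q - 1)
      = transport Γ q - transport Γ p := by
    rw [mul_sub, ← mul_assoc, hΓ.transport_mul_star, one_mul, mul_one]
  rw [← transport_def, ← transport_def] at h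
  rw [← h5, ← h, ← ContinuousLinearMap.mul_apply' ℝ (F →L[ℝ] F) (transport Γ p),
    ← ContinuousLinearMap.intervalIntegral_comp_comm _ (hgc.intervalIntegrable 0 1)]
  congr 1
  ext1 r
  simp only [g, transportSlope, ContinuousLinearMap.mul_apply', ContinuousLinearMap.comp_apply,
    ContinuousLinearMap.mulLeftRight_apply, ContinuousLinearMap.inl_apply]
  rw [sub_eq_integral_fderiv hΓ.contDiff_segCoeff (p, r) (q, r)]
  simp only [Prod.mk_sub_mk, sub_self]
  noncomm_ring

theorem IsSkewForm.hasFDerivAt_transport (hΓ : IsSkewForm Γ) (p : E × E) :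
    HasFDerivAt (transport Γ) (∫ r in (0 : ℝ)..1, transportSlope Γ p p r) p := by
  have hc := continuous_intervalIntegral_param (fun q r => transportSlope Γ p q r)
    (hΓ.continuous_transportSlope continuous_const continuous_fst continuous_snd)
  exact hasFDerivAt_of_continuousAt_slope hc.continuousAt (fun q => hΓ.transport_sub p q)

theorem IsSkewForm.contDiff_transport (hΓ : IsSkewForm Γ) : ContDiff ℝ 1 (transport Γ) := by
  have hc := continuous_intervalIntegral_param (fun q r => transportSlope Γ q q r)
    (hΓ.continuous_transportSlope continuous_fst continuous_fst continuous_snd)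
  exact contDiff_one_iff_hasFDerivAt.2 ⟨_, hc, hΓ.hasFDerivAt_transport⟩

/-- The curvature of a connection form on a whole space. -/
def fullCurvature (Γ : E → E →L[ℝ] F →L[ℝ] F) (z v w : E) : F →L[ℝ] F :=
  fderiv ℝ Γ z v w - fderiv ℝ Γ z w v + Γ z v * Γ z w - Γ z w * Γ z v

/-- Moving the end point by `v` moves the point of parameter `r` by `r • v` and changes the velocity
of the segment by `v`; hence the two terms. -/
theorem IsSkewForm.fderiv_segCoeff_snd (hΓ : IsSkewForm Γ) (y z v : E) (r : ℝ) :
    fderiv ℝ (segCoeff Γ) ((y, z), r) ((0, v), 0) =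
      -(r • fderiv ℝ Γ (y + r • (z - y)) v (z - y) + Γ (y + r • (z - y)) v) := by
  have h1 : HasDerivAt (fun ε : ℝ => (((y, z + ε • v), r) : (E × E) × ℝ)) ((0, v), 0) 0 := by
    refine HasDerivAt.prodMk (HasDerivAt.prodMk (hasDerivAt_const _ _) ?_) (hasDerivAt_const _ _)
    simpa using ((hasDerivAt_id (0 : ℝ)).smul_const v).const_add z
  have h2 : HasDerivAt (fun ε : ℝ => segCoeff Γ ((y, z + ε • v), r))
      (fderiv ℝ (segCoeff Γ) ((y, z), r) ((0, v), 0)) 0 := by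
    have := (hΓ.contDiff_segCoeff.differentiable one_ne_zero ((y, z), r)).hasFDerivAt
    exact HasFDerivAt.comp_hasDerivAt (0 : ℝ) (l := segCoeff Γ) (by simpa using this) h1
  have h3 : HasDerivAt (fun ε : ℝ => y + r • (z + ε • v - y)) (r • v) 0 := by
    have : HasDerivAt (fun ε : ℝ => z + ε • v - y) v 0 := by
      simpa using (((hasDerivAt_id (0 : ℝ)).smul_const v).const_add z).sub_const y
    exact (this.const_smul r).const_add y
  have h4 : HasDerivAt (fun ε : ℝ => z + ε • v - y) v 0 := by
    simpa using (((hasDerivAt_id (0 : ℝ)).smul_const v).const_add z).sub_const y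
  have h5 : HasDerivAt (fun ε : ℝ => Γ (y + r • (z + ε • v - y)))
      (fderiv ℝ Γ (y + r • (z - y)) (r • v)) 0 := by
    have := (hΓ.contDiff.differentiable one_ne_zero (y + r • (z - y))).hasFDerivAt
    exact HasFDerivAt.comp_hasDerivAt (0 : ℝ) (l := Γ) (by simpa using this) h3
  refine h2.unique ((h5.clm_apply h4).neg.congr_deriv ?_)
  simp

/-- Covariant derivative of the radial transport in terms of the curvature. -/
theorem IsSkewForm.covDeriv_transport (hΓ : IsSkewForm Γ) (y z v : E) :
    fderiv ℝ (fun z => transport Γ (y, z)) z v + Γ z v * transport Γ (y, z) =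
      ∫ r in (0 : ℝ)..1, transport Γ (y, z) * star (transport Γ (y, y + r • (z - y))) *
        (r • fullCurvature Γ (y + r • (z - y)) (z - y) v) *
        transport Γ (y, y + r • (z - y)) := by
  have hc := hΓ.continuous_transport
  have hΓc := hΓ.contDiff.continuous
  have hΓd := hΓ.contDiff.continuous_fderiv one_ne_zero
  have h4 := continuous_star_endomorphism (F := F)
  set σ : ℝ → E := fun r => y + r • (z - y) with hσ
  have hσc : Continuous σ := by fun_prop
  set Q : ℝ → F →L[ℝ] F := fun r => transport Γ (y, σ r) with hQ
  have hQc : Continuous Q := by fun_prop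
  -- derivative of the transport
  have e1 : fderiv ℝ (fun z => transport Γ (y, z)) z v = ∫ r in (0 : ℝ)..1,
      transport Γ (y, z) * star (Q r) *
        (-(r • fderiv ℝ Γ (σ r) v (z - y) + Γ (σ r) v)) * Q r := by
    have h1 : HasFDerivAt (fun z : E => (y, z)) (ContinuousLinearMap.inr ℝ E E) z :=
      hasFDerivAt_prodMk_right y z
    have h2 := ((hΓ.hasFDerivAt_transport (y, z)).comp z h1).fderiv
    change fderiv ℝ (fun z => transport Γ (y, z)) z = _ at h2
    have hsl : Continuous fun r => transportSlope Γ (y, z) (y, z) r :=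
      hΓ.continuous_transportSlope continuous_const continuous_const continuous_id
    rw [h2, ContinuousLinearMap.comp_apply, ContinuousLinearMap.inr_apply,
      ContinuousLinearMap.intervalIntegral_apply (hsl.intervalIntegrable _ _)]
    congr 1
    ext1 r
    simp only [transportSlope, ContinuousLinearMap.comp_apply,
      ContinuousLinearMap.mulLeftRight_apply, ContinuousLinearMap.inl_apply, sub_self, smul_zero,
      add_zero, intervalIntegral.integral_const, sub_zero, one_smul]
    rw [hΓ.fderiv_segCoeff_snd]
  -- derivative of the boundary term
  let g : ℝ → F →L[ℝ] F := fun r => star (Q r) * ((r • Γ (σ r) v) * Q r)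
  let g' : ℝ → F →L[ℝ] F := fun r => star (Q r) * (Γ (σ r) v * Q r)
    + r • (star (Q r) * ((Γ (σ r) (z - y) * Γ (σ r) v + fderiv ℝ Γ (σ r) (z - y) v
      - Γ (σ r) v * Γ (σ r) (z - y)) * Q r))
  have hd : ∀ s ∈ Icc (0 : ℝ) 1, HasDerivWithinAt g (g' s) (Icc 0 1) s := by
    intro s hs
    have d1 := hΓ.hasDerivWithinAt_transport y z hs
    have d2 : HasDerivAt (fun s : ℝ => σ s) (z - y) s := by
      simpa [hσ] using ((hasDerivAt_id s).smul_const (z - y)).const_add y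
    have d3 : HasDerivAt (fun s => Γ (σ s)) (fderiv ℝ Γ (σ s) (z - y)) s :=
      ((hΓ.contDiff.differentiable one_ne_zero (σ s)).hasFDerivAt).comp_hasDerivAt s d2
    have d4 : HasDerivAt (fun s => Γ (σ s) v) (fderiv ℝ Γ (σ s) (z - y) v) s := by
      simpa using d3.clm_apply (hasDerivAt_const s v)
    have d5 : HasDerivAt (fun s => s • Γ (σ s) v)
        (s • fderiv ℝ Γ (σ s) (z - y) v + (1 : ℝ) • Γ (σ s) v) s := (hasDerivAt_id s).smul d4
    have d6 : HasDerivWithinAt (fun s => (s • Γ (σ s) v) * transport Γ (y, y + s • (z - y))) _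
      (Icc 0 1) s := d5.hasDerivWithinAt.mul d1
    refine (d1.star.mul d6).congr_deriv ?_
    simp only [g', star_mul, star_neg, hΓ.skew]
    simp only [hQ, hσ, neg_neg, one_smul, mul_add, add_mul, mul_sub, sub_mul, smul_add, smul_sub,
      mul_assoc, smul_mul_assoc, mul_smul_comm, neg_mul, mul_neg]
    abel
  have hg'c : Continuous g' := by fun_prop
  have h := intervalIntegral.integral_eq_sub_of_hasDerivAt_of_le zero_le_one
    (fun s hs => (hd s hs).continuousWithinAt)
    (fun s hs => (hd s ⟨hs.1.le, hs.2.le⟩).hasDerivAt (Icc_mem_nhds hs.1 hs.2))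
    (hg'c.intervalIntegrable 0 1)
  have hg0 : g 0 = 0 := by simp [g]
  have hσ1 : σ 1 = z := by simp [hσ]
  have hg1 : transport Γ (y, z) * g 1 = Γ z v * transport Γ (y, z) := by
    simp only [g, hQ, hσ1, one_smul]
    rw [← mul_assoc, hΓ.transport_mul_star, one_mul]
  rw [hg0, sub_zero] at h
  rw [e1, ← hg1, ← h, ← ContinuousLinearMap.mul_apply' ℝ (F →L[ℝ] F) (transport Γ (y, z)),
    ← ContinuousLinearMap.intervalIntegral_comp_comm _ (hg'c.intervalIntegrable 0 1),
    ← intervalIntegral.integral_add (Continuous.intervalIntegrable (by fun_prop) _ _)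
      (Continuous.intervalIntegrable (by fun_prop) _ _)]
  congr 1
  ext1 r
  -- The undifferentiated terms `Γ (σ r) v` cancel. What remains is `r` times the antisymmetrized
  -- derivative plus the commutator, which is the curvature in the directions `z - y` and `v`.
  simp only [g', ContinuousLinearMap.mul_apply', fullCurvature]
  simp only [mul_add, add_mul, mul_sub, sub_mul, smul_add, smul_sub,
    mul_assoc, smul_mul_assoc, mul_smul_comm, neg_mul, mul_neg, neg_add, hQ, hσ]
  abel

/-- Convexity keeps the segment where curvature is controlled, and the transports in the integrand
are isometries. The weight `r` is simply bounded by one. -/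
theorem IsSkewForm.norm_covDeriv_transport_le (hΓ : IsSkewForm Γ) {S : Set E} (hS : Convex ℝ S)
    {β : ℝ} (hβ : ∀ z ∈ S, ∀ v w, ‖fullCurvature Γ z v w‖ ≤ β * ‖v‖ * ‖w‖) {y z : E} (hy : y ∈ S)
    (hz : z ∈ S) (v : E) :
    ‖fderiv ℝ (fun z => transport Γ (y, z)) z v + Γ z v * transport Γ (y, z)‖ ≤
      β * ‖z - y‖ * ‖v‖ := by
  rw [hΓ.covDeriv_transport]
  refine (intervalIntegral.norm_integral_le_of_norm_le_const (C := β * ‖z - y‖ * ‖v‖)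
    fun r hr => ?_).trans (by simp)
  rw [uIoc_of_le zero_le_one] at hr
  have h0 := norm_le_one_of_star_mul_self (hΓ.star_mul_transport (y, z))
  have h1 := norm_le_one_of_star_mul_self (hΓ.star_mul_transport (y, y + r • (z - y)))
  have h2 := hβ (y + r • (z - y)) (hS.add_smul_sub_mem hy hz ⟨hr.1.le, hr.2⟩) (z - y) v
  have h3 : ‖r • fullCurvature Γ (y + r • (z - y)) (z - y) v‖ ≤ β * ‖z - y‖ * ‖v‖ := by
    rw [norm_smul, Real.norm_eq_abs, abs_of_pos hr.1]
    exact (mul_le_of_le_one_left (norm_nonneg _) hr.2).trans h2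
  have h4 : ‖star (transport Γ (y, y + r • (z - y)))‖ ≤ 1 := by rwa [norm_star_endomorphism]
  have h5 : 0 ≤ β * ‖z - y‖ * ‖v‖ := (norm_nonneg _).trans h3
  calc _ ≤ ‖transport Γ (y, z)‖ * ‖star (transport Γ (y, y + r • (z - y)))‖ *
        ‖r • fullCurvature Γ (y + r • (z - y)) (z - y) v‖ *
        ‖transport Γ (y, y + r • (z - y))‖ := by
        refine (norm_mul_le _ _).trans ?_
        gcongr
        refine (norm_mul_le _ _).trans ?_
        gcongr
        exact norm_mul_le _ _
    _ ≤ 1 * 1 * (β * ‖z - y‖ * ‖v‖) * 1 := by gcongr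
    _ = _ := by ring

/-- The variation of a section along a segment, measured with parallel transport. -/
theorem IsSkewForm.norm_sub_transport_le_integral (hΓ : IsSkewForm Γ) {U : E → F}
    (hU : ContDiff ℝ 1 U) (b c : E) :
    ‖U c - transport Γ (b, c) (U b)‖ ≤ ∫ s in (0 : ℝ)..1,
      ‖fderiv ℝ U (b + s • (c - b)) (c - b)
        + Γ (b + s • (c - b)) (c - b) (U (b + s • (c - b)))‖ := by
  have hc := hΓ.continuous_transport
  have hΓc := hΓ.contDiff.continuous
  have hUc := hU.continuous
  have hUd := hU.continuous_fderiv one_ne_zero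
  have h4 := continuous_star_endomorphism (F := F)
  set σ : ℝ → E := fun r => b + r • (c - b) with hσ
  have hσc : Continuous σ := by fun_prop
  -- Pulled back to `b` by the inverse transport, the section takes values in a fixed space, and its
  -- ordinary derivative is the pulled back covariant derivative.
  let g' : ℝ → F := fun s => star (transport Γ (b, σ s))
    (fderiv ℝ U (σ s) (c - b) + Γ (σ s) (c - b) (U (σ s)))
  have hg'c : Continuous g' := by fun_prop
  have hd : ∀ s ∈ Icc (0 : ℝ) 1, HasDerivWithinAt
      (fun s => star (transport Γ (b, σ s)) (U (σ s))) (g' s) (Icc 0 1) s := by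
    intro s hs
    have d1 := hΓ.hasDerivWithinAt_transport b c hs
    have d2 : HasDerivAt (fun s : ℝ => σ s) (c - b) s := by
      simpa [hσ] using ((hasDerivAt_id s).smul_const (c - b)).const_add b
    have d3 : HasDerivAt (fun s => U (σ s)) (fderiv ℝ U (σ s) (c - b)) s :=
      ((hU.differentiable one_ne_zero (σ s)).hasFDerivAt).comp_hasDerivAt s d2
    refine (d1.star.clm_apply d3.hasDerivWithinAt).congr_deriv ?_
    simp only [g', star_mul, star_neg, hΓ.skew, neg_neg, map_add]
    rw [add_comm]
    rfl
  have h := intervalIntegral.integral_eq_sub_of_hasDerivAt_of_le zero_le_one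
    (fun s hs => (hd s hs).continuousWithinAt)
    (fun s hs => (hd s ⟨hs.1.le, hs.2.le⟩).hasDerivAt (Icc_mem_nhds hs.1 hs.2))
    (hg'c.intervalIntegrable 0 1)
  have hσ1 : σ 1 = c := by simp [hσ]
  have hσ0 : σ 0 = b := by simp [hσ]
  rw [hσ1, hσ0, hΓ.transport_self, star_one] at h
  change _ = star (transport Γ (b, c)) (U c) - U b at h
  have e : U c - transport Γ (b, c) (U b) =
      transport Γ (b, c) (star (transport Γ (b, c)) (U c) - U b) := by
    rw [map_sub]
    have := congrArg (fun A : F →L[ℝ] F => A (U c)) (hΓ.transport_mul_star (b, c))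
    change transport Γ (b, c) (star (transport Γ (b, c)) (U c)) = U c at this
    rw [this]
  rw [e, hΓ.norm_transport_apply, ← h]
  refine (intervalIntegral.norm_integral_le_integral_norm zero_le_one).trans ?_
  refine intervalIntegral.integral_mono_on zero_le_one
    (Continuous.intervalIntegrable (by fun_prop) _ _)
    (Continuous.intervalIntegrable (by fun_prop) _ _) fun s _ => ?_
  have h1 := norm_le_one_of_star_mul_self (hΓ.star_mul_transport (b, σ s))
  rw [← norm_star_endomorphism] at h1
  exact (ContinuousLinearMap.le_opNorm _ _).trans (mul_le_of_le_one_left (norm_nonneg _) h1)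

/-- Holonomy estimate for a triangle. -/
theorem IsSkewForm.norm_transport_sub_comp_le (hΓ : IsSkewForm Γ) {S : Set E} (hS : Convex ℝ S)
    {β : ℝ} (hβ0 : 0 ≤ β) (hβ : ∀ z ∈ S, ∀ v w, ‖fullCurvature Γ z v w‖ ≤ β * ‖v‖ * ‖w‖)
    {a b c : E} (ha : a ∈ S) (hb : b ∈ S) (hc : c ∈ S) {r : ℝ} (hbr : ‖b - a‖ ≤ r)
    (hcr : ‖c - a‖ ≤ r) (f : F) :
    ‖transport Γ (a, c) f - transport Γ (b, c) (transport Γ (a, b) f)‖ ≤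
      β * r * ‖c - b‖ * ‖f‖ := by
  have hT := hΓ.contDiff_transport
  have hU : ContDiff ℝ 1 fun z => transport Γ (a, z) f := by fun_prop
  -- The section here is the radial transport of `f` from `a`, followed along the opposite side from
  -- `b` to `c`. Its covariant derivative there is controlled by curvature times the distance to
  -- `a`.
  refine (hΓ.norm_sub_transport_le_integral hU b c).trans ?_
  suffices h : ∀ s ∈ uIoc (0 : ℝ) 1, ‖‖fderiv ℝ (fun z => transport Γ (a, z) f)
      (b + s • (c - b)) (c - b) + Γ (b + s • (c - b)) (c - b)
        (transport Γ (a, b + s • (c - b)) f)‖‖ ≤ β * r * ‖c - b‖ * ‖f‖ by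
    have := intervalIntegral.norm_integral_le_of_norm_le_const h
    rw [sub_zero, abs_one, mul_one] at this
    exact (le_abs_self _).trans this
  intro s hs
  rw [uIoc_of_le zero_le_one] at hs
  have hs' : s ∈ Icc (0 : ℝ) 1 := ⟨hs.1.le, hs.2⟩
  have hz := hS.add_smul_sub_mem hb hc hs'
  have h1 := hΓ.norm_covDeriv_transport_le hS hβ ha hz (c - b)
  rw [norm_norm]
  have hT' : DifferentiableAt ℝ (fun z => transport Γ (a, z)) (b + s • (c - b)) :=
    (ContDiff.differentiable (n := 1) (by fun_prop) one_ne_zero) _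
  have e : fderiv ℝ (fun z => transport Γ (a, z) f) (b + s • (c - b)) (c - b) =
      fderiv ℝ (fun z => transport Γ (a, z)) (b + s • (c - b)) (c - b) f := by
    have := (hT'.hasFDerivAt.clm_apply (hasFDerivAt_const f (b + s • (c - b)))).fderiv
    rw [this]
    simp
  rw [e]
  have hr : ‖b + s • (c - b) - a‖ ≤ r := by
    have := (convex_closedBall a r).add_smul_sub_mem
      (mem_closedBall_iff_norm.2 hbr) (mem_closedBall_iff_norm.2 hcr) hs'
    exact mem_closedBall_iff_norm.1 this
  refine (ContinuousLinearMap.le_opNorm (fderiv ℝ (fun z => transport Γ (a, z))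
    (b + s • (c - b)) (c - b) + Γ (b + s • (c - b)) (c - b) * transport Γ (a, b + s • (c - b))) f).trans ?_
  refine mul_le_mul_of_nonneg_right (h1.trans ?_) (norm_nonneg _)
  gcongr

end TransportC1

/-! ### Coordinates on the half-space -/

section HalfSpaceGeometry

variable (n : ℕ)

/-- The projection `(x, t) ↦ x`. -/
def horizontal : EuclideanSpace ℝ (Fin (n + 1)) →L[ℝ] EuclideanSpace ℝ (Fin n) :=
  LinearMap.toContinuousLinearMap
    { toFun := fun z => WithLp.toLp 2 fun i => z i.castSucc
      map_add' := fun _ _ => rfl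
      map_smul' := fun _ _ => rfl }

/-- The projection `(x, t) ↦ t`. -/
def height : EuclideanSpace ℝ (Fin (n + 1)) →L[ℝ] ℝ := EuclideanSpace.proj (Fin.last n)

/-- The unit vector `(0, 1)`. -/
def vertical : EuclideanSpace ℝ (Fin (n + 1)) := EuclideanSpace.single (Fin.last n) 1

variable {n}

/-- The point `(x, t)`. -/
def pt (x : EuclideanSpace ℝ (Fin n)) (t : ℝ) : EuclideanSpace ℝ (Fin (n + 1)) :=
  boundaryIncl n x + t • vertical n

theorem horizontal_apply (z : EuclideanSpace ℝ (Fin (n + 1))) (i : Fin n) :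
    horizontal n z i = z i.castSucc := rfl

theorem height_apply (z : EuclideanSpace ℝ (Fin (n + 1))) : height n z = z (Fin.last n) := rfl

theorem boundaryIncl_castSucc (x : EuclideanSpace ℝ (Fin n)) (i : Fin n) :
    boundaryIncl n x i.castSucc = x i := by
  change Fin.snoc (α := fun _ => ℝ) (WithLp.ofLp x) 0 i.castSucc = x i
  simp

theorem boundaryIncl_last (x : EuclideanSpace ℝ (Fin n)) :
    boundaryIncl n x (Fin.last n) = 0 := by
  change Fin.snoc (α := fun _ => ℝ) (WithLp.ofLp x) 0 (Fin.last n) = 0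
  simp

@[simp] theorem height_boundaryIncl (x : EuclideanSpace ℝ (Fin n)) :
    height n (boundaryIncl n x) = 0 := boundaryIncl_last x

@[simp] theorem height_vertical : height n (vertical n) = 1 := by
  simp [height_apply, vertical]

@[simp] theorem horizontal_boundaryIncl (x : EuclideanSpace ℝ (Fin n)) :
    horizontal n (boundaryIncl n x) = x := by
  ext i
  rw [horizontal_apply, boundaryIncl_castSucc]

@[simp] theorem horizontal_vertical : horizontal n (vertical n) = 0 := by
  ext i
  simp [horizontal_apply, vertical]

@[simp] theorem height_pt (x : EuclideanSpace ℝ (Fin n)) (t : ℝ) : height n (pt x t) = t := by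
  simp [pt]

@[simp] theorem horizontal_pt (x : EuclideanSpace ℝ (Fin n)) (t : ℝ) :
    horizontal n (pt x t) = x := by
  simp [pt]

@[simp] theorem pt_zero (x : EuclideanSpace ℝ (Fin n)) : pt x 0 = boundaryIncl n x := by
  simp [pt]

@[simp] theorem pt_horizontal_height (z : EuclideanSpace ℝ (Fin (n + 1))) :
    pt (horizontal n z) (height n z) = z := by
  ext i
  refine Fin.lastCases ?_ (fun j => ?_) i
  · simp [pt, boundaryIncl_last, vertical, height_apply]
  · simp [pt, boundaryIncl_castSucc, vertical, horizontal_apply]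

theorem pt_apply_last (x : EuclideanSpace ℝ (Fin n)) (t : ℝ) : pt x t (Fin.last n) = t :=
  height_pt x t

theorem pt_apply_castSucc (x : EuclideanSpace ℝ (Fin n)) (t : ℝ) (i : Fin n) :
    pt x t i.castSucc = x i := by
  rw [← horizontal_apply, horizontal_pt]

theorem norm_pt_sq (x : EuclideanSpace ℝ (Fin n)) (t : ℝ) : ‖pt x t‖ ^ 2 = ‖x‖ ^ 2 + t ^ 2 := by
  rw [EuclideanSpace.norm_sq_eq, EuclideanSpace.norm_sq_eq, Fin.sum_univ_castSucc]
  simp [pt_apply_last, pt_apply_castSucc]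

@[simp] theorem norm_boundaryIncl (x : EuclideanSpace ℝ (Fin n)) : ‖boundaryIncl n x‖ = ‖x‖ := by
  have := norm_pt_sq x 0
  rw [pt_zero] at this
  exact (sq_eq_sq₀ (norm_nonneg _) (norm_nonneg _)).1 (by simpa using this)

theorem norm_horizontal_le (z : EuclideanSpace ℝ (Fin (n + 1))) : ‖horizontal n z‖ ≤ ‖z‖ := by
  have := norm_pt_sq (horizontal n z) (height n z)
  rw [pt_horizontal_height] at this
  exact (sq_le_sq₀ (norm_nonneg _) (norm_nonneg _)).1 (by nlinarith [sq_nonneg (height n z)])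

theorem abs_height_le (z : EuclideanSpace ℝ (Fin (n + 1))) : |height n z| ≤ ‖z‖ := by
  have := norm_pt_sq (horizontal n z) (height n z)
  rw [pt_horizontal_height] at this
  exact abs_le_of_sq_le_sq (by nlinarith [sq_nonneg (‖horizontal n z‖)]) (norm_nonneg _)

theorem norm_vertical : ‖vertical n‖ = 1 := by simp [vertical]

theorem norm_pt_le (x : EuclideanSpace ℝ (Fin n)) (t : ℝ) : ‖pt x t‖ ≤ ‖x‖ + |t| := by
  refine (norm_add_le _ _).trans ?_
  rw [norm_boundaryIncl, norm_smul, norm_vertical, Real.norm_eq_abs, mul_one]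

theorem continuous_pt : Continuous fun q : EuclideanSpace ℝ (Fin n) × ℝ => pt q.1 q.2 := by
  unfold pt
  fun_prop

theorem pt_sub_pt (x y : EuclideanSpace ℝ (Fin n)) (s t : ℝ) :
    pt x s - pt y t = pt (x - y) (s - t) := by
  simp only [pt, map_sub, sub_smul]
  abel

theorem mem_closedHalfSpace {z : EuclideanSpace ℝ (Fin (n + 1))} :
    z ∈ closedHalfSpace n ↔ 0 ≤ height n z := Iff.rfl

theorem mem_openHalfSpace {z : EuclideanSpace ℝ (Fin (n + 1))} :
    z ∈ openHalfSpace n ↔ 0 < height n z := Iff.rfl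

theorem openHalfSpace_subset : openHalfSpace n ⊆ closedHalfSpace n := fun z hz => by
  rw [mem_openHalfSpace] at hz
  exact mem_closedHalfSpace.2 hz.le

theorem isOpen_openHalfSpace : IsOpen (openHalfSpace n) :=
  isOpen_lt continuous_const (height n).continuous

theorem isClosed_closedHalfSpace : IsClosed (closedHalfSpace n) :=
  isClosed_le continuous_const (height n).continuous

theorem convex_closedHalfSpace : Convex ℝ (closedHalfSpace n) :=
  convex_halfSpace_ge (height n).toLinearMap.isLinear 0

theorem boundaryIncl_mem (x : EuclideanSpace ℝ (Fin n)) : boundaryIncl n x ∈ closedHalfSpace n := by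
  simp [mem_closedHalfSpace]

theorem pt_mem {x : EuclideanSpace ℝ (Fin n)} {t : ℝ} (ht : 0 ≤ t) : pt x t ∈ closedHalfSpace n := by
  simpa [mem_closedHalfSpace] using ht

theorem uniqueDiffOn_closedHalfSpace : UniqueDiffOn ℝ (closedHalfSpace n) := by
  refine uniqueDiffOn_convex convex_closedHalfSpace ⟨vertical n, ?_⟩
  refine interior_maximal openHalfSpace_subset isOpen_openHalfSpace ?_
  simp [mem_openHalfSpace]

end HalfSpaceGeometry

/-! ### Extension by reflection across the boundary -/

section Extension

variable {n : ℕ} {G : Type*} [NormedAddCommGroup G] [NormedSpace ℝ G]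

/-- A `C¹` function on the closed half-space extends by reflection. -/
theorem exists_contDiff_extension {f : EuclideanSpace ℝ (Fin (n + 1)) → G}
    (hf : ContDiffOn ℝ 1 f (closedHalfSpace n)) :
    ∃ g : EuclideanSpace ℝ (Fin (n + 1)) → G, ContDiff ℝ 1 g ∧
      (∀ z ∈ closedHalfSpace n, g z = f z) ∧
      ∀ z, ∃ a ∈ closedHalfSpace n, ∃ b ∈ closedHalfSpace n, g z = (2 : ℝ) • f a - f b := by
  set S := closedHalfSpace n with hS
  let E := EuclideanSpace ℝ (Fin (n + 1))
  -- Below the boundary the extension is `2 f ∘ π - f ∘ ρ`, with `π` the projection to the boundary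
  -- and `ρ` the reflection. Plain even reflection would reverse the normal derivative.
  let π : E →L[ℝ] E := ContinuousLinearMap.id ℝ E - (height n).smulRight (vertical n)
  let ρ : E →L[ℝ] E := ContinuousLinearMap.id ℝ E - (2 : ℝ) • (height n).smulRight (vertical n)
  have hπ : ∀ z, π z = z - height n z • vertical n := fun z => rfl
  have hρ : ∀ z, ρ z = z - (2 : ℝ) • height n z • vertical n := fun z => rfl
  have hπh : ∀ z, height n (π z) = 0 := fun z => by simp [hπ]
  have hρh : ∀ z, height n (ρ z) = -height n z := fun z => by
    simp only [hρ, map_sub, map_smul, height_vertical, smul_eq_mul, mul_one]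
    ring
  have hπS : ∀ z, π z ∈ S := fun z => by rw [hS, mem_closedHalfSpace, hπh]
  have hρS : ∀ z, height n z ≤ 0 → ρ z ∈ S := fun z hz => by
    rw [hS, mem_closedHalfSpace, hρh]
    linarith
  have hπ0 : ∀ z, height n z = 0 → π z = z := fun z hz => by simp [hπ, hz]
  have hρ0 : ∀ z, height n z = 0 → ρ z = z := fun z hz => by simp [hρ, hz]
  let f' := fderivWithin ℝ f S
  have hd : ∀ z ∈ S, HasFDerivWithinAt f (f' z) S z := fun z hz =>
    (hf.differentiableOn one_ne_zero z hz).hasFDerivWithinAt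
  have hdc : ContinuousOn f' S :=
    hf.continuousOn_fderivWithin uniqueDiffOn_closedHalfSpace le_rfl
  let h : E → G := fun z => (2 : ℝ) • f (π z) - f (ρ z)
  let h' : E → E →L[ℝ] G := fun z => (2 : ℝ) • (f' (π z)).comp π - (f' (ρ z)).comp ρ
  let g : E → G := fun z => if 0 ≤ height n z then f z else h z
  let D : E → E →L[ℝ] G := fun z => if 0 ≤ height n z then f' z else h' z
  have hh : ∀ z, height n z = 0 → f z = h z := fun z hz => by
    simp only [h, hπ0 z hz, hρ0 z hz, two_smul]
    abel
  -- The derivatives match because `2 π - ρ` is the identity.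
  have hh' : ∀ z, height n z = 0 → f' z = h' z := fun z hz => by
    simp only [h', hπ0 z hz, hρ0 z hz]
    ext v
    change f' z v = (2 : ℝ) • f' z (π v) - f' z (ρ v)
    rw [← (f' z).map_smul, ← (f' z).map_sub, hπ, hρ]
    congr 1
    module
  have hgS : ∀ z ∈ S, g z = f z := fun z hz => if_pos hz
  have hgN : ∀ z, height n z ≤ 0 → g z = h z := fun z hz => by
    rcases eq_or_lt_of_le hz with hz | hz
    · rw [hgS z (mem_closedHalfSpace.2 hz.ge), hh z hz]
    · exact if_neg (not_le.2 hz)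
  have hDN : ∀ z, height n z ≤ 0 → D z = h' z := fun z hz => by
    rcases eq_or_lt_of_le hz with hz | hz
    · rw [← hh' z hz]
      exact if_pos hz.ge
    · exact if_neg (not_le.2 hz)
  have hNc : IsClosed {z : E | height n z ≤ 0} := isClosed_le (height n).continuous continuous_const
  refine ⟨g, contDiff_one_iff_hasFDerivAt.2 ⟨D, ?_, fun z => ?_⟩, hgS, fun z => ?_⟩
  · refine continuous_if_le continuous_const (height n).continuous hdc ?_ (fun z hz => hh' z hz.symm)
    have c1 : ContinuousOn (fun z => f' (π z)) {z : E | height n z ≤ 0} :=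
      hdc.comp π.continuous.continuousOn fun z _ => hπS z
    have c2 : ContinuousOn (fun z => f' (ρ z)) {z : E | height n z ≤ 0} :=
      hdc.comp ρ.continuous.continuousOn fun z hz => hρS z hz
    exact ((c1.clm_comp continuousOn_const).const_smul (2 : ℝ)).sub
      (c2.clm_comp continuousOn_const)
  -- Differentiability is proved within each of the two closed half-spaces, vacuously off their
  -- closures, and the two cover the space.
  · have h1 : HasFDerivWithinAt g (D z) S z := by
      by_cases hz : z ∈ S
      · have : D z = f' z := if_pos hz
        rw [this]
        exact (hd z hz).congr hgS (hgS z hz)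
      · exact HasFDerivWithinAt.of_notMem_closure (by rwa [isClosed_closedHalfSpace.closure_eq])
    have h2 : HasFDerivWithinAt g (D z) {z : E | height n z ≤ 0} z := by
      by_cases hz : height n z ≤ 0
      · rw [hDN z hz]
        refine HasFDerivWithinAt.congr ?_ hgN (hgN z hz)
        have d1 : HasFDerivWithinAt (fun z => f (π z)) ((f' (π z)).comp π) {z : E | height n z ≤ 0} z :=
          (hd (π z) (hπS z)).comp z π.hasFDerivWithinAt fun z _ => hπS z
        have d2 : HasFDerivWithinAt (fun z => f (ρ z)) ((f' (ρ z)).comp ρ) {z : E | height n z ≤ 0} z :=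
          (hd (ρ z) (hρS z hz)).comp z ρ.hasFDerivWithinAt fun z hz => hρS z hz
        exact (d1.const_smul (2 : ℝ)).sub d2
      · exact HasFDerivWithinAt.of_notMem_closure (by rwa [hNc.closure_eq])
    have h3 := h1.union h2
    have : S ∪ {z : E | height n z ≤ 0} = univ := eq_univ_of_forall fun z => le_total (0 : ℝ) (height n z)
    rwa [this, hasFDerivWithinAt_univ] at h3
  · by_cases hz : z ∈ S
    · refine ⟨z, hz, z, hz, ?_⟩
      rw [hgS z hz, two_smul, add_sub_cancel_right]
    · have hz' : height n z ≤ 0 := (not_le.1 hz).le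
      exact ⟨π z, hπS z, ρ z, hρS z hz', hgN z hz'⟩

theorem fderivWithin_closedHalfSpace_eq {f g : EuclideanSpace ℝ (Fin (n + 1)) → G}
    (hg : ContDiff ℝ 1 g) (hfg : ∀ z ∈ closedHalfSpace n, g z = f z)
    {z : EuclideanSpace ℝ (Fin (n + 1))} (hz : z ∈ closedHalfSpace n) :
    fderivWithin ℝ f (closedHalfSpace n) z = fderiv ℝ g z := by
  rw [← fderivWithin_congr hfg (hfg z hz)]
  exact fderivWithin_eq_fderiv (uniqueDiffOn_closedHalfSpace z hz)
    (hg.differentiable one_ne_zero z)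

end Extension

/-! ### Connection forms on the whole space -/

section ConnectionExtension

variable {n : ℕ} {F : Type*} [NormedAddCommGroup F] [InnerProductSpace ℝ F]
  {Γ Γ' : EuclideanSpace ℝ (Fin (n + 1)) → EuclideanSpace ℝ (Fin (n + 1)) →L[ℝ] F →L[ℝ] F}

/-- The Hilbert-Schmidt norm of the covariant derivative for a form on the whole space. -/
def covNorm (Γ : EuclideanSpace ℝ (Fin (n + 1)) → EuclideanSpace ℝ (Fin (n + 1)) →L[ℝ] F →L[ℝ] F)
    (U : EuclideanSpace ℝ (Fin (n + 1)) → F) (z : EuclideanSpace ℝ (Fin (n + 1))) : ℝ :=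
  hilbertSchmidtNorm (fderiv ℝ U z + (Γ z).flip (U z))

theorem covNorm_nonneg (U : EuclideanSpace ℝ (Fin (n + 1)) → F) (z) : 0 ≤ covNorm Γ U z :=
  Real.sqrt_nonneg _

theorem hilbertSchmidtNorm_covDeriv_eq (he : ∀ z ∈ closedHalfSpace n, Γ' z = Γ z)
    {U V : EuclideanSpace ℝ (Fin (n + 1)) → F} (hV : ContDiff ℝ 1 V)
    (hUV : ∀ z ∈ closedHalfSpace n, V z = U z) {z} (hz : z ∈ closedHalfSpace n) :
    hilbertSchmidtNorm (covDeriv Γ U z) = covNorm Γ' V z := by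
  rw [covDeriv, covNorm, fderivWithin_closedHalfSpace_eq hV hUV hz, he z hz, hUV z hz]

theorem norm_apply_le_hilbertSchmidtNorm {k : ℕ} (T : EuclideanSpace ℝ (Fin k) →L[ℝ] F) (v) :
    ‖T v‖ ≤ ‖v‖ * hilbertSchmidtNorm T := by
  have h1 : T v = ∑ i, v i • T (EuclideanSpace.single i 1) := by
    have : v = ∑ i, v i • EuclideanSpace.single i (1 : ℝ) := by
      ext j
      simp [Finset.sum_apply, Pi.single_apply]
    conv_lhs => rw [this]
    simp only [map_sum, map_smul]
  have h2 : ‖T v‖ ≤ ∑ i, |v i| * ‖T (EuclideanSpace.single i 1)‖ := by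
    rw [h1]
    refine (norm_sum_le _ _).trans (le_of_eq ?_)
    simp [norm_smul]
  refine h2.trans ((Real.sum_mul_le_sqrt_mul_sqrt _ _ _).trans (le_of_eq ?_))
  rw [EuclideanSpace.norm_eq, hilbertSchmidtNorm]
  simp

theorem hilbertSchmidtNorm_le {k : ℕ} {T : EuclideanSpace ℝ (Fin k) →L[ℝ] F} {B : ℝ} (hB : 0 ≤ B)
    (hT : ∀ v, ‖T v‖ ≤ B * ‖v‖) : hilbertSchmidtNorm T ≤ k * B := by
  rw [hilbertSchmidtNorm]
  refine Real.sqrt_le_iff.2 ⟨by positivity, ?_⟩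
  calc ∑ i, ‖T (EuclideanSpace.single i 1)‖ ^ 2 ≤ ∑ _i : Fin k, B ^ 2 := by
        refine Finset.sum_le_sum fun i _ => ?_
        have := hT (EuclideanSpace.single i 1)
        rw [PiLp.norm_single, norm_one, mul_one] at this
        gcongr
    _ = k * B ^ 2 := by simp
    _ ≤ (k * B) ^ 2 := by
        rw [mul_pow]
        refine mul_le_mul_of_nonneg_right ?_ (sq_nonneg B)
        exact_mod_cast Nat.le_self_pow two_ne_zero k

variable [FiniteDimensional ℝ F]

local instance : CompleteSpace F := FiniteDimensional.complete ℝ F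

/-- `Γ` is a skew-adjoint connection form on the whole space whose curvature on the closed
half-space is bounded by `β`. -/
structure HalfSpaceForm
    (Γ : EuclideanSpace ℝ (Fin (n + 1)) → EuclideanSpace ℝ (Fin (n + 1)) →L[ℝ] F →L[ℝ] F)
    (β : ℝ) : Prop extends IsSkewForm Γ where
  nonneg : 0 ≤ β
  curvature_le : ∀ z ∈ closedHalfSpace n, ∀ v w, ‖fullCurvature Γ z v w‖ ≤ β * ‖v‖ * ‖w‖

theorem HalfSpaceForm.mono
    {Γ : EuclideanSpace ℝ (Fin (n + 1)) → EuclideanSpace ℝ (Fin (n + 1)) →L[ℝ] F →L[ℝ] F}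
    {β b : ℝ} (h : HalfSpaceForm Γ β) (hb : β ≤ b) : HalfSpaceForm Γ b :=
  ⟨h.toIsSkewForm, h.nonneg.trans hb, fun z hz v w => (h.curvature_le z hz v w).trans
    (by gcongr)⟩

/-- The reflected form is pointwise a linear combination of values of the original one, so it stays
skew-adjoint. On the closed half-space its full derivative is the derivative within the half-space,
so the curvature, and its bound, are unchanged there. -/
theorem IsMetricConnectionForm.exists_extension
    {Γ : EuclideanSpace ℝ (Fin (n + 1)) → EuclideanSpace ℝ (Fin (n + 1)) →L[ℝ] F →L[ℝ] F}
    (hΓ : IsMetricConnectionForm Γ) {β : ℝ≥0} (hβ : curvatureSupNorm Γ ≤ β) :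
    ∃ Γ', HalfSpaceForm Γ' (β : ℝ) ∧ ∀ z ∈ closedHalfSpace n, Γ' z = Γ z := by
  obtain ⟨Γ', hc, he, hr⟩ := exists_contDiff_extension hΓ.contDiffOn
  refine ⟨Γ', ⟨⟨hc, fun z v => ?_⟩, β.2, fun z hz v w => ?_⟩, he⟩
  · obtain ⟨a, ha, b, hb, h⟩ := hr z
    rw [h]
    simp only [sub_apply, smul_apply, star_sub, star_smul,
      star_eq_neg_of_mem_orthogonalLieAlgebra (hΓ.mem_orthogonal a ha v),
      star_eq_neg_of_mem_orthogonalLieAlgebra (hΓ.mem_orthogonal b hb v), star_trivial]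
    module
  · have hcurv : ∀ v w, fullCurvature Γ' z v w = curvature Γ z v w := fun v w => by
      rw [fullCurvature, curvature, fderivWithin_closedHalfSpace_eq hc he hz, he z hz]
      rfl
    have h1 : ∀ v ∈ Metric.closedBall (0 : EuclideanSpace ℝ (Fin (n + 1))) 1,
        ∀ w ∈ Metric.closedBall (0 : EuclideanSpace ℝ (Fin (n + 1))) 1,
        ‖fullCurvature Γ' z v w‖ ≤ β := by
      intro v hv w hw
      have : ‖curvature Γ z v w‖ₑ ≤ β := by
        refine le_trans ?_ hβ
        exact le_iSup₂_of_le z hz (le_iSup₂_of_le v hv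
          (le_iSup₂ (f := fun w (_ : w ∈ Metric.closedBall _ _) => ‖curvature Γ z v w‖ₑ) w hw))
      rw [hcurv]
      rw [enorm_eq_nnnorm] at this
      exact_mod_cast this
    -- Bilinearity turns the supremum over unit balls into a bound for all vectors.
    have hsm : ∀ (a b : ℝ) v w, fullCurvature Γ' z (a • v) (b • w) =
        (a * b) • fullCurvature Γ' z v w := fun a b v w => by
      simp only [fullCurvature, map_smul, smul_apply, smul_mul_smul_comm, mul_comm b a, smul_smul]
      module
    by_cases hv : v = 0
    · have := hsm 0 1 v w
      simp only [zero_smul, one_smul, zero_mul] at this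
      subst hv
      simp [this]
    by_cases hw : w = 0
    · have := hsm 1 0 v w
      simp only [zero_smul, one_smul, mul_zero] at this
      subst hw
      simp [this]
    have hv' := norm_ne_zero_iff.2 hv
    have hw' := norm_ne_zero_iff.2 hw
    have := hsm ‖v‖ ‖w‖ (‖v‖⁻¹ • v) (‖w‖⁻¹ • w)
    rw [smul_inv_smul₀ hv', smul_inv_smul₀ hw'] at this
    rw [this, norm_smul, norm_mul, norm_norm, norm_norm]
    have h2 := h1 (‖v‖⁻¹ • v) (by simp [norm_smul, hv']) (‖w‖⁻¹ • w) (by simp [norm_smul, hw'])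
    calc ‖v‖ * ‖w‖ * _ ≤ ‖v‖ * ‖w‖ * β := by gcongr
      _ = _ := by ring

/-- The two conventions differ by reversing time: the solution with terminal value the identity at
`y`, read at parameter `1 - t`, is the transport that starts at `y`. Boundary segments stay in the
boundary, where both forms coincide. -/
theorem IsSkewForm.parallelTransport_boundaryForm (hΓ : IsSkewForm Γ')
    (he : ∀ z ∈ closedHalfSpace n, Γ' z = Γ z) (x y : EuclideanSpace ℝ (Fin n)) :
    parallelTransport (boundaryForm Γ) x y =
      transport Γ' (boundaryIncl n y, boundaryIncl n x) := by
  have hb : boundaryForm Γ = fun x => (Γ' (boundaryIncl n x)).comp (boundaryIncl n) := by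
    ext1 x
    rw [boundaryForm, he _ (boundaryIncl_mem x)]
  have hc : Continuous (boundaryForm Γ) := by
    have := hΓ.contDiff.continuous
    rw [hb]
    fun_prop
  have hs := hΓ.solvesLinear_segTransport (boundaryIncl n y, boundaryIncl n x)
  rw [parallelTransport_eq hc (P := fun t => segTransport Γ' (boundaryIncl n y, boundaryIncl n x)
    (1 - t)) ?_, sub_zero, transport_def]
  refine ⟨fun t ht => ?_, ?_⟩
  · have ht' : 1 - t ∈ Icc (0 : ℝ) 1 := ⟨by linarith [ht.2], by linarith [ht.1]⟩
    have h1 : HasDerivWithinAt (fun s : ℝ => 1 - s) (-1) (Icc 0 1) t := by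
      simpa using (hasDerivWithinAt_id t (Icc (0 : ℝ) 1)).const_sub 1
    have h2 := (hs (1 - t) ht').scomp t h1 (fun s hs => ⟨by linarith [hs.2], by linarith [hs.1]⟩)
    refine h2.congr_deriv ?_
    have e : boundaryIncl n y + (1 - t) • boundaryIncl n (x - y) =
        boundaryIncl n ((1 - t) • x + t • y) := by
      simp only [map_add, map_smul, map_sub]
      module
    rw [hb]
    simp only [segCoeff, ← map_sub, ContinuousLinearMap.comp_apply]
    rw [e, ← neg_sub x y, map_neg, map_neg, neg_one_smul, neg_mul, neg_neg,
      ContinuousLinearMap.neg_comp, neg_neg]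
    rfl
  · simp [hΓ.segTransport_zero, ContinuousLinearMap.one_def]

theorem IsSkewForm.continuous_covNorm (hΓ : IsSkewForm Γ)
    {U : EuclideanSpace ℝ (Fin (n + 1)) → F} (hU : ContDiff ℝ 1 U) :
    Continuous (covNorm Γ U) := by
  have h1 := hU.continuous
  have h2 := hU.continuous_fderiv one_ne_zero
  have h3 := hΓ.contDiff.continuous
  unfold covNorm hilbertSchmidtNorm
  simp only [add_apply, ContinuousLinearMap.flip_apply]
  fun_prop

end ConnectionExtension

/-! ### Integration over the half-space and polar coordinates -/

section HalfSpaceMeasure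

variable {n : ℕ}

theorem measurePreserving_pt :
    MeasurePreserving (fun q : EuclideanSpace ℝ (Fin n) × ℝ => pt q.1 q.2) := by
  have h1 : MeasurePreserving (fun q : EuclideanSpace ℝ (Fin n) × ℝ => (q.2, WithLp.ofLp q.1)) :=
    Measure.measurePreserving_swap.comp
      ((PiLp.volume_preserving_ofLp (Fin n)).prod (MeasurePreserving.id volume))
  have h2 := (volume_preserving_piFinSuccAbove (fun _ : Fin (n + 1) => ℝ) (Fin.last n)).symm
  have h3 := PiLp.volume_preserving_toLp (Fin (n + 1))
  have h := h3.comp (h2.comp h1)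
  convert h using 1
  ext1 q
  ext i
  refine Fin.lastCases ?_ (fun j => ?_) i
  · rw [pt_apply_last]
    simp [MeasurableEquiv.piFinSuccAbove]
  · rw [pt_apply_castSucc]
    simp [MeasurableEquiv.piFinSuccAbove]

theorem lintegral_openHalfSpace {f : EuclideanSpace ℝ (Fin (n + 1)) → ℝ≥0∞} (hf : Measurable f) :
    ∫⁻ z in openHalfSpace n, f z = ∫⁻ t in Ioi (0 : ℝ), ∫⁻ x, f (pt x t) := by
  have hc := continuous_pt (n := n)
  have hpre : (fun q : EuclideanSpace ℝ (Fin n) × ℝ => pt q.1 q.2) ⁻¹' openHalfSpace n =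
      univ ×ˢ Ioi 0 := by
    ext q
    simp [mem_openHalfSpace]
  have h := (measurePreserving_pt (n := n)).restrict_preimage isOpen_openHalfSpace.measurableSet
  rw [← h.lintegral_comp hf, hpre, Measure.volume_eq_prod, ← Measure.prod_restrict,
    Measure.restrict_univ]
  exact lintegral_prod_symm' _ (hf.comp hc.measurable)

/-- Polar coordinates for the integral of a radial function. -/
theorem lintegral_fun_norm {X : Type*} [NormedAddCommGroup X] [NormedSpace ℝ X]
    [FiniteDimensional ℝ X] [MeasurableSpace X] [BorelSpace X] [Nontrivial X] (μ : Measure X)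
    [μ.IsAddHaarMeasure] {f : ℝ → ℝ≥0∞} (hf : Measurable f) :
    ∫⁻ x, f ‖x‖ ∂μ = μ.toSphere univ *
      ∫⁻ r in Ioi (0 : ℝ), ENNReal.ofReal (r ^ (Module.finrank ℝ X - 1)) * f r :=
  calc
    ∫⁻ x, f ‖x‖ ∂μ = ∫⁻ x : ({(0)}ᶜ : Set X), f ‖x.1‖ ∂(μ.comap (↑)) := by
      rw [lintegral_subtype_comap (measurableSet_singleton _).compl fun x ↦ f ‖x‖,
        restrict_compl_singleton]
    _ = ∫⁻ x, f x.2 ∂μ.toSphere.prod (.volumeIoiPow (Module.finrank ℝ X - 1)) := by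
      simpa using μ.measurePreserving_homeomorphUnitSphereProd.lintegral_comp_emb
        (Homeomorph.measurableEmbedding _) (f ∘ Subtype.val ∘ Prod.snd)
    _ = μ.toSphere univ * ∫⁻ x : Ioi (0 : ℝ), f x ∂.volumeIoiPow (Module.finrank ℝ X - 1) := by
      rw [lintegral_prod _ (by fun_prop)]
      simp only [lintegral_const, mul_comm]
    _ = _ := by
      rw [Measure.volumeIoiPow, lintegral_withDensity_eq_lintegral_mul _ (by fun_prop)
        (by fun_prop)]
      congr 1
      exact lintegral_subtype_comap measurableSet_Ioi
        fun r : ℝ => ENNReal.ofReal (r ^ (Module.finrank ℝ X - 1)) * f r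

theorem lintegral_Ioi_rpow {a c : ℝ} (ha : a < -1) (hc : 0 < c) :
    ∫⁻ t in Ioi c, ENNReal.ofReal (t ^ a) = ENNReal.ofReal (c ^ (a + 1) / (-a - 1)) := by
  rw [← ofReal_integral_eq_lintegral_ofReal (integrableOn_Ioi_rpow_of_lt ha hc)
    ((ae_restrict_mem measurableSet_Ioi).mono fun t ht =>
      Real.rpow_nonneg (hc.le.trans (le_of_lt ht)) _), integral_Ioi_rpow_of_lt ha hc]
  congr 1
  rw [← neg_add', neg_div, div_neg]

theorem lintegral_Ioc_rpow {a c : ℝ} (ha : -1 < a) (hc : 0 ≤ c) :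
    ∫⁻ t in Ioc 0 c, ENNReal.ofReal (t ^ a) = ENNReal.ofReal (c ^ (a + 1) / (a + 1)) := by
  have h := intervalIntegral.intervalIntegrable_rpow' (a := 0) (b := c) ha
  rw [intervalIntegrable_iff_integrableOn_Ioc_of_le hc] at h
  rw [← ofReal_integral_eq_lintegral_ofReal h
    ((ae_restrict_mem measurableSet_Ioc).mono fun t ht => Real.rpow_nonneg ht.1.le _),
    ← intervalIntegral.integral_of_le hc, integral_rpow (Or.inl ha), Real.zero_rpow (by linarith),
    sub_zero]

theorem lintegral_Ioi_comp_mul {f : ℝ → ℝ≥0∞} {a : ℝ} (ha : 0 < a) :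
    ∫⁻ r in Ioi (0 : ℝ), f (a * r) = ENNReal.ofReal a⁻¹ * ∫⁻ r in Ioi (0 : ℝ), f r := by
  have h := MeasureTheory.lintegral_image_eq_lintegral_abs_deriv_mul (s := Ioi (0 : ℝ))
    measurableSet_Ioi (f := fun r => a * r) (f' := fun _ => a)
    (fun x _ => by simpa using ((hasDerivAt_id x).const_mul a).hasDerivWithinAt)
    (fun x _ y _ hxy => mul_left_cancel₀ ha.ne' hxy) f
  have himg : (fun r => a * r) '' Ioi (0 : ℝ) = Ioi 0 := by
    rw [image_mul_left_Ioi ha, mul_zero]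
  rw [himg, lintegral_const_mul' _ _ ENNReal.ofReal_ne_top, abs_of_pos ha] at h
  rw [h, ← mul_assoc, ← ENNReal.ofReal_mul (by positivity), inv_mul_cancel₀ ha.ne',
    ENNReal.ofReal_one, one_mul]

end HalfSpaceMeasure

/-! ### Hölder and power inequalities -/

section Inequalities

/-- Jensen's inequality for a finite measure. -/
theorem rpow_lintegral_le {α : Type*} [MeasurableSpace α] (μ : Measure α) {p : ℝ} (hp : 1 < p)
    {f : α → ℝ≥0∞} (hf : AEMeasurable f μ) :
    (∫⁻ a, f a ∂μ) ^ p ≤ μ univ ^ (p - 1) * ∫⁻ a, f a ^ p ∂μ := by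
  have hp0 : 0 < p := by linarith
  have hpq := Real.HolderConjugate.conjExponent hp
  have h := ENNReal.lintegral_mul_le_Lp_mul_Lq μ hpq hf (aemeasurable_const (b := (1 : ℝ≥0∞)))
  simp only [Pi.mul_apply, mul_one, ENNReal.one_rpow, lintegral_const, one_mul] at h
  calc _ ≤ ((∫⁻ a, f a ^ p ∂μ) ^ (1 / p) * μ univ ^ (1 / p.conjExponent)) ^ p := by gcongr
    _ = _ := by
      rw [ENNReal.mul_rpow_of_nonneg _ _ hp0.le, ← ENNReal.rpow_mul, ← ENNReal.rpow_mul,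
        one_div_mul_cancel hp0.ne', ENNReal.rpow_one, mul_comm]
      congr 2
      rw [Real.conjExponent]
      field_simp

/-- A weighted Hölder inequality on `(0, 1]`. -/
theorem rpow_lintegral_Ioc_le {p : ℝ} (hp : 1 < p) {f : ℝ → ℝ≥0∞} (hf : Measurable f) :
    (∫⁻ s in Ioc (0 : ℝ) 1, f s) ^ p ≤ 2 ^ (p - 1) *
      ∫⁻ s in Ioc (0 : ℝ) 1, ENNReal.ofReal (s ^ ((p - 1) / 2)) * f s ^ p := by
  have hp0 : 0 < p := by linarith
  have hpq := Real.HolderConjugate.conjExponent hp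
  set q := p.conjExponent with hq
  have hq' : q = p / (p - 1) := rfl
  have hp1 : p - 1 ≠ 0 := by linarith
  -- With this exponent the dual factor is the integral of `s ^ (-1/2)`, equal to `2`, while the
  -- weight `s ^ ((p - 1) / 2)` left on `f` is strong enough to absorb a later factor `s⁻¹`.
  set a : ℝ := (p - 1) / (2 * p) with ha
  have h := ENNReal.lintegral_mul_le_Lp_mul_Lq (volume.restrict (Ioc (0 : ℝ) 1)) hpq
    (f := fun s => ENNReal.ofReal (s ^ a) * f s) (g := fun s => ENNReal.ofReal (s ^ (-a)))
    (by fun_prop) (by fun_prop)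
  have e1 : ∫⁻ s in Ioc (0 : ℝ) 1, ((fun s => ENNReal.ofReal (s ^ a) * f s) *
      fun s => ENNReal.ofReal (s ^ (-a))) s = ∫⁻ s in Ioc (0 : ℝ) 1, f s := by
    refine setLIntegral_congr_fun measurableSet_Ioc fun s hs => ?_
    simp only [Pi.mul_apply]
    rw [mul_right_comm, ← ENNReal.ofReal_mul (Real.rpow_nonneg hs.1.le _),
      ← Real.rpow_add hs.1, add_neg_cancel, Real.rpow_zero, ENNReal.ofReal_one, one_mul]
  have e2 : ∫⁻ s in Ioc (0 : ℝ) 1, (ENNReal.ofReal (s ^ a) * f s) ^ p =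
      ∫⁻ s in Ioc (0 : ℝ) 1, ENNReal.ofReal (s ^ ((p - 1) / 2)) * f s ^ p := by
    refine setLIntegral_congr_fun measurableSet_Ioc fun s hs => ?_
    rw [ENNReal.mul_rpow_of_nonneg _ _ hp0.le,
      ENNReal.ofReal_rpow_of_nonneg (Real.rpow_nonneg hs.1.le _) hp0.le, ← Real.rpow_mul hs.1.le]
    have : a * p = (p - 1) / 2 := by
      rw [ha]
      field_simp
    rw [this]
  have e3 : ∫⁻ s in Ioc (0 : ℝ) 1, ENNReal.ofReal (s ^ (-a)) ^ q = 2 := by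
    have : ∫⁻ s in Ioc (0 : ℝ) 1, ENNReal.ofReal (s ^ (-a)) ^ q =
        ∫⁻ s in Ioc (0 : ℝ) 1, ENNReal.ofReal (s ^ (-(1 / 2) : ℝ)) := by
      refine setLIntegral_congr_fun measurableSet_Ioc fun s hs => ?_
      rw [ENNReal.ofReal_rpow_of_nonneg (Real.rpow_nonneg hs.1.le _) hpq.symm.nonneg,
        ← Real.rpow_mul hs.1.le]
      congr 2
      rw [ha, hq']
      field_simp
    rw [this, lintegral_Ioc_rpow (by norm_num) zero_le_one]
    norm_num
  rw [e1, e2, e3] at h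
  calc _ ≤ ((∫⁻ s in Ioc (0 : ℝ) 1, ENNReal.ofReal (s ^ ((p - 1) / 2)) * f s ^ p) ^ (1 / p) *
        2 ^ (1 / q)) ^ p := by gcongr
    _ = _ := by
      rw [ENNReal.mul_rpow_of_nonneg _ _ hp0.le, ← ENNReal.rpow_mul, ← ENNReal.rpow_mul,
        one_div_mul_cancel hp0.ne', ENNReal.rpow_one, mul_comm]
      congr 2
      rw [hq']
      field_simp

theorem rpow_add_le_two_rpow_mul (a b : ℝ≥0∞) {p : ℝ} (hp : 0 < p) :
    (a + b) ^ p ≤ 2 ^ p * (a ^ p + b ^ p) := by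
  wlog h : a ≤ b
  · rw [add_comm a b, add_comm (a ^ p)]
    exact this b a hp (le_of_not_ge h)
  calc (a + b) ^ p ≤ (2 * b) ^ p := by
        rw [two_mul]
        gcongr
    _ = 2 ^ p * b ^ p := ENNReal.mul_rpow_of_nonneg _ _ hp.le
    _ ≤ _ := by gcongr; exact le_add_self

theorem rpow_add_add_le (a b c : ℝ≥0∞) {p : ℝ} (hp : 0 < p) :
    (a + b + c) ^ p ≤ 4 ^ p * (a ^ p + b ^ p + c ^ p) := by
  have h2 : (2 : ℝ≥0∞) ^ p * 2 ^ p = 4 ^ p := by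
    rw [← ENNReal.mul_rpow_of_nonneg _ _ hp.le]
    norm_num
  calc (a + b + c) ^ p ≤ 2 ^ p * ((a + b) ^ p + c ^ p) := rpow_add_le_two_rpow_mul _ _ hp
    _ ≤ 2 ^ p * (2 ^ p * (a ^ p + b ^ p) + 2 ^ p * c ^ p) := by
        gcongr
        · exact rpow_add_le_two_rpow_mul _ _ hp
        · exact le_mul_of_one_le_left zero_le (ENNReal.one_le_rpow (by norm_num) hp)
    _ = _ := by rw [← h2]; ring

end Inequalities

/-! ### Energies, and the pointwise trace estimate -/

section Energies

variable {n : ℕ} {F : Type*} [NormedAddCommGroup F] [InnerProductSpace ℝ F]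

/-- The covariant difference `|u(x) - R(x, y) u(y)|`. -/
def osc (Γ : EuclideanSpace ℝ (Fin (n + 1)) → EuclideanSpace ℝ (Fin (n + 1)) →L[ℝ] F →L[ℝ] F)
    (u : EuclideanSpace ℝ (Fin n) → F) (x y : EuclideanSpace ℝ (Fin n)) : ℝ≥0∞ :=
  ‖u x - transport Γ (boundaryIncl n y, boundaryIncl n x) (u y)‖ₑ

/-- The `p`-th power of the Gagliardo seminorm. -/
def gagEnergy (p : ℝ)
    (Γ : EuclideanSpace ℝ (Fin (n + 1)) → EuclideanSpace ℝ (Fin (n + 1)) →L[ℝ] F →L[ℝ] F)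
    (u : EuclideanSpace ℝ (Fin n) → F) : ℝ≥0∞ :=
  ∫⁻ x, ∫⁻ y, osc Γ u x y ^ p / ‖x - y‖ₑ ^ ((n : ℝ) + p - 1)

/-- The `p`-th power of the `L^p` norm on the half-space. -/
def halfEnergy (p : ℝ) {G : Type*} [NormedAddCommGroup G] (U : EuclideanSpace ℝ (Fin (n + 1)) → G) :
    ℝ≥0∞ :=
  ∫⁻ z in openHalfSpace n, ‖U z‖ₑ ^ p

/-- The `p`-th power of the `L^p` norm. -/
def lpEnergy (p : ℝ) (u : EuclideanSpace ℝ (Fin n) → F) : ℝ≥0∞ := ∫⁻ x, ‖u x‖ₑ ^ p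

theorem eLpNorm_eq_lintegral {α G : Type*} [MeasurableSpace α] {μ : Measure α}
    [NormedAddCommGroup G] {p : ℝ} (hp : 0 < p) (f : α → G) :
    eLpNorm f (ENNReal.ofReal p) μ = (∫⁻ a, ‖f a‖ₑ ^ p ∂μ) ^ (1 / p) := by
  rw [eLpNorm_eq_eLpNorm' (by simpa using hp) ENNReal.ofReal_ne_top, ENNReal.toReal_ofReal hp.le,
    eLpNorm'_eq_lintegral_enorm]

variable {Γ Γ' : EuclideanSpace ℝ (Fin (n + 1)) → EuclideanSpace ℝ (Fin (n + 1)) →L[ℝ] F →L[ℝ] F}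

theorem halfEnergy_congr {p : ℝ} {G : Type*} [NormedAddCommGroup G]
    {U V : EuclideanSpace ℝ (Fin (n + 1)) → G} (h : ∀ z ∈ closedHalfSpace n, ‖U z‖ = ‖V z‖) :
    halfEnergy p U = halfEnergy p V :=
  setLIntegral_congr_fun isOpen_openHalfSpace.measurableSet fun z hz => by
    simp only [enorm_eq_iff_norm_eq.2 (h z (openHalfSpace_subset hz))]

/-- Both terms depend only on values on the closed half-space, including the derivative within it,
so they can be computed with extensions to the whole space. -/
theorem interiorNorm_eq {p : ℝ} (hp : 0 < p) (β : ℝ≥0)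
    (he : ∀ z ∈ closedHalfSpace n, Γ' z = Γ z)
    {U V : EuclideanSpace ℝ (Fin (n + 1)) → F} (hV : ContDiff ℝ 1 V)
    (hUV : ∀ z ∈ closedHalfSpace n, V z = U z) :
    interiorNorm p β Γ U = halfEnergy p (covNorm Γ' V) ^ (1 / p) +
      ((β ^ (1 / 2 : ℝ) : ℝ≥0) : ℝ≥0∞) * halfEnergy p V ^ (1 / p) := by
  rw [interiorNorm, eLpNorm_eq_lintegral hp, eLpNorm_eq_lintegral hp]
  have h1 : halfEnergy p (fun z => hilbertSchmidtNorm (covDeriv Γ U z)) =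
      halfEnergy p (covNorm Γ' V) :=
    halfEnergy_congr fun z hz => by rw [hilbertSchmidtNorm_covDeriv_eq he hV hUV hz]
  have h2 : halfEnergy p U = halfEnergy p V := halfEnergy_congr fun z hz => by rw [hUV z hz]
  rw [← h1, ← h2]
  rfl

variable [FiniteDimensional ℝ F]

theorem IsSkewForm.gagliardoSeminorm_eq (hΓ : IsSkewForm Γ') {p : ℝ} (hp : 0 < p)
    (he : ∀ z ∈ closedHalfSpace n, Γ' z = Γ z) (u : EuclideanSpace ℝ (Fin n) → F) :
    gagliardoSeminorm (1 - 1 / p) p (boundaryForm Γ) u = gagEnergy p Γ' u ^ (1 / p) := by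
  simp only [gagliardoSeminorm, gagEnergy, osc, hΓ.parallelTransport_boundaryForm he]
  have : (n : ℝ) + (1 - 1 / p) * p = n + p - 1 := by
    field_simp
    ring
  rw [this]

theorem IsSkewForm.boundaryNorm_eq (hΓ : IsSkewForm Γ') {p : ℝ} (hp : 0 < p) (β : ℝ≥0)
    (he : ∀ z ∈ closedHalfSpace n, Γ' z = Γ z) (u : EuclideanSpace ℝ (Fin n) → F) :
    boundaryNorm p β Γ u = gagEnergy p Γ' u ^ (1 / p) +
      ((β ^ ((p - 1) / (2 * p)) : ℝ≥0) : ℝ≥0∞) * lpEnergy p u ^ (1 / p) := by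
  rw [boundaryNorm, hΓ.gagliardoSeminorm_eq hp he, eLpNorm_eq_lintegral hp]
  rfl

theorem IsSkewForm.continuous_oscReal (hΓ : IsSkewForm Γ) {u : EuclideanSpace ℝ (Fin n) → F}
    (hu : Continuous u) : Continuous fun q : EuclideanSpace ℝ (Fin n) × EuclideanSpace ℝ (Fin n) =>
      u q.1 - transport Γ (boundaryIncl n q.2, boundaryIncl n q.1) (u q.2) := by
  have := hΓ.continuous_transport
  fun_prop

theorem IsSkewForm.measurable_osc (hΓ : IsSkewForm Γ) {u : EuclideanSpace ℝ (Fin n) → F}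
    (hu : Continuous u) : Measurable fun q : EuclideanSpace ℝ (Fin n) × EuclideanSpace ℝ (Fin n) =>
      osc Γ u q.1 q.2 :=
  (hΓ.continuous_oscReal hu).enorm.measurable

/-- The variation of a section along a segment, in terms of the Hilbert-Schmidt norm. -/
theorem IsSkewForm.enorm_sub_transport_le (hΓ : IsSkewForm Γ)
    {U : EuclideanSpace ℝ (Fin (n + 1)) → F} (hU : ContDiff ℝ 1 U)
    (b c : EuclideanSpace ℝ (Fin (n + 1))) :
    ‖U c - transport Γ (b, c) (U b)‖ₑ ≤
      ‖c - b‖ₑ * ∫⁻ s in Ioc (0 : ℝ) 1, ‖covNorm Γ U (b + s • (c - b))‖ₑ := by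
  have hg := hΓ.continuous_covNorm hU
  have h1 := hΓ.norm_sub_transport_le_integral hU b c
  have hUc := hU.continuous
  have hUd := hU.continuous_fderiv one_ne_zero
  have hΓc := hΓ.contDiff.continuous
  have h2 : ‖U c - transport Γ (b, c) (U b)‖ ≤
      ∫ s in (0 : ℝ)..1, ‖c - b‖ * covNorm Γ U (b + s • (c - b)) := by
    refine h1.trans (intervalIntegral.integral_mono_on zero_le_one
      (Continuous.intervalIntegrable (by fun_prop) _ _)
      (Continuous.intervalIntegrable (by fun_prop) _ _) fun s _ => ?_)
    exact norm_apply_le_hilbertSchmidtNorm (fderiv ℝ U (b + s • (c - b)) +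
      (Γ (b + s • (c - b))).flip (U (b + s • (c - b)))) (c - b)
  rw [intervalIntegral.integral_of_le zero_le_one] at h2
  rw [← lintegral_const_mul' _ _ enorm_ne_top, ← ofReal_norm]
  refine (ENNReal.ofReal_le_ofReal h2).trans (le_of_eq ?_)
  rw [ofReal_integral_eq_lintegral_ofReal]
  · refine lintegral_congr fun s => ?_
    rw [ENNReal.ofReal_mul (norm_nonneg _), ofReal_norm, Real.enorm_of_nonneg (covNorm_nonneg _ _)]
  · exact (Continuous.integrableOn_Icc (by fun_prop)).mono_set Ioc_subset_Icc_self
  · exact Filter.Eventually.of_forall fun s => mul_nonneg (norm_nonneg _) (covNorm_nonneg _ _)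

/-- The average of the covariant derivative along the segment joining `(x, 0)` to the point at
height `‖h‖ / 2` above `x + h / 2`. -/
def slantAverage (g : EuclideanSpace ℝ (Fin (n + 1)) → ℝ≥0∞) (x h : EuclideanSpace ℝ (Fin n)) :
    ℝ≥0∞ :=
  ∫⁻ s in Ioc (0 : ℝ) 1, g (pt (x + (s / 2) • h) (s / 2 * ‖h‖))

/-- The apex lies at distance at most `‖h‖ / 2 + ‖h‖ / 2` from `(x, 0)`. -/
theorem IsSkewForm.enorm_sub_transport_slant_le (hΓ : IsSkewForm Γ)
    {U : EuclideanSpace ℝ (Fin (n + 1)) → F} (hU : ContDiff ℝ 1 U)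
    (x h : EuclideanSpace ℝ (Fin n)) :
    ‖U (pt (x + (1 / 2 : ℝ) • h) (1 / 2 * ‖h‖)) - transport Γ (boundaryIncl n x,
      pt (x + (1 / 2 : ℝ) • h) (1 / 2 * ‖h‖)) (U (boundaryIncl n x))‖ₑ ≤
      ‖h‖ₑ * slantAverage (fun z => ‖covNorm Γ U z‖ₑ) x h := by
  refine (hΓ.enorm_sub_transport_le hU _ _).trans ?_
  have e : pt (x + (1 / 2 : ℝ) • h) (1 / 2 * ‖h‖) - boundaryIncl n x =
      pt ((1 / 2 : ℝ) • h) (1 / 2 * ‖h‖) := by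
    rw [← pt_zero, pt_sub_pt, add_sub_cancel_left, sub_zero]
  rw [e, slantAverage]
  refine mul_le_mul' ?_ (le_of_eq (lintegral_congr fun s => ?_))
  · rw [enorm_le_iff_norm_le]
    refine (norm_pt_le _ _).trans (le_of_eq ?_)
    rw [norm_smul, abs_of_nonneg (by positivity)]
    norm_num
    ring
  · congr 2
    simp only [pt, map_add, map_smul]
    module

/-- Both boundary values are transported to the common apex `c`, where each is compared with `U c`.
The defect between going from `y` to `c` directly and through `x` is the holonomy of the triangle,
quadratic in `‖x - y‖`. The bound `2`, valid because transports are isometries, is what makes this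
term integrable for distant points. -/
theorem HalfSpaceForm.osc_le {β : ℝ} (hΓ : HalfSpaceForm Γ β)
    {U : EuclideanSpace ℝ (Fin (n + 1)) → F} (hU : ContDiff ℝ 1 U)
    (x y : EuclideanSpace ℝ (Fin n)) :
    osc Γ (fun x => U (boundaryIncl n x)) x y ≤
      ‖y - x‖ₑ * slantAverage (fun z => ‖covNorm Γ U z‖ₑ) x (y - x) +
      ‖x - y‖ₑ * slantAverage (fun z => ‖covNorm Γ U z‖ₑ) y (x - y) +
      ENNReal.ofReal (min 2 (β * ‖x - y‖ ^ 2)) * ‖U (boundaryIncl n y)‖ₑ := by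
  set c := pt (x + (1 / 2 : ℝ) • (y - x)) (1 / 2 * ‖y - x‖) with hc
  have hc' : c = pt (y + (1 / 2 : ℝ) • (x - y)) (1 / 2 * ‖x - y‖) := by
    rw [hc, norm_sub_rev]
    congr 1
    module
  have h1 := hΓ.enorm_sub_transport_slant_le hU x (y - x)
  have h2 := hΓ.enorm_sub_transport_slant_le hU y (x - y)
  rw [← hc] at h1
  rw [← hc'] at h2
  set ix := boundaryIncl n x
  set iy := boundaryIncl n y
  have hix : ix = pt x 0 := (pt_zero x).symm
  have hiy : iy = pt y 0 := (pt_zero y).symm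
  set ux := U ix
  set uy := U iy
  have h3 : ‖transport Γ (iy, c) uy - transport Γ (ix, c) (transport Γ (iy, ix) uy)‖ₑ ≤
      ENNReal.ofReal (min 2 (β * ‖x - y‖ ^ 2)) * ‖uy‖ₑ := by
    rw [← ofReal_norm, ← ofReal_norm, ← ENNReal.ofReal_mul (le_min zero_le_two
      (mul_nonneg hΓ.nonneg (sq_nonneg _)))]
    refine ENNReal.ofReal_le_ofReal ?_
    rw [min_mul_of_nonneg _ _ (norm_nonneg _)]
    refine le_min ?_ ?_
    · refine (norm_sub_le _ _).trans (le_of_eq ?_)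
      rw [hΓ.norm_transport_apply, hΓ.norm_transport_apply, hΓ.norm_transport_apply]
      ring
    · have hn : ∀ w : EuclideanSpace ℝ (Fin n), ‖pt ((1 / 2 : ℝ) • w) (1 / 2 * ‖w‖)‖ ≤ ‖w‖ :=
        fun w => by
        refine (norm_pt_le _ _).trans (le_of_eq ?_)
        rw [norm_smul, abs_of_nonneg (by positivity)]
        norm_num
        ring
      have hb : ‖ix - iy‖ ≤ ‖x - y‖ := by rw [← map_sub, norm_boundaryIncl]
      have hcy : ‖c - iy‖ ≤ ‖x - y‖ := by
        rw [hc', hiy, pt_sub_pt, add_sub_cancel_left, sub_zero]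
        exact hn _
      have hcx : ‖c - ix‖ ≤ ‖x - y‖ := by
        rw [norm_sub_rev x y, hc, hix, pt_sub_pt, add_sub_cancel_left, sub_zero]
        exact hn _
      have := hΓ.norm_transport_sub_comp_le convex_closedHalfSpace hΓ.nonneg hΓ.curvature_le
        (boundaryIncl_mem y) (boundaryIncl_mem x) (pt_mem (x := x + (1 / 2 : ℝ) • (y - x))
        (t := 1 / 2 * ‖y - x‖) (by positivity)) hb hcy uy
      refine this.trans ?_
      have hβ := hΓ.nonneg
      calc β * ‖x - y‖ * ‖c - ix‖ * ‖uy‖ ≤ β * ‖x - y‖ * ‖x - y‖ * ‖uy‖ := by gcongr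
        _ = _ := by ring
  -- Transporting the covariant difference from `x` to the apex does not change its norm.
  have e : osc Γ (fun x => U (boundaryIncl n x)) x y =
      ‖transport Γ (ix, c) ux - transport Γ (ix, c) (transport Γ (iy, ix) uy)‖ₑ := by
    rw [← map_sub, enorm_eq_iff_norm_eq.2 (hΓ.norm_transport_apply _ _)]
    rfl
  rw [e]
  have e2 : transport Γ (ix, c) ux - transport Γ (ix, c) (transport Γ (iy, ix) uy) =
      -(U c - transport Γ (ix, c) ux) + (U c - transport Γ (iy, c) uy) +
      (transport Γ (iy, c) uy - transport Γ (ix, c) (transport Γ (iy, ix) uy)) := by abel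
  rw [e2]
  refine (enorm_add_le _ _).trans (add_le_add ((enorm_add_le _ _).trans (add_le_add ?_ h2)) h3)
  rwa [enorm_neg]

end Energies

/-! ### Integrals arising in the trace estimate -/

section TraceIntegrals

variable {n : ℕ}

/-- The integral of a kernel in relative coordinates. -/
theorem lintegral_lintegral_sub {f : EuclideanSpace ℝ (Fin n) → EuclideanSpace ℝ (Fin n) → ℝ≥0∞}
    (hf : Measurable (Function.uncurry f)) :
    ∫⁻ x, ∫⁻ y, f x (y - x) = ∫⁻ h, ∫⁻ x, f x h := by
  rw [← lintegral_lintegral_swap hf.aemeasurable]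
  refine lintegral_congr fun x => ?_
  exact lintegral_sub_right_eq_self (fun h => f x h) x

/-- The weight `‖h‖ ^ (1 - n)` cancels the Jacobian of polar coordinates. -/
theorem lintegral_norm_weight (hn : 1 ≤ n) {f : ℝ → ℝ≥0∞} (hf : Measurable f) :
    ∫⁻ h : EuclideanSpace ℝ (Fin n), ENNReal.ofReal (‖h‖ ^ (1 - n : ℝ)) * f ‖h‖ =
      (volume : Measure (EuclideanSpace ℝ (Fin n))).toSphere univ * ∫⁻ r in Ioi (0 : ℝ), f r := by
  have : Nonempty (Fin n) := ⟨⟨0, hn⟩⟩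
  rw [lintegral_fun_norm volume (f := fun r => ENNReal.ofReal (r ^ (1 - n : ℝ)) * f r)
    (by fun_prop)]
  congr 1
  refine setLIntegral_congr_fun measurableSet_Ioi fun r hr => ?_
  rw [mem_Ioi] at hr
  rw [← mul_assoc, ← ENNReal.ofReal_mul (by positivity), finrank_euclideanSpace_fin,
    ← Real.rpow_natCast, ← Real.rpow_add hr, Nat.cast_sub hn]
  norm_num

theorem measurable_slantAverage {g : EuclideanSpace ℝ (Fin (n + 1)) → ℝ≥0∞} (hg : Measurable g) :
    Measurable (Function.uncurry (slantAverage g)) := by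
  have hc : Continuous fun q : (EuclideanSpace ℝ (Fin n) × EuclideanSpace ℝ (Fin n)) × ℝ =>
      pt (q.1.1 + (q.2 / 2) • q.1.2) (q.2 / 2 * ‖q.1.2‖) :=
    continuous_pt.comp (by fun_prop : Continuous
      fun q : (EuclideanSpace ℝ (Fin n) × EuclideanSpace ℝ (Fin n)) × ℝ =>
      (q.1.1 + (q.2 / 2) • q.1.2, q.2 / 2 * ‖q.1.2‖))
  exact (hg.comp hc.measurable).lintegral_prod_right'

/-- The constant in `lintegral_slantAverage_le`. -/
def slantConst (n : ℕ) (p : ℝ) : ℝ≥0∞ :=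
  2 ^ (p - 1) * ((volume : Measure (EuclideanSpace ℝ (Fin n))).toSphere univ *
    ENNReal.ofReal (4 / (p - 1)))

/-- After the weighted Hölder inequality, translation invariance in `x` removes the horizontal
displacement, so only the height `s / 2 * ‖h‖` remains. Polar coordinates and rescaling turn that
height into the vertical variable at the cost of a factor `2 / s`. The remaining integral of `s ^
((p - 3) / 2)` over `(0, 1]` converges exactly because `p > 1`, and yields `4 / (p - 1)`. -/
theorem lintegral_slantAverage_le (hn : 1 ≤ n) {p : ℝ} (hp : 1 < p)
    {g : EuclideanSpace ℝ (Fin (n + 1)) → ℝ≥0∞} (hg : Measurable g) :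
    ∫⁻ h : EuclideanSpace ℝ (Fin n), ∫⁻ x, ENNReal.ofReal (‖h‖ ^ (1 - n : ℝ)) *
      slantAverage g x h ^ p ≤ slantConst n p * ∫⁻ z in openHalfSpace n, g z ^ p := by
  have hc3 : Continuous fun q : (EuclideanSpace ℝ (Fin n) × EuclideanSpace ℝ (Fin n)) × ℝ =>
      pt (q.1.1 + (q.2 / 2) • q.1.2) (q.2 / 2 * ‖q.1.2‖) :=
    continuous_pt.comp (by fun_prop : Continuous
      fun q : (EuclideanSpace ℝ (Fin n) × EuclideanSpace ℝ (Fin n)) × ℝ =>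
      (q.1.1 + (q.2 / 2) • q.1.2, q.2 / 2 * ‖q.1.2‖))
  set G : ℝ → ℝ≥0∞ := fun t => ∫⁻ x, g (pt x t) ^ p with hG
  have hGm : Measurable G := by
    have : Measurable fun q : ℝ × EuclideanSpace ℝ (Fin n) => g (pt q.2 q.1) ^ p :=
      (hg.comp (continuous_pt.comp continuous_swap).measurable).pow_const p
    exact this.lintegral_prod_right'
  have hHölder : ∀ x h : EuclideanSpace ℝ (Fin n), slantAverage g x h ^ p ≤ 2 ^ (p - 1) *
      ∫⁻ s in Ioc (0 : ℝ) 1, ENNReal.ofReal (s ^ ((p - 1) / 2)) *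
        g (pt (x + (s / 2) • h) (s / 2 * ‖h‖)) ^ p := fun x h => by
    refine rpow_lintegral_Ioc_le hp (hg.comp ?_)
    exact (hc3.comp (by fun_prop : Continuous fun s : ℝ => ((x, h), s))).measurable
  have htwo : (2 : ℝ≥0∞) ^ (p - 1) ≠ ⊤ := by finiteness
  calc ∫⁻ h : EuclideanSpace ℝ (Fin n), ∫⁻ x, ENNReal.ofReal (‖h‖ ^ (1 - n : ℝ)) *
        slantAverage g x h ^ p
      ≤ ∫⁻ h : EuclideanSpace ℝ (Fin n), ∫⁻ x, ENNReal.ofReal (‖h‖ ^ (1 - n : ℝ)) *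
        (2 ^ (p - 1) * ∫⁻ s in Ioc (0 : ℝ) 1, ENNReal.ofReal (s ^ ((p - 1) / 2)) *
          g (pt (x + (s / 2) • h) (s / 2 * ‖h‖)) ^ p) := by
        gcongr with h x
        exact hHölder x h
    _ = 2 ^ (p - 1) * ∫⁻ h : EuclideanSpace ℝ (Fin n), ∫⁻ s in Ioc (0 : ℝ) 1,
        ENNReal.ofReal (‖h‖ ^ (1 - n : ℝ)) * (ENNReal.ofReal (s ^ ((p - 1) / 2)) *
          G (s / 2 * ‖h‖)) := by
        rw [← lintegral_const_mul' _ _ htwo]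
        refine lintegral_congr fun h => ?_
        have hm : Measurable (Function.uncurry fun (x : EuclideanSpace ℝ (Fin n)) (s : ℝ) =>
            ENNReal.ofReal (s ^ ((p - 1) / 2)) * g (pt (x + (s / 2) • h) (s / 2 * ‖h‖)) ^ p) := by
          refine Measurable.mul (by fun_prop) (Measurable.pow_const (hg.comp ?_) _)
          exact (hc3.comp (by fun_prop : Continuous
            fun q : EuclideanSpace ℝ (Fin n) × ℝ => ((q.1, h), q.2))).measurable
        rw [lintegral_const_mul' _ _ ENNReal.ofReal_ne_top, lintegral_const_mul' _ _ htwo,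
          lintegral_const_mul' _ _ ENNReal.ofReal_ne_top, lintegral_lintegral_swap hm.aemeasurable,
          mul_left_comm]
        congr 2
        refine lintegral_congr fun s => ?_
        rw [lintegral_const_mul' _ _ ENNReal.ofReal_ne_top]
        congr 1
        exact lintegral_add_right_eq_self (fun x => g (pt x (s / 2 * ‖h‖)) ^ p) ((s / 2) • h)
    _ = 2 ^ (p - 1) * ∫⁻ s in Ioc (0 : ℝ) 1, ENNReal.ofReal (s ^ ((p - 1) / 2)) *
        ∫⁻ h : EuclideanSpace ℝ (Fin n), ENNReal.ofReal (‖h‖ ^ (1 - n : ℝ)) *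
          G (s / 2 * ‖h‖) := by
        rw [lintegral_lintegral_swap]
        · congr 1
          refine lintegral_congr fun s => ?_
          rw [← lintegral_const_mul' _ _ ENNReal.ofReal_ne_top]
          refine lintegral_congr fun h => ?_
          rw [mul_left_comm]
        · refine Measurable.aemeasurable ?_
          refine Measurable.mul (by fun_prop) (Measurable.mul (by fun_prop) (hGm.comp ?_))
          fun_prop
    _ = 2 ^ (p - 1) * ((volume : Measure (EuclideanSpace ℝ (Fin n))).toSphere univ *
        ENNReal.ofReal (4 / (p - 1))) * ∫⁻ t in Ioi (0 : ℝ), G t := by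
        rw [mul_assoc]
        congr 1
        have : ∀ s ∈ Ioc (0 : ℝ) 1, ENNReal.ofReal (s ^ ((p - 1) / 2)) *
            ∫⁻ h : EuclideanSpace ℝ (Fin n), ENNReal.ofReal (‖h‖ ^ (1 - n : ℝ)) *
              G (s / 2 * ‖h‖) = ENNReal.ofReal (s ^ ((p - 3) / 2)) *
            (2 * ((volume : Measure (EuclideanSpace ℝ (Fin n))).toSphere univ *
              ∫⁻ t in Ioi (0 : ℝ), G t)) := by
          intro s hs
          rw [lintegral_norm_weight hn (f := fun r => G (s / 2 * r)) (hGm.comp (by fun_prop)),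
            lintegral_Ioi_comp_mul (half_pos hs.1)]
          have e : ENNReal.ofReal (s ^ ((p - 1) / 2)) * ENNReal.ofReal (s / 2)⁻¹ =
              ENNReal.ofReal (s ^ ((p - 3) / 2)) * 2 := by
            rw [← ENNReal.ofReal_mul (Real.rpow_nonneg hs.1.le _), inv_div,
              show (2 : ℝ≥0∞) = ENNReal.ofReal 2 by simp,
              ← ENNReal.ofReal_mul (Real.rpow_nonneg hs.1.le _)]
            congr 1
            have : (p - 1) / 2 = (p - 3) / 2 + 1 := by ring
            rw [this, Real.rpow_add_one hs.1.ne']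
            have := hs.1.ne'
            field_simp
          rw [mul_left_comm, ← mul_assoc (ENNReal.ofReal (s ^ ((p - 1) / 2))), e]
          ring
        rw [setLIntegral_congr_fun measurableSet_Ioc this,
          lintegral_mul_const _ (by fun_prop), lintegral_Ioc_rpow (by linarith) zero_le_one]
        have e : ENNReal.ofReal ((1 : ℝ) ^ ((p - 3) / 2 + 1) / ((p - 3) / 2 + 1)) * 2 =
            ENNReal.ofReal (4 / (p - 1)) := by
          rw [show (2 : ℝ≥0∞) = ENNReal.ofReal 2 by simp, ← ENNReal.ofReal_mul' zero_le_two,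
            Real.one_rpow]
          congr 1
          have : p - 1 ≠ 0 := by linarith
          have : (p - 3) / 2 + 1 = (p - 1) / 2 := by ring
          rw [this]
          field_simp
          norm_num
        rw [← mul_assoc, e]
        ring
    _ = _ := by
        rw [lintegral_openHalfSpace (hg.pow_const p)]
        rfl

/-- The constant in `lintegral_holonomy_le`. -/
def holonomyConst (n : ℕ) (p : ℝ) : ℝ≥0∞ :=
  (volume : Measure (EuclideanSpace ℝ (Fin n))).toSphere univ *
    ENNReal.ofReal (1 / (p + 1) + 2 ^ p / (p - 1))

theorem lintegral_min_rpow_le {p β : ℝ} (hp : 1 < p) (hβ : 0 ≤ β) :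
    ∫⁻ r in Ioi (0 : ℝ), ENNReal.ofReal (min 2 (β * r ^ 2) ^ p * r ^ (-p)) ≤
      ENNReal.ofReal (1 / (p + 1) + 2 ^ p / (p - 1)) * ENNReal.ofReal (β ^ ((p - 1) / 2)) := by
  rcases hβ.eq_or_lt with rfl | hβ
  · have : (fun r : ℝ => ENNReal.ofReal (min 2 (0 * r ^ 2) ^ p * r ^ (-p))) = fun _ => 0 := by
      ext1 r
      rw [zero_mul, min_eq_right zero_le_two, Real.zero_rpow (by linarith), zero_mul,
        ENNReal.ofReal_zero]
    rw [this, lintegral_zero]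
    exact zero_le
  -- The radius at which `β * r ^ 2 = 1`. Below it the quadratic bound makes the integrand at most
  -- `β ^ p * r ^ p`; above it the bound `2` leaves the integrable tail `r ^ (-p)`.
  set c : ℝ := β ^ (-(1 / 2) : ℝ) with hc
  have hc0 : 0 < c := Real.rpow_pos_of_pos hβ _
  have hp1 : 0 < p - 1 := by linarith
  rw [← Ioc_union_Ioi_eq_Ioi hc0.le]
  refine (lintegral_union_le _ _ _).trans ?_
  have h1 : ∫⁻ r in Ioc 0 c, ENNReal.ofReal (min 2 (β * r ^ 2) ^ p * r ^ (-p)) ≤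
      ENNReal.ofReal (1 / (p + 1)) * ENNReal.ofReal (β ^ ((p - 1) / 2)) := by
    calc _ ≤ ∫⁻ r in Ioc 0 c, ENNReal.ofReal (β ^ p) * ENNReal.ofReal (r ^ p) := by
          refine setLIntegral_mono' measurableSet_Ioc fun r hr => ?_
          rw [← ENNReal.ofReal_mul (by positivity)]
          refine ENNReal.ofReal_le_ofReal ?_
          have hr0 := hr.1
          calc min 2 (β * r ^ 2) ^ p * r ^ (-p) ≤ (β * r ^ 2) ^ p * r ^ (-p) := by
                gcongr
                exact min_le_right _ _
            _ = β ^ p * r ^ p := by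
                rw [Real.mul_rpow hβ.le (by positivity), ← Real.rpow_natCast, ← Real.rpow_mul hr0.le,
                  mul_assoc, ← Real.rpow_add hr0]
                congr 2
                push_cast
                ring
      _ = _ := by
          rw [lintegral_const_mul' _ _ ENNReal.ofReal_ne_top,
            lintegral_Ioc_rpow (by linarith) hc0.le, ← ENNReal.ofReal_mul (by positivity),
            ← ENNReal.ofReal_mul (by positivity)]
          congr 1
          rw [hc, ← Real.rpow_mul hβ.le, mul_div_assoc', ← Real.rpow_add hβ, one_div_mul_eq_div]
          congr 2
          ring
  have h2 : ∫⁻ r in Ioi c, ENNReal.ofReal (min 2 (β * r ^ 2) ^ p * r ^ (-p)) ≤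
      ENNReal.ofReal (2 ^ p / (p - 1)) * ENNReal.ofReal (β ^ ((p - 1) / 2)) := by
    calc _ ≤ ∫⁻ r in Ioi c, ENNReal.ofReal (2 ^ p) * ENNReal.ofReal (r ^ (-p)) := by
          refine setLIntegral_mono' measurableSet_Ioi fun r hr => ?_
          have hr0 : 0 < r := hc0.trans hr
          rw [← ENNReal.ofReal_mul (by positivity)]
          refine ENNReal.ofReal_le_ofReal ?_
          gcongr
          exact min_le_left _ _
      _ = _ := by
          rw [lintegral_const_mul' _ _ ENNReal.ofReal_ne_top,
            lintegral_Ioi_rpow (by linarith) hc0, ← ENNReal.ofReal_mul (by positivity),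
            ← ENNReal.ofReal_mul (by positivity)]
          congr 1
          rw [hc, ← Real.rpow_mul hβ.le, neg_neg, mul_div_assoc', mul_div_right_comm]
          congr 2
          ring
  refine (add_le_add h1 h2).trans (le_of_eq ?_)
  rw [← add_mul, ← ENNReal.ofReal_add (by positivity) (by positivity)]

theorem lintegral_holonomy_le (hn : 1 ≤ n) {p β : ℝ} (hp : 1 < p) (hβ : 0 ≤ β) :
    ∫⁻ h : EuclideanSpace ℝ (Fin n), ENNReal.ofReal (‖h‖ ^ (1 - n : ℝ)) *
      ENNReal.ofReal (min 2 (β * ‖h‖ ^ 2) ^ p * ‖h‖ ^ (-p)) ≤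
      holonomyConst n p * ENNReal.ofReal (β ^ ((p - 1) / 2)) := by
  rw [lintegral_norm_weight hn (f := fun r => ENNReal.ofReal (min 2 (β * r ^ 2) ^ p * r ^ (-p)))
    (by fun_prop), holonomyConst, mul_assoc]
  gcongr
  exact lintegral_min_rpow_le hp hβ

end TraceIntegrals

/-! ### The trace inequality -/

section TraceInequality

variable {n : ℕ} {F : Type*} [NormedAddCommGroup F] [InnerProductSpace ℝ F] [FiniteDimensional ℝ F]
  {Γ : EuclideanSpace ℝ (Fin (n + 1)) → EuclideanSpace ℝ (Fin (n + 1)) →L[ℝ] F →L[ℝ] F}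

theorem enorm_rpow_div_enorm_rpow {X : Type*} [NormedAddCommGroup X] {h : X} (hh : h ≠ 0)
    {p q : ℝ} (hq : 0 ≤ q) (hp : 0 ≤ p) :
    ‖h‖ₑ ^ p / ‖h‖ₑ ^ q = ENNReal.ofReal (‖h‖ ^ (p - q)) := by
  have h0 : 0 < ‖h‖ := norm_pos_iff.2 hh
  rw [← ofReal_norm, ENNReal.ofReal_rpow_of_nonneg h0.le hp,
    ENNReal.ofReal_rpow_of_nonneg h0.le hq, ← ENNReal.ofReal_div_of_pos (Real.rpow_pos_of_pos h0 _),
    Real.rpow_sub h0]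

theorem IsSkewForm.osc_self (hΓ : IsSkewForm Γ) (u : EuclideanSpace ℝ (Fin n) → F)
    (x : EuclideanSpace ℝ (Fin n)) : osc Γ u x x = 0 := by
  rw [osc, hΓ.transport_self]
  change ‖u x - u x‖ₑ = 0
  simp

theorem HalfSpaceForm.osc_rpow_div_le {β : ℝ} (hΓ : HalfSpaceForm Γ β) {p : ℝ} (hp : 1 < p)
    {U : EuclideanSpace ℝ (Fin (n + 1)) → F} (hU : ContDiff ℝ 1 U)
    (x y : EuclideanSpace ℝ (Fin n)) :
    osc Γ (fun x => U (boundaryIncl n x)) x y ^ p / ‖x - y‖ₑ ^ ((n : ℝ) + p - 1) ≤ 4 ^ p *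
      (ENNReal.ofReal (‖y - x‖ ^ (1 - n : ℝ)) *
          slantAverage (fun z => ‖covNorm Γ U z‖ₑ) x (y - x) ^ p +
        ENNReal.ofReal (‖x - y‖ ^ (1 - n : ℝ)) *
          slantAverage (fun z => ‖covNorm Γ U z‖ₑ) y (x - y) ^ p +
        ENNReal.ofReal (‖x - y‖ ^ (1 - n : ℝ)) *
          ENNReal.ofReal (min 2 (β * ‖x - y‖ ^ 2) ^ p * ‖x - y‖ ^ (-p)) *
            ‖U (boundaryIncl n y)‖ₑ ^ p) := by
  have hp0 : 0 < p := by linarith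
  have hβ := hΓ.nonneg
  have hq : 0 ≤ (n : ℝ) + p - 1 := by
    have : (0 : ℝ) ≤ n := Nat.cast_nonneg n
    linarith
  -- On the diagonal the covariant difference vanishes, and `0 / 0 = 0` in `ℝ≥0∞`.
  by_cases hxy : x = y
  · subst hxy
    rw [hΓ.osc_self, ENNReal.zero_rpow_of_pos hp0, ENNReal.zero_div]
    exact zero_le
  have h1 : x - y ≠ 0 := sub_ne_zero.2 hxy
  have hpos : 0 < ‖x - y‖ := norm_pos_iff.2 h1
  have hyx : ‖y - x‖ = ‖x - y‖ := norm_sub_rev _ _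
  have hyx' : ‖y - x‖ₑ = ‖x - y‖ₑ := enorm_eq_iff_norm_eq.2 hyx
  have key : ‖x - y‖ₑ ^ p / ‖x - y‖ₑ ^ ((n : ℝ) + p - 1) =
      ENNReal.ofReal (‖x - y‖ ^ (1 - n : ℝ)) := by
    rw [enorm_rpow_div_enorm_rpow h1 hq hp0.le]
    congr 2
    ring
  have key2 : ENNReal.ofReal (min 2 (β * ‖x - y‖ ^ 2)) ^ p / ‖x - y‖ₑ ^ ((n : ℝ) + p - 1) =
      ENNReal.ofReal (‖x - y‖ ^ (1 - n : ℝ)) *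
          ENNReal.ofReal (min 2 (β * ‖x - y‖ ^ 2) ^ p * ‖x - y‖ ^ (-p)) := by
    have hm : 0 ≤ min 2 (β * ‖x - y‖ ^ 2) := le_min zero_le_two (by positivity)
    rw [← ofReal_norm, ENNReal.ofReal_rpow_of_nonneg hm hp0.le,
      ENNReal.ofReal_rpow_of_nonneg hpos.le hq,
      ← ENNReal.ofReal_div_of_pos (Real.rpow_pos_of_pos hpos _),
      ← ENNReal.ofReal_mul (by positivity)]
    congr 1
    rw [mul_left_comm, ← Real.rpow_add hpos, div_eq_mul_inv, ← Real.rpow_neg hpos.le]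
    congr 2
    ring
  refine (ENNReal.div_le_div_right ((ENNReal.rpow_le_rpow (hΓ.osc_le hU x y) hp0.le).trans
    (rpow_add_add_le _ _ _ hp0)) _).trans (le_of_eq ?_)
  rw [mul_div_assoc, ENNReal.add_div, ENNReal.add_div, ENNReal.mul_rpow_of_nonneg _ _ hp0.le,
    ENNReal.mul_rpow_of_nonneg _ _ hp0.le, ENNReal.mul_rpow_of_nonneg _ _ hp0.le, hyx, hyx',
    ENNReal.mul_div_right_comm, ENNReal.mul_div_right_comm, ENNReal.mul_div_right_comm, key, key2]

/-- Tonelli's theorem and translation invariance: the first two terms are exchanged by swapping `x`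
and `y`, and the third is a convolution integrated over the whole space. -/
theorem lintegral_relative_sum {f : EuclideanSpace ℝ (Fin n) → EuclideanSpace ℝ (Fin n) → ℝ≥0∞}
    (hf : Measurable (Function.uncurry f)) {w v : EuclideanSpace ℝ (Fin n) → ℝ≥0∞}
    (hw : Measurable w) (hv : Measurable v) :
    ∫⁻ x, ∫⁻ y, f x (y - x) + f y (x - y) + w (x - y) * v y =
      (∫⁻ h, ∫⁻ x, f x h) + (∫⁻ h, ∫⁻ x, f x h) + (∫⁻ h, w h) * ∫⁻ y, v y := by
  have hsub : Measurable fun q : EuclideanSpace ℝ (Fin n) × EuclideanSpace ℝ (Fin n) =>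
    (q.1, q.2 - q.1) := by fun_prop
  have hsub' : Measurable fun q : EuclideanSpace ℝ (Fin n) × EuclideanSpace ℝ (Fin n) =>
    (q.2, q.1 - q.2) := by fun_prop
  have m1 : Measurable (Function.uncurry fun x y => f x (y - x)) := hf.comp hsub
  have m2 : Measurable (Function.uncurry fun x y => f y (x - y)) := hf.comp hsub'
  have m3 : Measurable (Function.uncurry fun x y => w (x - y) * v y) := by fun_prop
  have i1 : ∫⁻ x, ∫⁻ y, f x (y - x) = ∫⁻ h, ∫⁻ x, f x h := lintegral_lintegral_sub hf
  have i2 : ∫⁻ x, ∫⁻ y, f y (x - y) = ∫⁻ h, ∫⁻ x, f x h := by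
    rw [lintegral_lintegral_swap m2.aemeasurable]
    exact i1
  have i3 : ∫⁻ x, ∫⁻ y, w (x - y) * v y = (∫⁻ h, w h) * ∫⁻ y, v y := by
    rw [lintegral_lintegral_swap m3.aemeasurable]
    calc ∫⁻ y, ∫⁻ x, w (x - y) * v y = ∫⁻ y, (∫⁻ h, w h) * v y := by
          refine lintegral_congr fun y => ?_
          rw [lintegral_mul_const _ (by fun_prop)]
          congr 1
          exact lintegral_sub_right_eq_self w y
      _ = _ := lintegral_const_mul _ hv
  have n1 : Measurable fun x => ∫⁻ y, f x (y - x) := m1.lintegral_prod_right'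
  have n2 : Measurable fun x => ∫⁻ y, f y (x - y) := m2.lintegral_prod_right'
  calc _ = ∫⁻ x, ((∫⁻ y, f x (y - x)) + (∫⁻ y, f y (x - y)) + ∫⁻ y, w (x - y) * v y) := by
        refine lintegral_congr fun x => ?_
        have m1x : Measurable fun y => f x (y - x) := m1.of_uncurry_left
        have m2x : Measurable fun y => f y (x - y) := m2.of_uncurry_left
        have m12 : Measurable fun y => f x (y - x) + f y (x - y) := m1x.add m2x
        rw [lintegral_add_left m12, lintegral_add_left m1x]
    _ = _ := by
        have n12 : Measurable fun x => (∫⁻ y, f x (y - x)) + ∫⁻ y, f y (x - y) := n1.add n2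
        rw [lintegral_add_left n12, lintegral_add_left n1, i1, i2, i3]

theorem HalfSpaceForm.gagEnergy_trace_le {β : ℝ} (hΓ : HalfSpaceForm Γ β) (hn : 1 ≤ n) {p : ℝ}
    (hp : 1 < p) {U : EuclideanSpace ℝ (Fin (n + 1)) → F} (hU : ContDiff ℝ 1 U) :
    gagEnergy p Γ (fun x => U (boundaryIncl n x)) ≤ 4 ^ p *
      (2 * slantConst n p * halfEnergy p (covNorm Γ U) + holonomyConst n p *
        (ENNReal.ofReal (β ^ ((p - 1) / 2)) * lpEnergy p (fun x => U (boundaryIncl n x)))) := by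
  have hgm : Measurable fun z => ‖covNorm Γ U z‖ₑ := (hΓ.continuous_covNorm hU).enorm.measurable
  have hf : Measurable (Function.uncurry fun x h : EuclideanSpace ℝ (Fin n) =>
      ENNReal.ofReal (‖h‖ ^ (1 - n : ℝ)) * slantAverage (fun z => ‖covNorm Γ U z‖ₑ) x h ^ p) :=
    Measurable.mul (by fun_prop) (Measurable.pow_const (measurable_slantAverage hgm) p)
  have hw : Measurable fun h : EuclideanSpace ℝ (Fin n) => ENNReal.ofReal (‖h‖ ^ (1 - n : ℝ)) *
    ENNReal.ofReal (min 2 (β * ‖h‖ ^ 2) ^ p * ‖h‖ ^ (-p)) := by fun_prop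
  have hv : Measurable fun y => ‖U (boundaryIncl n y)‖ₑ ^ p := by
    have := hU.continuous
    exact (Continuous.enorm (by fun_prop)).measurable.pow_const p
  have hle := (lintegral_mono fun x => lintegral_mono fun y => hΓ.osc_rpow_div_le hp hU x y :
    gagEnergy p Γ (fun x => U (boundaryIncl n x)) ≤ _)
  have h4 : (4 : ℝ≥0∞) ^ p ≠ ⊤ := by finiteness
  refine hle.trans ?_
  simp only [lintegral_const_mul' _ _ h4]
  gcongr
  refine (lintegral_relative_sum hf hw hv).le.trans ?_
  rw [two_mul, add_mul, ← mul_assoc (holonomyConst n p)]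
  gcongr
  · exact lintegral_slantAverage_le hn hp hgm
  · exact lintegral_slantAverage_le hn hp hgm
  · exact lintegral_holonomy_le hn hp hΓ.nonneg
  · exact le_rfl

/-- The boundary value at `x` is compared with `U` at `(x, t)` along the vertical segment, and the
result is integrated in `x` and over `t` in `(0, c]`. The free length `c` is fixed later by the
curvature. -/
theorem IsSkewForm.lpEnergy_trace_le (hΓ : IsSkewForm Γ) {p : ℝ}
    (hp : 1 < p) {U : EuclideanSpace ℝ (Fin (n + 1)) → F} (hU : ContDiff ℝ 1 U) {c : ℝ}
    (hc : 0 < c) :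
    ENNReal.ofReal c * lpEnergy p (fun x => U (boundaryIncl n x)) ≤
      2 ^ p * (halfEnergy p U + ENNReal.ofReal (c ^ p) * halfEnergy p (covNorm Γ U)) := by
  have hp0 : 0 < p := by linarith
  have hUc := hU.continuous
  set g : EuclideanSpace ℝ (Fin (n + 1)) → ℝ≥0∞ := fun z => ‖covNorm Γ U z‖ₑ with hg
  have hgm : Measurable g := (hΓ.continuous_covNorm hU).enorm.measurable
  set G : ℝ → ℝ≥0∞ := fun t => ∫⁻ x, g (pt x t) ^ p with hG
  set V : ℝ → ℝ≥0∞ := fun t => ∫⁻ x, ‖U (pt x t)‖ₑ ^ p with hV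
  have hptswap : Measurable fun q : ℝ × EuclideanSpace ℝ (Fin n) => pt q.2 q.1 :=
    (continuous_pt.comp continuous_swap).measurable
  have hVm : Measurable V := by
    have : Measurable fun q : ℝ × EuclideanSpace ℝ (Fin n) => ‖U (pt q.2 q.1)‖ₑ ^ p :=
      (hUc.enorm.measurable.comp hptswap).pow_const p
    exact this.lintegral_prod_right'
  have hpoint : ∀ t : ℝ, 0 < t → ∀ x : EuclideanSpace ℝ (Fin n), ‖U (boundaryIncl n x)‖ₑ ^ p ≤
      2 ^ p * (‖U (pt x t)‖ₑ ^ p + ENNReal.ofReal (t ^ p) *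
        ∫⁻ s in Ioc (0 : ℝ) 1, g (pt x (t * s)) ^ p) := by
    intro t ht x
    have h1 := hΓ.enorm_sub_transport_le hU (boundaryIncl n x) (pt x t)
    have e1 : pt x t - boundaryIncl n x = t • vertical n := by simp [pt]
    have e2 : ∀ s : ℝ, boundaryIncl n x + s • t • vertical n = pt x (t * s) := fun s => by
      rw [pt, smul_smul, mul_comm]
    simp only [e1, e2] at h1
    have e3 : ‖t • vertical n‖ₑ = ENNReal.ofReal t := by
      rw [← ofReal_norm, norm_smul, norm_vertical, mul_one, Real.norm_of_nonneg ht.le]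
    rw [e3] at h1
    have h2 : ‖U (boundaryIncl n x)‖ₑ ≤ ‖U (pt x t)‖ₑ +
        ENNReal.ofReal t * ∫⁻ s in Ioc (0 : ℝ) 1, g (pt x (t * s)) := by
      calc ‖U (boundaryIncl n x)‖ₑ =
            ‖transport Γ (boundaryIncl n x, pt x t) (U (boundaryIncl n x))‖ₑ :=
            (enorm_eq_iff_norm_eq.2 (hΓ.norm_transport_apply _ _)).symm
        _ = ‖U (pt x t) + -(U (pt x t) -
              transport Γ (boundaryIncl n x, pt x t) (U (boundaryIncl n x)))‖ₑ := by
            congr 1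
            abel
        _ ≤ _ := (enorm_add_le _ _).trans (by rw [enorm_neg]; gcongr)
    refine (ENNReal.rpow_le_rpow h2 hp0.le).trans ((rpow_add_le_two_rpow_mul _ _ hp0).trans ?_)
    gcongr
    rw [ENNReal.mul_rpow_of_nonneg _ _ hp0.le, ENNReal.ofReal_rpow_of_nonneg ht.le hp0.le]
    gcongr
    have hm : Measurable fun s : ℝ => g (pt x (t * s)) :=
      hgm.comp (continuous_pt.comp (by fun_prop : Continuous fun s : ℝ => (x, t * s))).measurable
    refine (rpow_lintegral_le _ hp hm.aemeasurable).trans (le_of_eq ?_)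
    simp
  have hgl : ∫⁻ t in Ioi (0 : ℝ), G t = halfEnergy p (covNorm Γ U) :=
    (lintegral_openHalfSpace (hgm.pow_const p)).symm
  have hul : ∫⁻ t in Ioi (0 : ℝ), V t = halfEnergy p U :=
    (lintegral_openHalfSpace (hUc.enorm.measurable.pow_const p)).symm
  have hslice : ∀ t ∈ Ioc 0 c, lpEnergy p (fun x => U (boundaryIncl n x)) ≤
      2 ^ p * (V t + ENNReal.ofReal (c ^ (p - 1)) * halfEnergy p (covNorm Γ U)) := by
    intro t ht
    have hm : Measurable (Function.uncurry fun (x : EuclideanSpace ℝ (Fin n)) (s : ℝ) =>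
        g (pt x (t * s)) ^ p) :=
      (hgm.comp (continuous_pt.comp (by fun_prop : Continuous
        fun q : EuclideanSpace ℝ (Fin n) × ℝ => (q.1, t * q.2))).measurable).pow_const p
    have htwo : (2 : ℝ≥0∞) ^ p ≠ ⊤ := by finiteness
    have hVx : Measurable fun x => ‖U (pt x t)‖ₑ ^ p :=
      (hUc.enorm.measurable.comp (continuous_pt.comp (by fun_prop : Continuous
        fun x : EuclideanSpace ℝ (Fin n) => (x, t))).measurable).pow_const p
    calc lpEnergy p (fun x => U (boundaryIncl n x)) ≤ ∫⁻ x, 2 ^ p * (‖U (pt x t)‖ₑ ^ p +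
            ENNReal.ofReal (t ^ p) * ∫⁻ s in Ioc (0 : ℝ) 1, g (pt x (t * s)) ^ p) :=
          lintegral_mono fun x => hpoint t ht.1 x
      _ = 2 ^ p * (V t + ENNReal.ofReal (t ^ p) * ∫⁻ s in Ioc (0 : ℝ) 1, G (t * s)) := by
          rw [lintegral_const_mul' _ _ htwo, lintegral_add_left hVx,
            lintegral_const_mul' _ _ ENNReal.ofReal_ne_top,
            lintegral_lintegral_swap hm.aemeasurable]
      -- Enlarging the range of `s` allows a substitution that costs `t⁻¹`. The power of `t` drops
      -- to `p - 1`, which is still nonnegative and so bounded by that of `c`.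
      _ ≤ 2 ^ p * (V t + ENNReal.ofReal (t ^ p) * ∫⁻ s in Ioi (0 : ℝ), G (t * s)) := by
          gcongr
          exact Ioc_subset_Ioi_self
      _ = 2 ^ p * (V t + ENNReal.ofReal (t ^ (p - 1)) * halfEnergy p (covNorm Γ U)) := by
          rw [lintegral_Ioi_comp_mul ht.1, hgl, ← mul_assoc,
            ← ENNReal.ofReal_mul (Real.rpow_nonneg ht.1.le _), Real.rpow_sub_one ht.1.ne',
            div_eq_mul_inv]
      _ ≤ _ := by
          have := ht.2
          have := ht.1.le
          have : 0 ≤ p - 1 := by linarith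
          gcongr
  calc ENNReal.ofReal c * lpEnergy p (fun x => U (boundaryIncl n x))
      = ∫⁻ _t in Ioc 0 c, lpEnergy p (fun x => U (boundaryIncl n x)) := by
        rw [setLIntegral_const, Real.volume_Ioc, sub_zero, mul_comm]
    _ ≤ ∫⁻ t in Ioc 0 c,
          2 ^ p * (V t + ENNReal.ofReal (c ^ (p - 1)) * halfEnergy p (covNorm Γ U)) :=
        setLIntegral_mono' measurableSet_Ioc hslice
    _ = 2 ^ p * ((∫⁻ t in Ioc 0 c, V t) + ENNReal.ofReal c *
          (ENNReal.ofReal (c ^ (p - 1)) * halfEnergy p (covNorm Γ U))) := by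
        rw [lintegral_const_mul' _ _ (by finiteness), lintegral_add_left hVm, setLIntegral_const,
          Real.volume_Ioc, sub_zero, mul_comm (ENNReal.ofReal c)]
    _ ≤ 2 ^ p * ((∫⁻ t in Ioi 0, V t) + ENNReal.ofReal c *
          (ENNReal.ofReal (c ^ (p - 1)) * halfEnergy p (covNorm Γ U))) := by
        gcongr
        exact Ioc_subset_Ioi_self
    _ = _ := by
        rw [hul, ← mul_assoc (ENNReal.ofReal c), ← ENNReal.ofReal_mul hc.le,
          Real.rpow_sub_one hc.ne', mul_div_cancel₀ _ hc.ne']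

/-- Boundary trace estimate for the weighted `L^p` norm. -/
theorem IsSkewForm.rpow_mul_lpEnergy_trace_le (hΓ : IsSkewForm Γ) {p : ℝ}
    (hp : 1 < p) {U : EuclideanSpace ℝ (Fin (n + 1)) → F} (hU : ContDiff ℝ 1 U) {β : ℝ}
    (hβ : 0 ≤ β) :
    ENNReal.ofReal (β ^ ((p - 1) / 2)) * lpEnergy p (fun x => U (boundaryIncl n x)) ≤
      2 ^ p * (halfEnergy p (covNorm Γ U) + ENNReal.ofReal (β ^ (p / 2)) * halfEnergy p U) := by
  rcases hβ.eq_or_lt with rfl | hβ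
  · rw [Real.zero_rpow (by linarith : (p - 1) / 2 ≠ 0), ENNReal.ofReal_zero, zero_mul]
    exact zero_le
  -- With this length, multiplication by `β ^ (p / 2)` leaves the gradient energy with coefficient
  -- one.
  have h := hΓ.lpEnergy_trace_le hp hU (c := β ^ (-(1 / 2) : ℝ)) (Real.rpow_pos_of_pos hβ _)
  calc _ = ENNReal.ofReal (β ^ (p / 2)) * (ENNReal.ofReal (β ^ (-(1 / 2) : ℝ)) *
        lpEnergy p (fun x => U (boundaryIncl n x))) := by
        rw [← mul_assoc, ← ENNReal.ofReal_mul (by positivity), ← Real.rpow_add hβ]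
        congr 3
        ring
    _ ≤ ENNReal.ofReal (β ^ (p / 2)) * (2 ^ p * (halfEnergy p U +
          ENNReal.ofReal ((β ^ (-(1 / 2) : ℝ)) ^ p) * halfEnergy p (covNorm Γ U))) := by gcongr
    _ = 2 ^ p * (ENNReal.ofReal (β ^ (p / 2)) * ENNReal.ofReal ((β ^ (-(1 / 2) : ℝ)) ^ p) *
          halfEnergy p (covNorm Γ U) + ENNReal.ofReal (β ^ (p / 2)) * halfEnergy p U) := by ring
    _ = _ := by
        rw [← ENNReal.ofReal_mul (by positivity), ← Real.rpow_mul hβ.le, ← Real.rpow_add hβ,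
          show p / 2 + -(1 / 2) * p = 0 by ring, Real.rpow_zero, ENNReal.ofReal_one, one_mul]

theorem slantConst_ne_top (n : ℕ) (p : ℝ) : slantConst n p ≠ ⊤ := by
  unfold slantConst
  finiteness

theorem holonomyConst_ne_top (n : ℕ) (p : ℝ) : holonomyConst n p ≠ ⊤ := by
  unfold holonomyConst
  finiteness

/-- The sum of the weighted norms in terms of energies. -/
theorem coe_rpow_mul_rpow {p : ℝ} (hp : 0 < p) (β : ℝ≥0) (a : ℝ) (e : ℝ≥0∞) :
    ((β ^ a : ℝ≥0) : ℝ≥0∞) * e ^ (1 / p) = (ENNReal.ofReal ((β : ℝ) ^ (a * p)) * e) ^ (1 / p) := by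
  rw [ENNReal.mul_rpow_of_nonneg _ _ (by positivity), ENNReal.ofReal_rpow_of_nonneg (by positivity)
    (by positivity), ← Real.rpow_mul (NNReal.coe_nonneg β), mul_assoc, mul_one_div_cancel hp.ne', mul_one,
    ← NNReal.coe_rpow, ENNReal.ofReal_coe_nnreal]

theorem trace_estimate (hn : 1 ≤ n) {p : ℝ} (hp : 1 < p) :
    ∃ C : ℝ≥0, ∀ (F : Type*) [NormedAddCommGroup F] [InnerProductSpace ℝ F]
      [FiniteDimensional ℝ F]
      (Γ : EuclideanSpace ℝ (Fin (n + 1)) → EuclideanSpace ℝ (Fin (n + 1)) →L[ℝ] F →L[ℝ] F)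
      (β : ℝ≥0), IsMetricConnectionForm Γ → curvatureSupNorm Γ ≤ β →
      ∀ U ∈ C1cHalfSpace n F, boundaryNorm p β Γ (fun x => U (boundaryIncl n x)) ≤
        C * interiorNorm p β Γ U := by
  have hp0 : 0 < p := by linarith
  -- Large enough for the seminorm energy, whose holonomy part is bounded through the mass estimate
  -- with its factor `2 ^ p`, and for the mass energy itself. The factor `2` on its root counts
  -- these two summands.
  set K : ℝ≥0∞ := 4 ^ p * (2 * slantConst n p + holonomyConst n p * 2 ^ p) + 2 ^ p with hK
  have hKt : K ≠ ⊤ := by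
    have := slantConst_ne_top n p
    have := holonomyConst_ne_top n p
    finiteness
  have hKt' : 2 * K ^ (1 / p) ≠ ⊤ := by finiteness
  refine ⟨(2 * K ^ (1 / p)).toNNReal, ?_⟩
  intro F _ _ _ Γ β hΓ hβ U hU
  obtain ⟨Γ', hΓ', he⟩ := hΓ.exists_extension hβ
  obtain ⟨V, hV, hVU, -⟩ := exists_contDiff_extension hU.1
  have hbd : (fun x => U (boundaryIncl n x)) = fun x => V (boundaryIncl n x) := by
    ext1 x
    rw [hVU _ (boundaryIncl_mem x)]
  rw [ENNReal.coe_toNNReal hKt', hbd, hΓ'.boundaryNorm_eq hp0 β he,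
    interiorNorm_eq hp0 β he hV hVU, coe_rpow_mul_rpow hp0, coe_rpow_mul_rpow hp0]
  have e1 : (p - 1) / (2 * p) * p = (p - 1) / 2 := by field_simp
  have e2 : 1 / 2 * p = p / 2 := by ring
  rw [e1, e2]
  set A := halfEnergy p (covNorm Γ' V)
  set B := ENNReal.ofReal ((β : ℝ) ^ (p / 2)) * halfEnergy p V
  have h1 := hΓ'.rpow_mul_lpEnergy_trace_le hp hV β.2
  have h2 := hΓ'.gagEnergy_trace_le hn hp hV
  change ENNReal.ofReal ((β : ℝ) ^ ((p - 1) / 2)) * _ ≤ 2 ^ p * (A + B) at h1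
  set D := ENNReal.ofReal ((β : ℝ) ^ ((p - 1) / 2)) * lpEnergy p fun x => V (boundaryIncl n x)
  change _ ≤ 4 ^ p * (2 * slantConst n p * A + holonomyConst n p * D) at h2
  have h3 : gagEnergy p Γ' (fun x => V (boundaryIncl n x)) ≤ K * (A + B) := by
    calc _ ≤ 4 ^ p * (2 * slantConst n p * A + holonomyConst n p * D) := h2
      _ ≤ 4 ^ p * (2 * slantConst n p * (A + B) + holonomyConst n p * (2 ^ p * (A + B))) := by
          gcongr
          exact le_self_add
      _ = 4 ^ p * (2 * slantConst n p + holonomyConst n p * 2 ^ p) * (A + B) := by ring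
      _ ≤ _ := by
          gcongr
          exact le_self_add
  have h4 : D ≤ K * (A + B) := h1.trans (by
    gcongr
    exact le_add_self)
  have hip : 0 ≤ 1 / p := by positivity
  have h5 : (K * (A + B)) ^ (1 / p) ≤ K ^ (1 / p) * (A ^ (1 / p) + B ^ (1 / p)) := by
    rw [ENNReal.mul_rpow_of_nonneg _ _ hip]
    gcongr
    exact ENNReal.rpow_add_le_add_rpow _ _ hip (by rw [div_le_one hp0]; exact hp.le)
  calc _ ≤ (K * (A + B)) ^ (1 / p) + (K * (A + B)) ^ (1 / p) := by gcongr
    _ ≤ K ^ (1 / p) * (A ^ (1 / p) + B ^ (1 / p)) + K ^ (1 / p) * (A ^ (1 / p) + B ^ (1 / p)) :=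
        add_le_add h5 h5
    _ = _ := by ring

end TraceInequality

/-! ### Differentiation under the integral sign -/

section ParametricIntegral

variable {P Y G : Type*} [NormedAddCommGroup P] [NormedSpace ℝ P]
  [NormedAddCommGroup Y] [NormedSpace ℝ Y] [NormedAddCommGroup G] [NormedSpace ℝ G]

theorem fderiv_section {f : P × Y → G} {p : P} {y : Y} (hf : DifferentiableAt ℝ f (p, y)) :
    fderiv ℝ (fun p => f (p, y)) p = (fderiv ℝ f (p, y)).comp (ContinuousLinearMap.inl ℝ P Y) :=
  (hf.hasFDerivAt.comp p (hasFDerivAt_prodMk_left p y)).fderiv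

variable [FiniteDimensional ℝ P] [FiniteDimensional ℝ Y] [MeasurableSpace Y]
  [BorelSpace Y] {μ : Measure Y} [IsLocallyFiniteMeasure μ]

/-- Differentiation under the integral sign for compactly supported integrands. -/
theorem hasFDerivAt_integral_of_contDiffOn {f : P × Y → G} {O : Set P} (hO : IsOpen O) {K : Set Y}
    (hK : IsCompact K) (hf : ContDiffOn ℝ 1 f (O ×ˢ univ)) (h0 : ∀ p ∈ O, ∀ y ∉ K, f (p, y) = 0)
    {p : P} (hp : p ∈ O) :
    Integrable (fun y => fderiv ℝ (fun p => f (p, y)) p) μ ∧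
      HasFDerivAt (fun p => ∫ y, f (p, y) ∂μ) (∫ y, fderiv ℝ (fun p => f (p, y)) p ∂μ) p := by
  have hOu : IsOpen (O ×ˢ (univ : Set Y)) := hO.prod isOpen_univ
  have hda : ∀ p ∈ O, ∀ y, DifferentiableAt ℝ f (p, y) := fun p hp y =>
    (hf.differentiableOn one_ne_zero).differentiableAt (hOu.mem_nhds ⟨hp, mem_univ y⟩)
  have hdc : ContinuousOn (fderiv ℝ f) (O ×ˢ univ) := hf.continuousOn_fderiv_of_isOpen hOu le_rfl
  have hd' : ∀ p ∈ O, ∀ y ∉ K, fderiv ℝ (fun p => f (p, y)) p = 0 := by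
    intro p hp y hy
    have : (fun p => f (p, y)) =ᶠ[nhds p] fun _ => 0 := by
      filter_upwards [hO.mem_nhds hp] with q hq using h0 q hq y hy
    rw [this.fderiv_eq]
    simp
  have hs : ∀ p ∈ O, Continuous fun y => f (p, y) := fun p hp =>
    hf.continuousOn.comp_continuous (by fun_prop) fun y => ⟨hp, mem_univ y⟩
  have hs' : ∀ p ∈ O, Continuous fun y => fderiv ℝ (fun p => f (p, y)) p := fun p hp => by
    simp only [fderiv_section (hda p hp _)]
    exact (hdc.comp_continuous (by fun_prop) fun y => ⟨hp, mem_univ y⟩).clm_comp continuous_const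
  have hcs : ∀ p ∈ O, HasCompactSupport fun y => f (p, y) := fun p hp =>
    HasCompactSupport.intro hK (h0 p hp)
  have hcs' : ∀ p ∈ O, HasCompactSupport fun y => fderiv ℝ (fun p => f (p, y)) p := fun p hp =>
    HasCompactSupport.intro hK (hd' p hp)
  have hint := (hs' p hp).integrable_of_hasCompactSupport (hcs' p hp) (μ := μ)
  refine ⟨hint, ?_⟩
  obtain ⟨N, hN, hNO, hNc⟩ := local_compact_nhds (hO.mem_nhds hp)
  obtain ⟨M, hM⟩ := (hNc.prod hK).exists_bound_of_continuousOn
    (hdc.mono (prod_mono hNO (subset_univ K)))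
  refine hasFDerivAt_integral_of_dominated_of_fderiv_le
    (F' := fun p y => fderiv ℝ (fun p => f (p, y)) p) (bound := K.indicator fun _ => M) hN
    ?_ ((hs p hp).integrable_of_hasCompactSupport (hcs p hp)) hint.aestronglyMeasurable ?_ ?_ ?_
  · filter_upwards [hO.mem_nhds hp] with q hq using (hs q hq).aestronglyMeasurable
  · refine Filter.Eventually.of_forall fun y q hq => ?_
    by_cases hy : y ∈ K
    · rw [indicator_of_mem hy, fderiv_section (hda q (hNO hq) y)]
      refine (ContinuousLinearMap.opNorm_comp_le _ _).trans ?_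
      exact (mul_le_of_le_one_right (norm_nonneg _) (ContinuousLinearMap.norm_inl_le_one ℝ P Y)).trans
        (hM (q, y) ⟨hq, hy⟩)
    · rw [indicator_of_notMem hy, hd' q (hNO hq) y hy, norm_zero]
  · exact (integrable_indicator_iff hK.measurableSet).2 (integrableOn_const hK.measure_ne_top)
  · refine Filter.Eventually.of_forall fun y q hq => ?_
    exact (DifferentiableAt.comp (g := f) q (hda q (hNO hq) y)
      (hasFDerivAt_prodMk_left q y).differentiableAt).hasFDerivAt

theorem contDiff_integral_of_contDiff {f : P × Y → G} {K : Set Y}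
    (hK : IsCompact K) (hf : ContDiff ℝ 1 f) (h0 : ∀ p, ∀ y ∉ K, f (p, y) = 0) :
    ContDiff ℝ 1 fun p => ∫ y, f (p, y) ∂μ := by
  refine contDiff_one_iff_hasFDerivAt.2 ⟨_, ?_, fun p => (hasFDerivAt_integral_of_contDiffOn
    isOpen_univ hK hf.contDiffOn (fun p _ => h0 p) (mem_univ p)).2⟩
  have hd' : ∀ p, ∀ y ∉ K, fderiv ℝ (fun p => f (p, y)) p = 0 := by
    intro p y hy
    have : (fun p => f (p, y)) = fun _ => 0 := funext fun q => h0 q y hy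
    rw [this]
    simp
  have e : ∀ p, ∫ y, fderiv ℝ (fun p => f (p, y)) p ∂μ =
      ∫ y in K, (fderiv ℝ f (p, y)).comp (ContinuousLinearMap.inl ℝ P Y) ∂μ := fun p => by
    rw [← setIntegral_eq_integral_of_forall_compl_eq_zero (hd' p)]
    exact setIntegral_congr_fun hK.measurableSet fun y _ =>
      fderiv_section (hf.differentiable one_ne_zero _)
  simp only [e]
  refine continuous_parametric_integral_of_continuous ?_ hK
  exact (hf.continuous_fderiv one_ne_zero).clm_comp continuous_const

end ParametricIntegral

/-! ### The mollifier at scale equal to the height -/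

section Kernel

variable (n : ℕ)

/-- A smooth bump function on `ℝⁿ`, supported in the unit ball. -/
def mollifierBump : ContDiffBump (0 : EuclideanSpace ℝ (Fin n)) where
  rIn := 1 / 2
  rOut := 1
  rIn_pos := by norm_num
  rIn_lt_rOut := by norm_num

/-- A smooth mollifier of integral one on `ℝⁿ`, supported in the unit ball. -/
def mollifier : EuclideanSpace ℝ (Fin n) → ℝ := (mollifierBump n).normed volume

theorem contDiff_mollifier : ContDiff ℝ 1 (mollifier n) := (mollifierBump n).contDiff_normed

theorem integral_mollifier : ∫ w, mollifier n w = 1 := (mollifierBump n).integral_normed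

variable {n}

theorem mollifier_eq_zero {w : EuclideanSpace ℝ (Fin n)} (hw : 1 ≤ ‖w‖) : mollifier n w = 0 := by
  by_contra h
  have : w ∈ Function.support (mollifier n) := h
  rw [mollifier, ContDiffBump.support_normed_eq, mem_ball_zero_iff] at this
  exact absurd this (not_lt.2 hw)

theorem hasCompactSupport_mollifier : HasCompactSupport (mollifier n) :=
  (mollifierBump n).hasCompactSupport_normed

/-- The mollifier at scale `t`, as a function of `z = (x, t)` and `y`. -/
def kern (q : EuclideanSpace ℝ (Fin (n + 1)) × EuclideanSpace ℝ (Fin n)) : ℝ :=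
  (height n q.1 ^ n)⁻¹ * mollifier n ((height n q.1)⁻¹ • (horizontal n q.1 - q.2))

theorem contDiffOn_kern : ContDiffOn ℝ 1 (kern (n := n)) (openHalfSpace n ×ˢ univ) := by
  have h1 := contDiff_mollifier n
  have hne : ∀ q ∈ openHalfSpace n ×ˢ (univ : Set (EuclideanSpace ℝ (Fin n))),
      height n q.1 ≠ 0 := fun q hq => (mem_openHalfSpace.1 hq.1).ne'
  have h2 : ContDiff ℝ 1 fun q : EuclideanSpace ℝ (Fin (n + 1)) × EuclideanSpace ℝ (Fin n) =>
      height n q.1 := by fun_prop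
  have h3 : ContDiff ℝ 1 fun q : EuclideanSpace ℝ (Fin (n + 1)) × EuclideanSpace ℝ (Fin n) =>
      horizontal n q.1 - q.2 := by fun_prop
  exact ((h2.pow n).contDiffOn.inv fun q hq => pow_ne_zero n (hne q hq)).mul
    (h1.comp_contDiffOn ((h2.contDiffOn.inv hne).smul h3.contDiffOn))

theorem kern_eq_zero {z : EuclideanSpace ℝ (Fin (n + 1))} {y : EuclideanSpace ℝ (Fin n)}
    (hz : 0 < height n z) (hy : height n z ≤ ‖horizontal n z - y‖) : kern (z, y) = 0 := by
  rw [kern, mollifier_eq_zero, mul_zero]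
  rw [norm_smul, norm_inv, Real.norm_of_nonneg hz.le, inv_mul_eq_div, le_div_iff₀ hz, one_mul]
  exact hy

/-- Substitution in a mollification. -/
theorem integral_mollifier_eq {G : Type*} [NormedAddCommGroup G] [NormedSpace ℝ G]
    {z : EuclideanSpace ℝ (Fin (n + 1))} (hz : 0 < height n z) (H : EuclideanSpace ℝ (Fin n) → G) :
    ∫ w, mollifier n w • H (horizontal n z - height n z • w) = ∫ y, kern (z, y) • H y := by
  set t := height n z
  set x := horizontal n z
  have h1 := Measure.integral_comp_smul (volume : Measure (EuclideanSpace ℝ (Fin n)))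
    (fun y => mollifier n (t⁻¹ • y) • H (x - y)) t
  simp only [smul_smul, inv_mul_cancel₀ hz.ne', one_smul] at h1
  rw [h1, finrank_euclideanSpace_fin, abs_of_pos (by positivity)]
  have h2 := integral_sub_left_eq_self (fun y => mollifier n (t⁻¹ • (x - y)) • H y) volume x
  simp only [sub_sub_cancel] at h2
  rw [h2, ← integral_smul]
  refine integral_congr_ae (Filter.Eventually.of_forall fun y => ?_)
  simp only [kern, smul_smul]
  rfl

theorem integral_kern {z : EuclideanSpace ℝ (Fin (n + 1))} (hz : 0 < height n z) :
    ∫ y, kern (z, y) = 1 := by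
  have := integral_mollifier_eq hz fun _ => (1 : ℝ)
  simp only [smul_eq_mul, mul_one] at this
  rw [← this, integral_mollifier]

/-- By scaling, a derivative of the kernel costs a factor `t⁻¹`. The derivative of the scale itself
brings out `‖x - y‖ / t ^ 2`, which is at most `t⁻¹` on the support. -/
theorem exists_kern_bound (n : ℕ) : ∃ A : ℝ, 0 < A ∧
    ∀ (z : EuclideanSpace ℝ (Fin (n + 1))) (y : EuclideanSpace ℝ (Fin n)), 0 < height n z →
      |kern (z, y)| ≤ A * (height n z ^ n)⁻¹ ∧
      (∀ v, |fderiv ℝ (fun z => kern (z, y)) z v| ≤ A * (height n z ^ (n + 1))⁻¹ * ‖v‖) ∧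
      (height n z < ‖horizontal n z - y‖ → fderiv ℝ (fun z => kern (z, y)) z = 0) := by
  obtain ⟨M, hM⟩ := (hasCompactSupport_mollifier (n := n)).exists_bound_of_continuous
    (contDiff_mollifier n).continuous
  obtain ⟨L, hL⟩ := ((hasCompactSupport_mollifier (n := n)).fderiv (𝕜 := ℝ)).exists_bound_of_continuous
    ((contDiff_mollifier n).continuous_fderiv one_ne_zero)
  have hM0 : 0 ≤ M := (norm_nonneg _).trans (hM 0)
  have hL0 : 0 ≤ L := (norm_nonneg _).trans (hL 0)
  -- Here `n * M` comes from differentiating `t ^ (-n)` and `2 * L` from the two parts of the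
  -- argument of the mollifier. The extra `M` serves the bound of the kernel itself, and the `1`
  -- gives positivity.
  refine ⟨(n + 1) * M + 2 * L + 1, by positivity, fun z y hz => ?_⟩
  set t := height n z with ht
  have hvanish : t < ‖horizontal n z - y‖ → fderiv ℝ (fun z => kern (z, y)) z = 0 := by
    intro hlt
    have : (fun z => kern (z, y)) =ᶠ[nhds z] fun _ => 0 := by
      have ho : IsOpen {z : EuclideanSpace ℝ (Fin (n + 1)) |
          height n z < ‖horizontal n z - y‖} := isOpen_lt (by fun_prop) (by fun_prop)
      filter_upwards [ho.mem_nhds hlt, isOpen_openHalfSpace.mem_nhds (mem_openHalfSpace.2 hz)]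
        with w hw hw' using kern_eq_zero hw' (le_of_lt hw)
    rw [this.fderiv_eq]
    simp
  refine ⟨?_, fun v => ?_, hvanish⟩
  · rw [kern, abs_mul, abs_of_pos (by positivity), mul_comm]
    refine mul_le_mul_of_nonneg_right ?_ (by positivity)
    have := hM (t⁻¹ • (horizontal n z - y))
    rw [Real.norm_eq_abs] at this
    nlinarith
  · by_cases hlt : t < ‖horizontal n z - y‖
    · rw [hvanish hlt]
      simp only [zero_apply, abs_zero]
      positivity
    push Not at hlt
    set ξ := t⁻¹ • (horizontal n z - y) with hξ
    have d1 : HasFDerivAt (fun z => (height n z ^ n)⁻¹)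
        (-((t ^ n) ^ 2)⁻¹ • ((n * t ^ (n - 1)) • height n)) z := by
      have h := (height n).hasFDerivAt (x := z)
      have h2 : HasFDerivAt (fun z => height n z ^ n) ((n * t ^ (n - 1)) • height n) z :=
        (hasDerivAt_pow n t).comp_hasFDerivAt z h
      exact (hasDerivAt_inv (pow_pos hz n).ne').comp_hasFDerivAt z h2
    have d2 : HasFDerivAt (fun z => (height n z)⁻¹ • (horizontal n z - y))
        (t⁻¹ • horizontal n + (-(t ^ 2)⁻¹ • height n).smulRight (horizontal n z - y)) z := by
      have h := (hasDerivAt_inv hz.ne').comp_hasFDerivAt z (height n).hasFDerivAt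
      exact h.smul ((horizontal n).hasFDerivAt.sub_const y)
    have d3 : HasFDerivAt (fun z => mollifier n ((height n z)⁻¹ • (horizontal n z - y)))
        ((fderiv ℝ (mollifier n) ξ).comp
          (t⁻¹ • horizontal n + (-(t ^ 2)⁻¹ • height n).smulRight (horizontal n z - y))) z :=
      (((contDiff_mollifier n).differentiable one_ne_zero ξ).hasFDerivAt).comp z d2
    have d4 := (d1.mul d3).fderiv
    change fderiv ℝ (fun z => kern (z, y)) z = _ at d4
    rw [d4]
    simp only [add_apply, smul_apply, ContinuousLinearMap.comp_apply,
      ContinuousLinearMap.smulRight_apply, smul_eq_mul]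
    have hv1 := abs_height_le v
    have hv2 := norm_horizontal_le v
    have b1 : |fderiv ℝ (mollifier n) ξ (t⁻¹ • horizontal n v +
        (-(t ^ 2)⁻¹ * height n v) • (horizontal n z - y))| ≤ L * (2 * t⁻¹ * ‖v‖) := by
      rw [← Real.norm_eq_abs]
      refine (ContinuousLinearMap.le_opNorm _ _).trans (mul_le_mul (hL ξ) ?_ (norm_nonneg _) hL0)
      refine (norm_add_le _ _).trans ?_
      rw [norm_smul, norm_smul, norm_mul, norm_neg, norm_inv, norm_inv, norm_pow,
        Real.norm_of_nonneg hz.le, Real.norm_eq_abs]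
      calc t⁻¹ * ‖horizontal n v‖ + (t ^ 2)⁻¹ * |height n v| * ‖horizontal n z - y‖
          ≤ t⁻¹ * ‖v‖ + (t ^ 2)⁻¹ * ‖v‖ * t := by gcongr
        _ = 2 * t⁻¹ * ‖v‖ := by
            field_simp
            ring
    have b2 : |(-((t ^ n) ^ 2)⁻¹ * (n * t ^ (n - 1) * height n v)) * mollifier n ξ| ≤
        (t ^ (n + 1))⁻¹ * (n * M * ‖v‖) := by
      have hMξ := hM ξ
      rw [Real.norm_eq_abs] at hMξ
      -- Truncated subtraction in `t ^ (n - 1)` forces the case `n = 0`, where both sides vanish.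
      have e : ((t ^ n) ^ 2)⁻¹ * (n * t ^ (n - 1)) = n * (t ^ (n + 1))⁻¹ := by
        rcases Nat.eq_zero_or_pos n with h | h
        · subst h
          simp
        · obtain ⟨m, rfl⟩ := Nat.exists_eq_succ_of_ne_zero h.ne'
          simp only [Nat.succ_eq_add_one, Nat.add_sub_cancel]
          field_simp
          ring
      calc _ = (((t ^ n) ^ 2)⁻¹ * (n * t ^ (n - 1))) * |height n v| * |mollifier n ξ| := by
            rw [abs_mul, abs_mul, abs_neg, abs_mul, abs_of_pos (by positivity :
              0 < ((t ^ n) ^ 2)⁻¹), abs_of_nonneg (by positivity : 0 ≤ (n : ℝ) * t ^ (n - 1))]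
            ring
        _ ≤ (n * (t ^ (n + 1))⁻¹) * ‖v‖ * M := by
            rw [e]
            gcongr
        _ = _ := by ring
    have b3 : |(t ^ n)⁻¹ * fderiv ℝ (mollifier n) ξ (t⁻¹ • horizontal n v +
        (-(t ^ 2)⁻¹ * height n v) • (horizontal n z - y))| ≤
        (t ^ (n + 1))⁻¹ * (2 * L * ‖v‖) := by
      rw [abs_mul, abs_of_pos (by positivity : 0 < (t ^ n)⁻¹)]
      calc _ ≤ (t ^ n)⁻¹ * (L * (2 * t⁻¹ * ‖v‖)) := by gcongr
        _ = _ := by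
            rw [pow_succ, mul_inv]
            ring
    have b4 := abs_add_le ((t ^ n)⁻¹ * fderiv ℝ (mollifier n) ξ (t⁻¹ • horizontal n v +
        (-(t ^ 2)⁻¹ * height n v) • (horizontal n z - y)))
      ((-((t ^ n) ^ 2)⁻¹ * (n * t ^ (n - 1) * height n v)) * mollifier n ξ)
    have b5 : 0 ≤ (t ^ (n + 1))⁻¹ * (M + 1) * ‖v‖ := by positivity
    have b6 : ((n + 1) * M + 2 * L + 1) * (t ^ (n + 1))⁻¹ * ‖v‖ = (t ^ (n + 1))⁻¹ * (n * M * ‖v‖) +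
      (t ^ (n + 1))⁻¹ * (2 * L * ‖v‖) + (t ^ (n + 1))⁻¹ * (M + 1) * ‖v‖ := by ring
    rw [b6]
    refine le_trans (le_of_eq ?_) (b4.trans (by linarith))
    congr 1
    rw [mul_comm (mollifier n ξ)]

end Kernel

/-! ### The extension by mollified parallel transport -/

section SmoothExtension

variable {n : ℕ} {F : Type*} [NormedAddCommGroup F] [InnerProductSpace ℝ F]

/-- The mollification at height `t` of a function, parallel transported from the boundary. -/
def smoothExt (Γ : EuclideanSpace ℝ (Fin (n + 1)) → EuclideanSpace ℝ (Fin (n + 1)) →L[ℝ] F →L[ℝ] F)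
    (u : EuclideanSpace ℝ (Fin n) → F) (z : EuclideanSpace ℝ (Fin (n + 1))) : F :=
  ∫ w, mollifier n w • transport Γ (boundaryIncl n (horizontal n z - height n z • w), z)
    (u (horizontal n z - height n z • w))

/-- The average of a function over a ball, up to a constant. -/
def ballAverage (f : EuclideanSpace ℝ (Fin n) → ℝ≥0∞) (x : EuclideanSpace ℝ (Fin n)) (t : ℝ) :
    ℝ≥0∞ :=
  ENNReal.ofReal (t ^ n)⁻¹ * ∫⁻ y in Metric.closedBall x t, f y

variable
  {Γ : EuclideanSpace ℝ (Fin (n + 1)) → EuclideanSpace ℝ (Fin (n + 1)) →L[ℝ] F →L[ℝ] F}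

theorem smoothExt_smul (c : ℝ) (u : EuclideanSpace ℝ (Fin n) → F)
    (z : EuclideanSpace ℝ (Fin (n + 1))) : smoothExt Γ (c • u) z = c • smoothExt Γ u z := by
  rw [smoothExt, smoothExt, ← integral_smul]
  simp only [Pi.smul_apply, map_smul, smul_comm c]

theorem smoothExt_eq_zero {u : EuclideanSpace ℝ (Fin n) → F} {z : EuclideanSpace ℝ (Fin (n + 1))}
    (h : ∀ y, ‖horizontal n z - y‖ ≤ |height n z| → u y = 0) : smoothExt Γ u z = 0 := by
  rw [smoothExt, integral_eq_zero_of_ae]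
  refine Filter.Eventually.of_forall fun w => ?_
  by_cases hw : 1 ≤ ‖w‖
  · simp [mollifier_eq_zero hw]
  · have := h (horizontal n z - height n z • w) (by
      rw [sub_sub_cancel, norm_smul, Real.norm_eq_abs]
      exact mul_le_of_le_one_right (abs_nonneg _) (le_of_not_ge hw))
    simp [this]

theorem smoothExt_eq_integral_kern (u : EuclideanSpace ℝ (Fin n) → F)
    {z : EuclideanSpace ℝ (Fin (n + 1))} (hz : 0 < height n z) :
    smoothExt Γ u z = ∫ y, kern (z, y) • transport Γ (boundaryIncl n y, z) (u y) :=
  integral_mollifier_eq hz fun y => transport Γ (boundaryIncl n y, z) (u y)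

variable [FiniteDimensional ℝ F]

local instance : CompleteSpace F := FiniteDimensional.complete ℝ F

/-- In the rescaled variable the integration is over a fixed unit ball and nothing is singular at
height zero, so regularity up to and across the boundary is immediate. The kernel form is needed
only for estimates at positive height. -/
theorem IsSkewForm.contDiff_smoothExt (hΓ : IsSkewForm Γ) {u : EuclideanSpace ℝ (Fin n) → F}
    (hu : ContDiff ℝ 1 u) : ContDiff ℝ 1 (smoothExt Γ u) := by
  have hT := hΓ.contDiff_transport
  have hm := contDiff_mollifier n
  refine contDiff_integral_of_contDiff (f := fun q : EuclideanSpace ℝ (Fin (n + 1)) ×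
    EuclideanSpace ℝ (Fin n) => mollifier n q.2 •
      transport Γ (boundaryIncl n (horizontal n q.1 - height n q.1 • q.2), q.1)
        (u (horizontal n q.1 - height n q.1 • q.2)))
    (isCompact_closedBall 0 1) (by fun_prop) fun z w hw => ?_
  rw [mem_closedBall_zero_iff, not_le] at hw
  simp only [mollifier_eq_zero hw.le, zero_smul]

theorem IsSkewForm.integrable_smoothExt (hΓ : IsSkewForm Γ) {u : EuclideanSpace ℝ (Fin n) → F}
    (hu : Continuous u) (z : EuclideanSpace ℝ (Fin (n + 1))) :
    Integrable fun w => mollifier n w •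
      transport Γ (boundaryIncl n (horizontal n z - height n z • w), z)
        (u (horizontal n z - height n z • w)) := by
  have hT := hΓ.continuous_transport
  have hm := (contDiff_mollifier n).continuous
  exact Continuous.integrable_of_hasCompactSupport (by fun_prop)
    hasCompactSupport_mollifier.smul_right

theorem IsSkewForm.smoothExt_add (hΓ : IsSkewForm Γ) {u v : EuclideanSpace ℝ (Fin n) → F}
    (hu : Continuous u) (hv : Continuous v) (z : EuclideanSpace ℝ (Fin (n + 1))) :
    smoothExt Γ (u + v) z = smoothExt Γ u z + smoothExt Γ v z := by
  rw [smoothExt, smoothExt, smoothExt,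
    ← integral_add (hΓ.integrable_smoothExt hu z) (hΓ.integrable_smoothExt hv z)]
  simp only [Pi.add_apply, map_add, smul_add]

theorem IsSkewForm.smoothExt_boundaryIncl (hΓ : IsSkewForm Γ) (u : EuclideanSpace ℝ (Fin n) → F)
    (x : EuclideanSpace ℝ (Fin n)) : smoothExt Γ u (boundaryIncl n x) = u x := by
  simp only [smoothExt, horizontal_boundaryIncl, height_boundaryIncl, zero_smul, sub_zero]
  rw [integral_smul_const, integral_mollifier, one_smul, hΓ.transport_self]
  rfl

theorem continuous_kern {z : EuclideanSpace ℝ (Fin (n + 1))} (hz : 0 < height n z) :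
    Continuous fun y => kern (z, y) :=
  contDiffOn_kern.continuousOn.comp_continuous (by fun_prop)
    fun y => ⟨mem_openHalfSpace.2 hz, mem_univ y⟩

theorem hasCompactSupport_kern {z : EuclideanSpace ℝ (Fin (n + 1))} (hz : 0 < height n z) :
    HasCompactSupport fun y => kern (z, y) := by
  refine HasCompactSupport.intro (isCompact_closedBall (horizontal n z) (height n z))
    fun y hy => kern_eq_zero hz ?_
  rw [Metric.mem_closedBall, dist_eq_norm, not_le, norm_sub_rev] at hy
  exact hy.le

/-- The covariant derivative of the smooth extension. -/
theorem IsSkewForm.covDeriv_smoothExt (hΓ : IsSkewForm Γ) {u : EuclideanSpace ℝ (Fin n) → F}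
    (hu : ContDiff ℝ 1 u) {z : EuclideanSpace ℝ (Fin (n + 1))} (hz : 0 < height n z) (S₀ : F)
    (v : EuclideanSpace ℝ (Fin (n + 1))) :
    fderiv ℝ (smoothExt Γ u) z v + Γ z v (smoothExt Γ u z) =
      ∫ y, (fderiv ℝ (fun z => kern (z, y)) z v •
          (transport Γ (boundaryIncl n y, z) (u y) - S₀) +
        kern (z, y) • (fderiv ℝ (fun z => transport Γ (boundaryIncl n y, z)) z v +
          Γ z v * transport Γ (boundaryIncl n y, z)) (u y)) := by
  have hT := hΓ.contDiff_transport
  -- A neighbourhood of `z` in which all kernels have support in one fixed ball, so that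
  -- differentiation under the integral applies.
  set O : Set (EuclideanSpace ℝ (Fin (n + 1))) :=
    {w | ‖horizontal n w - horizontal n z‖ < 1 ∧ 0 < height n w ∧ height n w < height n z + 1}
    with hO
  have hOo : IsOpen O := by
    have o₁ : IsOpen {w | ‖horizontal n w - horizontal n z‖ < 1} :=
      isOpen_lt (by fun_prop) (by fun_prop)
    have o₂ : IsOpen {w | 0 < height n w} := isOpen_lt (by fun_prop) (by fun_prop)
    have o₃ : IsOpen {w | height n w < height n z + 1} := isOpen_lt (by fun_prop) (by fun_prop)
    exact o₁.inter (o₂.inter o₃)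
  have hzO : z ∈ O := ⟨by simp, hz, by linarith⟩
  set f : EuclideanSpace ℝ (Fin (n + 1)) × EuclideanSpace ℝ (Fin n) → F := fun q =>
    kern q • (transport Γ (boundaryIncl n q.2, q.1) (u q.2) - S₀) with hf
  have hk : ContDiffOn ℝ 1 (kern (n := n)) (O ×ˢ univ) :=
    contDiffOn_kern.mono (prod_mono (fun w hw => mem_openHalfSpace.2 hw.2.1) subset_rfl)
  have hS : ContDiff ℝ 1 fun q : EuclideanSpace ℝ (Fin (n + 1)) × EuclideanSpace ℝ (Fin n) =>
    transport Γ (boundaryIncl n q.2, q.1) (u q.2) - S₀ := by fun_prop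
  have h0 : ∀ w ∈ O, ∀ y ∉ Metric.closedBall (horizontal n z) (height n z + 2), f (w, y) = 0 := by
    intro w hw y hy
    rw [Metric.mem_closedBall, dist_eq_norm, not_le] at hy
    refine smul_eq_zero_of_left (kern_eq_zero hw.2.1 ?_) _
    have h1 := hw.1
    have h2 := hw.2.2
    have h3 := norm_sub_le_norm_sub_add_norm_sub y (horizontal n w) (horizontal n z)
    rw [norm_sub_rev y (horizontal n w)] at h3
    linarith
  obtain ⟨hint, hder⟩ := hasFDerivAt_integral_of_contDiffOn (μ := volume) (f := f) hOo
    (isCompact_closedBall (horizontal n z) (height n z + 2)) (hk.smul hS.contDiffOn) h0 hzO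
  have hcu := hu.continuous
  have hcT := hΓ.continuous_transport
  have hint2 : ∀ w, 0 < height n w → Integrable fun y =>
      kern (w, y) • transport Γ (boundaryIncl n y, w) (u y) := fun w hw => by
    have := continuous_kern hw
    exact Continuous.integrable_of_hasCompactSupport (by fun_prop)
      (hasCompactSupport_kern hw).smul_right
  -- The kernel has integral one at every height, so subtracting `S₀` inside the integral changes
  -- the extension only by a constant, which differentiation removes.
  have hV : ∀ w, 0 < height n w → smoothExt Γ u w = (∫ y, f (w, y)) + S₀ := by
    intro w hw
    have hi : Integrable fun y => kern (w, y) • S₀ :=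
      ((continuous_kern hw).smul continuous_const).integrable_of_hasCompactSupport
        (hasCompactSupport_kern hw).smul_right
    simp only [hf, smul_sub]
    rw [integral_sub (hint2 w hw) hi, integral_smul_const, integral_kern hw, one_smul,
      sub_add_cancel, smoothExt_eq_integral_kern u hw]
  have hVe : smoothExt Γ u =ᶠ[nhds z] fun w => (∫ y, f (w, y)) + S₀ := by
    filter_upwards [isOpen_openHalfSpace.mem_nhds (mem_openHalfSpace.2 hz)] with w hw
    exact hV w hw
  have hd : fderiv ℝ (smoothExt Γ u) z = ∫ y, fderiv ℝ (fun w => f (w, y)) z := by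
    rw [hVe.fderiv_eq]
    exact (hder.add_const S₀).fderiv
  have e1 : Γ z v (smoothExt Γ u z) = ∫ y, Γ z v (kern (z, y) •
      transport Γ (boundaryIncl n y, z) (u y)) := by
    rw [smoothExt_eq_integral_kern u hz]
    exact ((Γ z v).integral_comp_comm (hint2 z hz)).symm
  rw [hd, e1, ContinuousLinearMap.integral_apply hint, ← integral_add]
  · refine integral_congr_ae (Filter.Eventually.of_forall fun y => ?_)
    have d1 : DifferentiableAt ℝ (fun w => kern (w, y)) z :=
      DifferentiableAt.comp (g := kern) z ((contDiffOn_kern.differentiableOn one_ne_zero).differentiableAt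
        ((isOpen_openHalfSpace.prod isOpen_univ).mem_nhds ⟨mem_openHalfSpace.2 hz, mem_univ y⟩))
        (hasFDerivAt_prodMk_left z y).differentiableAt
    have d2 : DifferentiableAt ℝ (fun w => transport Γ (boundaryIncl n y, w)) z :=
      (ContDiff.differentiable (n := 1) (by fun_prop) one_ne_zero) z
    have d3 : HasFDerivAt (fun w => transport Γ (boundaryIncl n y, w) (u y) - S₀)
        ((fderiv ℝ (fun w => transport Γ (boundaryIncl n y, w)) z).flip (u y)) z := by
      have := d2.hasFDerivAt.clm_apply (hasFDerivAt_const (u y) z)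
      simpa using this.sub_const S₀
    have d4 := (d1.hasFDerivAt.smul d3).fderiv
    change fderiv ℝ (fun w => f (w, y)) z = _ at d4
    simp only [d4, add_apply, smul_apply, ContinuousLinearMap.smulRight_apply,
      ContinuousLinearMap.flip_apply, map_smul, smul_add]
    simp only [ContinuousLinearMap.mul_def, ContinuousLinearMap.comp_apply]
    abel
  · exact (ContinuousLinearMap.apply ℝ F v).integrable_comp hint
  · exact (Γ z v).integrable_comp (hint2 z hz)

/-- The constant of the kernel bounds. -/
def kernConst (n : ℕ) : ℝ := (exists_kern_bound n).choose

theorem kernConst_pos (n : ℕ) : 0 < kernConst n := (exists_kern_bound n).choose_spec.1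

theorem abs_kern_le {z : EuclideanSpace ℝ (Fin (n + 1))} (hz : 0 < height n z)
    (y : EuclideanSpace ℝ (Fin n)) : |kern (z, y)| ≤ kernConst n * (height n z ^ n)⁻¹ :=
  ((exists_kern_bound n).choose_spec.2 z y hz).1

theorem abs_fderiv_kern_le {z : EuclideanSpace ℝ (Fin (n + 1))} (hz : 0 < height n z)
    (y : EuclideanSpace ℝ (Fin n)) (v : EuclideanSpace ℝ (Fin (n + 1))) :
    |fderiv ℝ (fun z => kern (z, y)) z v| ≤ kernConst n * (height n z ^ (n + 1))⁻¹ * ‖v‖ :=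
  ((exists_kern_bound n).choose_spec.2 z y hz).2.1 v

theorem fderiv_kern_eq_zero {z : EuclideanSpace ℝ (Fin (n + 1))} (hz : 0 < height n z)
    {y : EuclideanSpace ℝ (Fin n)} (hy : height n z < ‖horizontal n z - y‖) :
    fderiv ℝ (fun z => kern (z, y)) z = 0 :=
  ((exists_kern_bound n).choose_spec.2 z y hz).2.2 hy

theorem IsSkewForm.enorm_smoothExt_le (hΓ : IsSkewForm Γ) (u : EuclideanSpace ℝ (Fin n) → F)
    {z : EuclideanSpace ℝ (Fin (n + 1))} (hz : 0 < height n z) :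
    ‖smoothExt Γ u z‖ₑ ≤ ENNReal.ofReal (kernConst n) *
      ballAverage (fun y => ‖u y‖ₑ) (horizontal n z) (height n z) := by
  have hA := (kernConst_pos n).le
  rw [smoothExt_eq_integral_kern u hz, ballAverage, ← mul_assoc, ← ENNReal.ofReal_mul hA,
    ← setIntegral_eq_integral_of_forall_compl_eq_zero
      (s := Metric.closedBall (horizontal n z) (height n z)),
    ← lintegral_const_mul' _ _ ENNReal.ofReal_ne_top]
  · refine (enorm_integral_le_lintegral_enorm _).trans (lintegral_mono fun y => ?_)
    rw [enorm_smul, enorm_eq_iff_norm_eq.2 (hΓ.norm_transport_apply _ _), ← ofReal_norm (kern _),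
      Real.norm_eq_abs]
    gcongr
    exact abs_kern_le hz y
  · intro y hy
    rw [Metric.mem_closedBall, dist_eq_norm, not_le, norm_sub_rev] at hy
    rw [kern_eq_zero hz hy.le, zero_smul]

/-- Bound of the covariant derivative of the smooth extension. -/
theorem HalfSpaceForm.enorm_covDeriv_smoothExt_le {β : ℝ} (hΓ : HalfSpaceForm Γ β)
    {u : EuclideanSpace ℝ (Fin n) → F} (hu : ContDiff ℝ 1 u)
    {z : EuclideanSpace ℝ (Fin (n + 1))} (hz : 0 < height n z) (S₀ : F)
    (v : EuclideanSpace ℝ (Fin (n + 1))) :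
    ‖fderiv ℝ (smoothExt Γ u) z v + Γ z v (smoothExt Γ u z)‖ₑ ≤
      ENNReal.ofReal (kernConst n) * ballAverage (fun y => ENNReal.ofReal (height n z)⁻¹ *
          ‖transport Γ (boundaryIncl n y, z) (u y) - S₀‖ₑ +
        ENNReal.ofReal (2 * β * height n z) * ‖u y‖ₑ) (horizontal n z) (height n z) * ‖v‖ₑ := by
  have hA := (kernConst_pos n).le
  have hβ := hΓ.nonneg
  rw [hΓ.covDeriv_smoothExt hu hz S₀ v, ballAverage, ← mul_assoc, ← ENNReal.ofReal_mul hA,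
    ← setIntegral_eq_integral_of_forall_compl_eq_zero
      (s := Metric.closedBall (horizontal n z) (height n z)),
    ← lintegral_const_mul' _ _ ENNReal.ofReal_ne_top, ← lintegral_mul_const' _ _ enorm_ne_top]
  · refine (enorm_integral_le_lintegral_enorm _).trans
      (setLIntegral_mono' Metric.isClosed_closedBall.measurableSet fun y hy => ?_)
    rw [Metric.mem_closedBall, dist_eq_norm, norm_sub_rev] at hy
    have h1 : ‖fderiv ℝ (fun z => kern (z, y)) z v‖ₑ ≤
        ENNReal.ofReal (kernConst n * (height n z ^ n)⁻¹) * ENNReal.ofReal (height n z)⁻¹ *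
          ‖v‖ₑ := by
      rw [← ofReal_norm, ← ofReal_norm v, ← ENNReal.ofReal_mul (by positivity),
        ← ENNReal.ofReal_mul (by positivity), Real.norm_eq_abs]
      refine ENNReal.ofReal_le_ofReal ((abs_fderiv_kern_le hz y v).trans (le_of_eq ?_))
      rw [pow_succ, mul_inv]
      ring
    have h2 : ‖kern (z, y)‖ₑ ≤ ENNReal.ofReal (kernConst n * (height n z ^ n)⁻¹) := by
      rw [← ofReal_norm, Real.norm_eq_abs]
      exact ENNReal.ofReal_le_ofReal (abs_kern_le hz y)
    have h3 : ‖(fderiv ℝ (fun z => transport Γ (boundaryIncl n y, z)) z v +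
        Γ z v * transport Γ (boundaryIncl n y, z)) (u y)‖ₑ ≤
        ENNReal.ofReal (2 * β * height n z) * ‖u y‖ₑ * ‖v‖ₑ := by
      rw [← ofReal_norm, ← ofReal_norm v, ← ofReal_norm (u y),
        ← ENNReal.ofReal_mul (by positivity), ← ENNReal.ofReal_mul (by positivity)]
      refine ENNReal.ofReal_le_ofReal ((ContinuousLinearMap.le_opNorm _ _).trans ?_)
      have h4 := hΓ.norm_covDeriv_transport_le convex_closedHalfSpace hΓ.curvature_le
        (boundaryIncl_mem y) (openHalfSpace_subset (mem_openHalfSpace.2 hz)) v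
      have h5 : ‖z - boundaryIncl n y‖ ≤ 2 * height n z := by
        conv_lhs => rw [← pt_horizontal_height z, ← pt_zero, pt_sub_pt, sub_zero]
        refine (norm_pt_le _ _).trans ?_
        rw [abs_of_pos hz]
        linarith
      calc _ ≤ (β * (2 * height n z) * ‖v‖) * ‖u y‖ := by
            gcongr
            exact h4.trans (by gcongr)
        _ = _ := by ring
    refine (enorm_add_le _ _).trans ?_
    rw [enorm_smul, enorm_smul]
    refine (add_le_add (mul_le_mul' h1 le_rfl) (mul_le_mul' h2 h3)).trans (le_of_eq ?_)
    ring
  · intro y hy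
    rw [Metric.mem_closedBall, dist_eq_norm, not_le, norm_sub_rev] at hy
    rw [kern_eq_zero hz hy.le, fderiv_kern_eq_zero hz hy]
    simp

end SmoothExtension

/-! ### Averages over balls -/

section BallAverages

variable {n : ℕ}

/-- The volume of the unit ball. -/
def ballVolume (n : ℕ) : ℝ≥0∞ := volume (Metric.ball (0 : EuclideanSpace ℝ (Fin n)) 1)

theorem ballVolume_ne_top (n : ℕ) : ballVolume n ≠ ⊤ := measure_ball_lt_top.ne

theorem volume_closedBall_eq (x : EuclideanSpace ℝ (Fin n)) {t : ℝ} (ht : 0 ≤ t) :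
    volume (Metric.closedBall x t) = ENNReal.ofReal (t ^ n) * ballVolume n := by
  rw [Measure.addHaar_closedBall _ _ ht, finrank_euclideanSpace_fin, ballVolume]

theorem ballAverage_mono {f g : EuclideanSpace ℝ (Fin n) → ℝ≥0∞} {x : EuclideanSpace ℝ (Fin n)}
    {t : ℝ} (h : ∀ y ∈ Metric.closedBall x t, f y ≤ g y) : ballAverage f x t ≤ ballAverage g x t := by
  unfold ballAverage
  exact mul_le_mul' le_rfl (setLIntegral_mono' Metric.isClosed_closedBall.measurableSet h)

theorem ballAverage_const_mul {c : ℝ≥0∞} (hc : c ≠ ⊤) (f : EuclideanSpace ℝ (Fin n) → ℝ≥0∞)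
    (x : EuclideanSpace ℝ (Fin n)) (t : ℝ) :
    ballAverage (fun y => c * f y) x t = c * ballAverage f x t := by
  rw [ballAverage, ballAverage, lintegral_const_mul' _ _ hc, mul_left_comm]

theorem ballAverage_add {f : EuclideanSpace ℝ (Fin n) → ℝ≥0∞} (hf : Measurable f)
    (g : EuclideanSpace ℝ (Fin n) → ℝ≥0∞) (x : EuclideanSpace ℝ (Fin n)) (t : ℝ) :
    ballAverage (fun y => f y + g y) x t = ballAverage f x t + ballAverage g x t := by
  rw [ballAverage, ballAverage, ballAverage, lintegral_add_left hf, mul_add]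

/-- Jensen's inequality; the powers of `t` combine as `-n * p + n * (p - 1) = -n`, so the constant
does not depend on the scale. -/
theorem ballAverage_rpow_le {p : ℝ} (hp : 1 < p) {f : EuclideanSpace ℝ (Fin n) → ℝ≥0∞}
    (hf : Measurable f) (x : EuclideanSpace ℝ (Fin n)) {t : ℝ} (ht : 0 < t) :
    ballAverage f x t ^ p ≤ ballVolume n ^ (p - 1) * ballAverage (fun y => f y ^ p) x t := by
  have hp0 : 0 < p := by linarith
  have h := rpow_lintegral_le (volume.restrict (Metric.closedBall x t)) hp hf.aemeasurable
  rw [Measure.restrict_apply_univ, volume_closedBall_eq x ht.le,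
    ENNReal.mul_rpow_of_nonneg _ _ (by linarith)] at h
  rw [ballAverage, ballAverage, ENNReal.mul_rpow_of_nonneg _ _ hp0.le]
  calc _ ≤ ENNReal.ofReal (t ^ n)⁻¹ ^ p * (ENNReal.ofReal (t ^ n) ^ (p - 1) *
        ballVolume n ^ (p - 1) * ∫⁻ y in Metric.closedBall x t, f y ^ p) := by gcongr
    _ = ballVolume n ^ (p - 1) * ((ENNReal.ofReal (t ^ n)⁻¹ ^ p *
          ENNReal.ofReal (t ^ n) ^ (p - 1)) * ∫⁻ y in Metric.closedBall x t, f y ^ p) := by ring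
    _ = _ := by
        have htn : 0 < t ^ n := pow_pos ht n
        rw [ENNReal.ofReal_rpow_of_nonneg (by positivity) hp0.le,
          ENNReal.ofReal_rpow_of_nonneg htn.le (by linarith),
          ← ENNReal.ofReal_mul (by positivity), Real.inv_rpow htn.le, ← Real.rpow_neg htn.le,
          ← Real.rpow_add htn, ← Real.rpow_neg_one]
        congr 4
        ring

/-- The indicator function of `‖x - y‖ ≤ t`. -/
def ballIndicator (t : ℝ) (x y : EuclideanSpace ℝ (Fin n)) : ℝ≥0∞ := if ‖x - y‖ ≤ t then 1 else 0

theorem setLIntegral_closedBall_eq (f : EuclideanSpace ℝ (Fin n) → ℝ≥0∞)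
    (x : EuclideanSpace ℝ (Fin n)) (t : ℝ) :
    ∫⁻ y in Metric.closedBall x t, f y = ∫⁻ y, ballIndicator t x y * f y := by
  rw [← lintegral_indicator Metric.isClosed_closedBall.measurableSet]
  refine lintegral_congr fun y => ?_
  by_cases h : ‖x - y‖ ≤ t
  · rw [indicator_of_mem (by rwa [Metric.mem_closedBall, dist_eq_norm, norm_sub_rev]),
      ballIndicator, if_pos h, one_mul]
  · rw [indicator_of_notMem (by rwa [Metric.mem_closedBall, dist_eq_norm, norm_sub_rev]),
      ballIndicator, if_neg h, zero_mul]

theorem measurable_ballIndicator : Measurable fun q : ℝ × EuclideanSpace ℝ (Fin n) ×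
    EuclideanSpace ℝ (Fin n) => ballIndicator q.1 q.2.1 q.2.2 :=
  Measurable.ite (isClosed_le (by fun_prop) (by fun_prop)).measurableSet measurable_const
    measurable_const

theorem lintegral_ballIndicator (y : EuclideanSpace ℝ (Fin n)) {t : ℝ} (ht : 0 < t) :
    ∫⁻ x, ballIndicator t x y = ENNReal.ofReal (t ^ n) * ballVolume n := by
  have h := setLIntegral_closedBall_eq (fun _ => 1) y t
  rw [setLIntegral_one, volume_closedBall_eq y ht.le] at h
  rw [h]
  refine lintegral_congr fun x => ?_
  rw [mul_one, ballIndicator, ballIndicator, norm_sub_rev]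

theorem measurable_ballIndicator_left (t : ℝ) (y : EuclideanSpace ℝ (Fin n)) :
    Measurable fun x => ballIndicator t x y :=
  Measurable.ite (isClosed_le (by fun_prop) (by fun_prop)).measurableSet measurable_const
    measurable_const

theorem measurable_ballIndicator_pair (t : ℝ) :
    Measurable fun q : EuclideanSpace ℝ (Fin n) × EuclideanSpace ℝ (Fin n) =>
      ballIndicator t q.1 q.2 :=
  Measurable.ite (isClosed_le (by fun_prop) (by fun_prop)).measurableSet measurable_const
    measurable_const

theorem lintegral_ballAverage {f : EuclideanSpace ℝ (Fin n) → ℝ≥0∞} (hf : Measurable f) {t : ℝ}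
    (ht : 0 < t) : ∫⁻ x, ballAverage f x t = ballVolume n * ∫⁻ y, f y := by
  have hm : Measurable (Function.uncurry fun x y : EuclideanSpace ℝ (Fin n) =>
      ballIndicator t x y * f y) :=
    (measurable_ballIndicator_pair t).mul (hf.comp measurable_snd)
  simp only [ballAverage, setLIntegral_closedBall_eq]
  rw [lintegral_const_mul' _ _ ENNReal.ofReal_ne_top, lintegral_lintegral_swap hm.aemeasurable]
  simp only [lintegral_mul_const _ (measurable_ballIndicator_left t _),
    lintegral_ballIndicator _ ht]
  rw [lintegral_const_mul _ hf, ← mul_assoc, ← mul_assoc, ← ENNReal.ofReal_mul (by positivity),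
    inv_mul_cancel₀ (pow_pos ht n).ne', ENNReal.ofReal_one, one_mul]

/-- Averaging is bounded on `L^p` uniformly in the scale: after Jensen's inequality, each `y` is
counted on a ball of radius `t`. -/
theorem lintegral_ballAverage_rpow_le {p : ℝ} (hp : 1 < p)
    {f : EuclideanSpace ℝ (Fin n) → ℝ≥0∞} (hf : Measurable f) {t : ℝ} (ht : 0 < t) :
    ∫⁻ x, ballAverage f x t ^ p ≤ ballVolume n ^ p * ∫⁻ y, f y ^ p := by
  calc _ ≤ ∫⁻ x, ballVolume n ^ (p - 1) * ballAverage (fun y => f y ^ p) x t :=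
        lintegral_mono fun x => ballAverage_rpow_le hp hf x ht
    _ = ballVolume n ^ (p - 1) * (ballVolume n * ∫⁻ y, f y ^ p) := by
        rw [lintegral_const_mul' _ _ (ENNReal.rpow_ne_top_of_nonneg (by linarith)
          (ballVolume_ne_top n)), lintegral_ballAverage (hf.pow_const p) ht]
    _ = _ := by
        have h0 : ballVolume n ≠ 0 := (Metric.measure_ball_pos volume _ one_pos).ne'
        rw [← mul_assoc]
        congr 1
        nth_rw 2 [← ENNReal.rpow_one (ballVolume n)]
        rw [← ENNReal.rpow_add _ _ h0 (ballVolume_ne_top n), sub_add_cancel]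

theorem measurable_ballAverage {f : EuclideanSpace ℝ (Fin n) × EuclideanSpace ℝ (Fin n) → ℝ≥0∞}
    (hf : Measurable f) (t : ℝ) : Measurable fun x => ballAverage (fun y => f (x, y)) x t := by
  simp only [ballAverage, setLIntegral_closedBall_eq]
  refine Measurable.const_mul ?_ _
  exact ((measurable_ballIndicator_pair t).mul hf).lintegral_prod_right'

variable {F : Type*} [NormedAddCommGroup F] [InnerProductSpace ℝ F] [FiniteDimensional ℝ F]
  {Γ : EuclideanSpace ℝ (Fin (n + 1)) → EuclideanSpace ℝ (Fin (n + 1)) →L[ℝ] F →L[ℝ] F}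

/-- Fractional energy as an integral of averaged differences over all scales. -/
theorem IsSkewForm.lintegral_ballAverage_osc_le (hΓ : IsSkewForm Γ) {p : ℝ} (hp : 1 < p)
    {u : EuclideanSpace ℝ (Fin n) → F} (hu : Continuous u) :
    ∫⁻ t in Ioi (0 : ℝ), ∫⁻ x, (ENNReal.ofReal t⁻¹ * ballAverage (osc Γ u x) x t) ^ p ≤
      ballVolume n ^ (p - 1) * ENNReal.ofReal (n + p - 1)⁻¹ * gagEnergy p Γ u := by
  have hp0 : 0 < p := by linarith
  have hn0 : (0 : ℝ) ≤ n := Nat.cast_nonneg n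
  have hosc := hΓ.measurable_osc hu
  have hoscx : ∀ x, Measurable (osc Γ u x) := fun x =>
    hosc.comp (measurable_prodMk_left (x := x))
  set k : ℝ → EuclideanSpace ℝ (Fin n) → EuclideanSpace ℝ (Fin n) → ℝ≥0∞ := fun t x y =>
    ENNReal.ofReal (t ^ (-p - n)) *
      (ballIndicator t x y * osc Γ u x y ^ p) with hk
  have hkm : Measurable fun q : ℝ × EuclideanSpace ℝ (Fin n) × EuclideanSpace ℝ (Fin n) =>
      k q.1 q.2.1 q.2.2 :=
    Measurable.mul (by fun_prop) (measurable_ballIndicator.mul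
      ((hosc.comp measurable_snd).pow_const p))
  have hpt : ∀ t ∈ Ioi (0 : ℝ), ∀ x, (ENNReal.ofReal t⁻¹ * ballAverage (osc Γ u x) x t) ^ p ≤
      ballVolume n ^ (p - 1) * ∫⁻ y, k t x y := by
    intro t ht x
    rw [mem_Ioi] at ht
    rw [ENNReal.mul_rpow_of_nonneg _ _ hp0.le]
    calc _ ≤ ENNReal.ofReal t⁻¹ ^ p * (ballVolume n ^ (p - 1) *
          ballAverage (fun y => osc Γ u x y ^ p) x t) := by
          gcongr
          exact ballAverage_rpow_le hp (hoscx x) x ht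
      _ = _ := by
          rw [ballAverage, setLIntegral_closedBall_eq, mul_left_comm]
          congr 1
          simp only [hk]
          rw [lintegral_const_mul' _ _ ENNReal.ofReal_ne_top, ← mul_assoc]
          congr 1
          rw [ENNReal.ofReal_rpow_of_nonneg (by positivity) hp0.le,
            ← ENNReal.ofReal_mul (by positivity), Real.inv_rpow ht.le, ← Real.rpow_neg ht.le,
            ← Real.rpow_natCast, ← Real.rpow_neg ht.le, ← Real.rpow_add ht, sub_eq_add_neg]
  have hω : ballVolume n ^ (p - 1) ≠ ⊤ :=
    ENNReal.rpow_ne_top_of_nonneg (by linarith) (ballVolume_ne_top n)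
  calc _ ≤ ∫⁻ t in Ioi (0 : ℝ), ∫⁻ x, ballVolume n ^ (p - 1) * ∫⁻ y, k t x y :=
        setLIntegral_mono' measurableSet_Ioi fun t ht => lintegral_mono fun x => hpt t ht x
    _ = ballVolume n ^ (p - 1) * ∫⁻ t in Ioi (0 : ℝ), ∫⁻ x, ∫⁻ y, k t x y := by
        simp only [lintegral_const_mul' _ _ hω]
    _ = ballVolume n ^ (p - 1) * ∫⁻ x, ∫⁻ y, ∫⁻ t in Ioi (0 : ℝ), k t x y := by
        congr 1
        rw [lintegral_lintegral_swap]
        · refine lintegral_congr fun x => lintegral_lintegral_swap ?_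
          exact (hkm.comp (by fun_prop : Measurable
            fun q : ℝ × EuclideanSpace ℝ (Fin n) => (q.1, x, q.2))).aemeasurable
        · have : Measurable fun q : (ℝ × EuclideanSpace ℝ (Fin n)) × EuclideanSpace ℝ (Fin n) =>
              k q.1.1 q.1.2 q.2 := hkm.comp (by fun_prop : Measurable fun q : (ℝ ×
              EuclideanSpace ℝ (Fin n)) × EuclideanSpace ℝ (Fin n) => (q.1.1, q.1.2, q.2))
          exact this.lintegral_prod_right'.aemeasurable
    _ ≤ ballVolume n ^ (p - 1) * ∫⁻ x, ∫⁻ y, ENNReal.ofReal (n + p - 1)⁻¹ *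
          (osc Γ u x y ^ p / ‖x - y‖ₑ ^ ((n : ℝ) + p - 1)) := by
        gcongr with x y
        by_cases hxy : x = y
        · subst hxy
          simp [hk, hΓ.osc_self, ENNReal.zero_rpow_of_pos hp0]
        have hr : 0 < ‖x - y‖ := norm_pos_iff.2 (sub_ne_zero.2 hxy)
        -- For fixed `x` and `y` only the scales `t ≥ ‖x - y‖` contribute. Integrating `t ^ (-p -
        -- n)` over them reproduces the Gagliardo kernel, with factor `1 / (n + p - 1)`.
        have e : ∀ t, k t x y = (Ici ‖x - y‖).indicator (fun t => ENNReal.ofReal (t ^ (-p - n))) t *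
            osc Γ u x y ^ p := fun t => by
          by_cases ht : t ∈ Ici ‖x - y‖
          · simp only [hk, ballIndicator]
            rw [indicator_of_mem ht, if_pos (mem_Ici.1 ht), one_mul]
          · simp only [hk, ballIndicator]
            rw [indicator_of_notMem ht, if_neg (by exact ht), zero_mul, mul_zero]
        simp only [e]
        rw [lintegral_mul_const _ (by
          exact Measurable.indicator (by fun_prop) measurableSet_Ici)]
        rw [lintegral_indicator measurableSet_Ici, Measure.restrict_restrict measurableSet_Ici,
          inter_eq_left.2 (show Ici ‖x - y‖ ⊆ Ioi 0 from fun t ht => hr.trans_le ht), setLIntegral_congr Ioi_ae_eq_Ici.symm,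
          lintegral_Ioi_rpow (by linarith) hr]
        refine le_of_eq ?_
        rw [div_eq_mul_inv (osc Γ u x y ^ p), ← ofReal_norm, ENNReal.ofReal_rpow_of_pos hr,
          ← ENNReal.ofReal_inv_of_pos (Real.rpow_pos_of_pos hr _), ← Real.rpow_neg hr.le,
          mul_comm (osc Γ u x y ^ p), ← mul_assoc, ← ENNReal.ofReal_mul (by
            refine inv_nonneg.2 ?_
            linarith)]
        congr 2
        rw [div_eq_mul_inv, mul_comm]
        congr 2 <;> ring
    _ = _ := by
        simp only [lintegral_const_mul' _ _ ENNReal.ofReal_ne_top]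
        rw [← mul_assoc]
        rfl

end BallAverages

/-! ### The vertical cutoff -/

section Cutoff

/-- A smooth function equal to `1` on `(-∞, 1]` and to `0` on `[2, ∞)`. -/
def cutoff (s : ℝ) : ℝ := Real.smoothTransition (2 - s)

theorem contDiff_cutoff : ContDiff ℝ 1 cutoff :=
  Real.smoothTransition.contDiff.comp (contDiff_const.sub contDiff_id)

theorem cutoff_eq_one {s : ℝ} (hs : s ≤ 1) : cutoff s = 1 :=
  Real.smoothTransition.one_of_one_le (by linarith)

theorem cutoff_eq_zero {s : ℝ} (hs : 2 ≤ s) : cutoff s = 0 :=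
  Real.smoothTransition.zero_of_nonpos (by linarith)

theorem cutoff_nonneg (s : ℝ) : 0 ≤ cutoff s := Real.smoothTransition.nonneg _

theorem cutoff_le_one (s : ℝ) : cutoff s ≤ 1 := Real.smoothTransition.le_one _

theorem deriv_cutoff_eq_zero_of_lt {s : ℝ} (hs : s < 1) : deriv cutoff s = 0 := by
  have : cutoff =ᶠ[nhds s] fun _ => 1 := by
    filter_upwards [Iio_mem_nhds hs] with r hr using cutoff_eq_one (le_of_lt hr)
  rw [this.deriv_eq, deriv_const]

theorem deriv_cutoff_eq_zero_of_gt {s : ℝ} (hs : 2 < s) : deriv cutoff s = 0 := by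
  have : cutoff =ᶠ[nhds s] fun _ => 0 := by
    filter_upwards [Ioi_mem_nhds hs] with r hr using cutoff_eq_zero (le_of_lt hr)
  rw [this.deriv_eq, deriv_const]

theorem exists_abs_deriv_cutoff_le : ∃ M : ℝ, 0 ≤ M ∧ ∀ s, |deriv cutoff s| ≤ M := by
  obtain ⟨M, hM⟩ := (isCompact_Icc (a := (1 : ℝ)) (b := 2)).exists_bound_of_continuousOn
    (contDiff_cutoff.continuous_deriv le_rfl).continuousOn
  have hM0 : 0 ≤ M := (norm_nonneg _).trans (hM 1 ⟨le_rfl, by norm_num⟩)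
  refine ⟨M, hM0, fun s => ?_⟩
  by_cases h1 : s < 1
  · rwa [deriv_cutoff_eq_zero_of_lt h1, abs_zero]
  by_cases h2 : 2 < s
  · rwa [deriv_cutoff_eq_zero_of_gt h2, abs_zero]
  exact hM s ⟨not_lt.1 h1, not_lt.1 h2⟩

/-- A bound for the derivative of the cutoff function. -/
def cutoffConst : ℝ := exists_abs_deriv_cutoff_le.choose

theorem cutoffConst_nonneg : 0 ≤ cutoffConst := exists_abs_deriv_cutoff_le.choose_spec.1

theorem abs_deriv_cutoff_le (s : ℝ) : |deriv cutoff s| ≤ cutoffConst :=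
  exists_abs_deriv_cutoff_le.choose_spec.2 s

theorem deriv_cutoff_mul (a t : ℝ) : deriv (fun t => cutoff (a * t)) t = a * deriv cutoff (a * t) := by
  have h1 := (contDiff_cutoff.differentiable one_ne_zero (a * t)).hasDerivAt
  have h2 : HasDerivAt (fun t => a * t) a t := by simpa using (hasDerivAt_id t).const_mul a
  have h3 : HasDerivAt (fun t => cutoff (a * t)) (deriv cutoff (a * t) * a) t := h1.comp t h2
  rw [h3.deriv, mul_comm]

end Cutoff

/-! ### Pointwise and energy bounds for the cut off extension -/

section CutExtension

variable {n : ℕ} {F : Type*} [NormedAddCommGroup F] [InnerProductSpace ℝ F]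
  {Γ : EuclideanSpace ℝ (Fin (n + 1)) → EuclideanSpace ℝ (Fin (n + 1)) →L[ℝ] F →L[ℝ] F}

theorem enorm_hilbertSchmidtNorm_le {T : EuclideanSpace ℝ (Fin (n + 1)) →L[ℝ] F} {c : ℝ≥0∞}
    (h : ∀ v, ‖T v‖ₑ ≤ c * ‖v‖ₑ) : ‖hilbertSchmidtNorm T‖ₑ ≤ (n + 1) * c := by
  by_cases hc : c = ⊤
  · rw [hc, ENNReal.mul_top (by positivity)]
    exact le_top
  lift c to ℝ≥0 using hc
  have h1 : hilbertSchmidtNorm T ≤ (n + 1 : ℕ) * (c : ℝ) := by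
    refine hilbertSchmidtNorm_le c.2 fun v => ?_
    have := h v
    rw [enorm_eq_nnnorm, enorm_eq_nnnorm] at this
    exact_mod_cast this
  rw [Real.enorm_of_nonneg (show 0 ≤ hilbertSchmidtNorm T from Real.sqrt_nonneg _)]
  refine (ENNReal.ofReal_le_ofReal h1).trans (le_of_eq ?_)
  rw [ENNReal.ofReal_mul (by positivity), ENNReal.ofReal_natCast, ENNReal.ofReal_coe_nnreal]
  push_cast
  rfl

variable [FiniteDimensional ℝ F]

/-- The constant in the pointwise bounds of the extension. -/
def extConst (n : ℕ) : ℝ≥0∞ := (n + 1) * ENNReal.ofReal (kernConst n)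

theorem extConst_ne_top (n : ℕ) : extConst n ≠ ⊤ := by
  unfold extConst
  finiteness

/-- Leibniz' rule for the vertical factor. The vector `S₀` is left free: zero gives a crude bound by
the size of `u`, and the transport of `u x` gives a bound by covariant differences. -/
theorem HalfSpaceForm.enorm_covNorm_smul_le {β : ℝ} (hΓ : HalfSpaceForm Γ β)
    {u : EuclideanSpace ℝ (Fin n) → F} (hu : ContDiff ℝ 1 u) {η : ℝ → ℝ} (hη : ContDiff ℝ 1 η)
    (x : EuclideanSpace ℝ (Fin n)) {t : ℝ} (ht : 0 < t) (S₀ : F) :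
    ‖covNorm Γ (fun z => η (height n z) • smoothExt Γ u z) (pt x t)‖ₑ ≤ extConst n *
      (‖η t‖ₑ * ballAverage (fun y => ENNReal.ofReal t⁻¹ *
          ‖transport Γ (boundaryIncl n y, pt x t) (u y) - S₀‖ₑ +
        ENNReal.ofReal (2 * β * t) * ‖u y‖ₑ) x t +
      ‖deriv η t‖ₑ * ballAverage (fun y => ‖u y‖ₑ) x t) := by
  rw [extConst, mul_assoc]
  refine enorm_hilbertSchmidtNorm_le fun v => ?_
  set z := pt x t with hz
  have hzt : height n z = t := height_pt x t
  have hzx : horizontal n z = x := horizontal_pt x t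
  have hzp : 0 < height n z := by rwa [hzt]
  have d1 : HasFDerivAt (fun z => η (height n z)) (deriv η t • height n) z := by
    have := (hη.differentiable one_ne_zero (height n z)).hasDerivAt.comp_hasFDerivAt z
      (height n).hasFDerivAt
    rwa [hzt] at this
  have d2 := ((hΓ.contDiff_smoothExt hu).differentiable one_ne_zero z).hasFDerivAt
  have d3 := (d1.smul d2).fderiv
  change fderiv ℝ (fun z => η (height n z) • smoothExt Γ u z) z = _ at d3
  have e : (fderiv ℝ (fun z => η (height n z) • smoothExt Γ u z) z +
      (Γ z).flip (η (height n z) • smoothExt Γ u z)) v =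
      η t • (fderiv ℝ (smoothExt Γ u) z v + Γ z v (smoothExt Γ u z)) +
      (deriv η t * height n v) • smoothExt Γ u z := by
    rw [d3]
    simp only [add_apply, smul_apply, ContinuousLinearMap.smulRight_apply,
      ContinuousLinearMap.flip_apply, map_smul, hzt, smul_eq_mul, smul_add]
    abel
  rw [e]
  have h1 := hΓ.enorm_covDeriv_smoothExt_le hu hzp S₀ v
  have h2 := hΓ.enorm_smoothExt_le u hzp
  rw [hzt, hzx] at h1 h2
  have h3 : ‖deriv η t * height n v‖ₑ ≤ ‖deriv η t‖ₑ * ‖v‖ₑ := by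
    rw [enorm_mul]
    gcongr
    exact enorm_le_iff_norm_le.2 (abs_height_le v)
  refine (enorm_add_le _ _).trans ?_
  rw [enorm_smul, enorm_smul]
  refine (add_le_add (mul_le_mul' le_rfl h1) (mul_le_mul' h3 h2)).trans (le_of_eq ?_)
  ring

theorem HalfSpaceForm.enorm_covNorm_smul_le_crude {β : ℝ} (hΓ : HalfSpaceForm Γ β)
    {u : EuclideanSpace ℝ (Fin n) → F} (hu : ContDiff ℝ 1 u) {η : ℝ → ℝ} (hη : ContDiff ℝ 1 η)
    (x : EuclideanSpace ℝ (Fin n)) {t : ℝ} (ht : 0 < t) :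
    ‖covNorm Γ (fun z => η (height n z) • smoothExt Γ u z) (pt x t)‖ₑ ≤ extConst n *
      ((‖η t‖ₑ * ENNReal.ofReal (t⁻¹ + 2 * β * t) + ‖deriv η t‖ₑ) *
        ballAverage (fun y => ‖u y‖ₑ) x t) := by
  have hβ := hΓ.nonneg
  refine (hΓ.enorm_covNorm_smul_le hu hη x ht 0).trans (le_of_eq ?_)
  simp only [sub_zero, enorm_eq_iff_norm_eq.2 (hΓ.norm_transport_apply _ _), ← add_mul]
  rw [← ENNReal.ofReal_add (by positivity) (by positivity),
    ballAverage_const_mul ENNReal.ofReal_ne_top, add_mul, mul_assoc ‖η t‖ₑ]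

/-- With `S₀` the transport of `u x` to the interior point, the transport from `y` is replaced by
the detour through `(x, 0)`. The triangle costs `2 * β * t ^ 2`; divided by `t` and added to the
curvature term `2 * β * t`, it gives `4 * β * t`. -/
theorem HalfSpaceForm.enorm_covNorm_smul_le_osc {β : ℝ} (hΓ : HalfSpaceForm Γ β)
    {u : EuclideanSpace ℝ (Fin n) → F} (hu : ContDiff ℝ 1 u) {η : ℝ → ℝ} (hη : ContDiff ℝ 1 η)
    (x : EuclideanSpace ℝ (Fin n)) {t : ℝ} (ht : 0 < t) :
    ‖covNorm Γ (fun z => η (height n z) • smoothExt Γ u z) (pt x t)‖ₑ ≤ extConst n *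
      (‖η t‖ₑ * (ENNReal.ofReal t⁻¹ * ballAverage (osc Γ u x) x t) +
        (‖η t‖ₑ * ENNReal.ofReal (4 * β * t) + ‖deriv η t‖ₑ) *
          ballAverage (fun y => ‖u y‖ₑ) x t) := by
  have hβ := hΓ.nonneg
  have hosc : Measurable (osc Γ u x) :=
    (hΓ.measurable_osc hu.continuous).comp (measurable_prodMk_left (x := x))
  refine (hΓ.enorm_covNorm_smul_le hu hη x ht
    (transport Γ (boundaryIncl n x, pt x t) (u x))).trans ?_
  rw [add_mul, ← add_assoc, mul_assoc ‖η t‖ₑ, ← mul_add]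
  gcongr
  rw [← ballAverage_const_mul ENNReal.ofReal_ne_top, ← ballAverage_const_mul ENNReal.ofReal_ne_top,
    ← ballAverage_add (hosc.const_mul _)]
  refine ballAverage_mono fun y hy => ?_
  rw [Metric.mem_closedBall, dist_eq_norm, norm_sub_rev] at hy
  set z := pt x t
  have h1 : ‖transport Γ (boundaryIncl n y, z) (u y) - transport Γ (boundaryIncl n x, z)
      (transport Γ (boundaryIncl n y, boundaryIncl n x) (u y))‖ₑ ≤
      ENNReal.ofReal (2 * β * t ^ 2) * ‖u y‖ₑ := by
    rw [← ofReal_norm, ← ofReal_norm, ← ENNReal.ofReal_mul (by positivity)]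
    refine ENNReal.ofReal_le_ofReal ?_
    have hzx : ‖z - boundaryIncl n x‖ = t := by
      have : z - boundaryIncl n x = t • vertical n := by simp [z, pt]
      rw [this, norm_smul, norm_vertical, mul_one, Real.norm_of_nonneg ht.le]
    have hzy : ‖z - boundaryIncl n y‖ ≤ 2 * t := by
      rw [← pt_zero, pt_sub_pt, sub_zero]
      refine (norm_pt_le _ _).trans ?_
      rw [abs_of_pos ht]
      linarith
    have hxy : ‖boundaryIncl n x - boundaryIncl n y‖ ≤ 2 * t := by
      rw [← map_sub, norm_boundaryIncl]
      linarith
    refine (hΓ.norm_transport_sub_comp_le convex_closedHalfSpace hβ hΓ.curvature_le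
      (boundaryIncl_mem y) (boundaryIncl_mem x) (pt_mem ht.le) hxy hzy (u y)).trans (le_of_eq ?_)
    rw [hzx]
    ring
  have h2 : ‖transport Γ (boundaryIncl n y, z) (u y) -
      transport Γ (boundaryIncl n x, z) (u x)‖ₑ ≤
      osc Γ u x y + ENNReal.ofReal (2 * β * t ^ 2) * ‖u y‖ₑ := by
    have e : osc Γ u x y = ‖transport Γ (boundaryIncl n x, z)
        (transport Γ (boundaryIncl n y, boundaryIncl n x) (u y)) -
        transport Γ (boundaryIncl n x, z) (u x)‖ₑ := by
      rw [← map_sub, enorm_eq_iff_norm_eq.2 (hΓ.norm_transport_apply _ _), osc,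
        enorm_eq_iff_norm_eq.2 (norm_sub_rev _ _)]
    rw [e, add_comm ‖_‖ₑ]
    refine le_trans (le_of_eq ?_) ((enorm_add_le _ _).trans (add_le_add h1 le_rfl))
    rw [sub_add_sub_cancel]
  calc _ ≤ ENNReal.ofReal t⁻¹ * (osc Γ u x y + ENNReal.ofReal (2 * β * t ^ 2) * ‖u y‖ₑ) +
        ENNReal.ofReal (2 * β * t) * ‖u y‖ₑ := by gcongr
    _ = _ := by
        rw [mul_add, add_assoc, ← mul_assoc, ← ENNReal.ofReal_mul (by positivity), ← add_mul,
          ← ENNReal.ofReal_add (by positivity) (by positivity)]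
        congr 3
        field_simp
        ring

/-- Energy bound from a pointwise bound by averages. -/
theorem halfEnergy_le_of_ballAverage {G : Type*} [NormedAddCommGroup G] {p : ℝ} (hp : 1 < p)
    {W : EuclideanSpace ℝ (Fin (n + 1)) → G} (hW : Continuous W)
    {u : EuclideanSpace ℝ (Fin n) → F} (hu : Continuous u) {w : ℝ → ℝ≥0∞} (hw : Measurable w)
    (h : ∀ t, 0 < t → ∀ x, ‖W (pt x t)‖ₑ ≤ w t * ballAverage (fun y => ‖u y‖ₑ) x t) :
    halfEnergy p W ≤ (∫⁻ t in Ioi (0 : ℝ), w t ^ p) * (ballVolume n ^ p * lpEnergy p u) := by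
  have hp0 : 0 < p := by linarith
  rw [halfEnergy, lintegral_openHalfSpace (hW.enorm.measurable.pow_const p),
    ← lintegral_mul_const _ (hw.pow_const p)]
  refine setLIntegral_mono' measurableSet_Ioi fun t ht => ?_
  have hm : Measurable fun x => ballAverage (fun y => ‖u y‖ₑ) x t :=
    measurable_ballAverage (f := fun q => ‖u q.2‖ₑ) (hu.enorm.measurable.comp measurable_snd) t
  calc _ ≤ ∫⁻ x, w t ^ p * ballAverage (fun y => ‖u y‖ₑ) x t ^ p := by
        refine lintegral_mono fun x => ?_
        rw [← ENNReal.mul_rpow_of_nonneg _ _ hp0.le]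
        exact ENNReal.rpow_le_rpow (h t ht x) hp0.le
    _ = w t ^ p * ∫⁻ x, ballAverage (fun y => ‖u y‖ₑ) x t ^ p :=
        lintegral_const_mul _ (hm.pow_const p)
    _ ≤ _ := by
        gcongr
        exact lintegral_ballAverage_rpow_le hp hu.enorm.measurable ht

theorem IsSkewForm.halfEnergy_le_of_ballAverage_osc (hΓ : IsSkewForm Γ) {G : Type*}
    [NormedAddCommGroup G] {p : ℝ} (hp : 1 < p)
    {W : EuclideanSpace ℝ (Fin (n + 1)) → G} (hW : Continuous W)
    {u : EuclideanSpace ℝ (Fin n) → F} (hu : Continuous u) {w : ℝ → ℝ≥0∞} (hw : Measurable w)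
    {c : ℝ≥0∞} (hc : c ≠ ⊤)
    (h : ∀ t, 0 < t → ∀ x, ‖W (pt x t)‖ₑ ≤ c * (ENNReal.ofReal t⁻¹ * ballAverage (osc Γ u x) x t +
      w t * ballAverage (fun y => ‖u y‖ₑ) x t)) :
    halfEnergy p W ≤ c ^ p * (2 ^ p *
      (ballVolume n ^ (p - 1) * ENNReal.ofReal (n + p - 1)⁻¹ * gagEnergy p Γ u +
        (∫⁻ t in Ioi (0 : ℝ), w t ^ p) * (ballVolume n ^ p * lpEnergy p u))) := by
  have hp0 : 0 < p := by linarith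
  have hcp : c ^ p ≠ ⊤ := ENNReal.rpow_ne_top_of_nonneg hp0.le hc
  have h2p : (2 : ℝ≥0∞) ^ p ≠ ⊤ := by finiteness
  rw [halfEnergy, lintegral_openHalfSpace (hW.enorm.measurable.pow_const p)]
  have key : ∀ t ∈ Ioi (0 : ℝ), ∫⁻ x, ‖W (pt x t)‖ₑ ^ p ≤ c ^ p * (2 ^ p *
      ((∫⁻ x, (ENNReal.ofReal t⁻¹ * ballAverage (osc Γ u x) x t) ^ p) +
        w t ^ p * (ballVolume n ^ p * lpEnergy p u))) := by
    intro t ht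
    have hm : Measurable fun x => ballAverage (fun y => ‖u y‖ₑ) x t :=
      measurable_ballAverage (f := fun q => ‖u q.2‖ₑ) (hu.enorm.measurable.comp measurable_snd) t
    have hm' : Measurable fun x => ballAverage (osc Γ u x) x t :=
      measurable_ballAverage (f := fun q => osc Γ u q.1 q.2) (hΓ.measurable_osc hu) t
    calc _ ≤ ∫⁻ x, c ^ p * (2 ^ p * ((ENNReal.ofReal t⁻¹ * ballAverage (osc Γ u x) x t) ^ p +
          (w t * ballAverage (fun y => ‖u y‖ₑ) x t) ^ p)) := by
          refine lintegral_mono fun x => (ENNReal.rpow_le_rpow (h t ht x) hp0.le).trans ?_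
          rw [ENNReal.mul_rpow_of_nonneg _ _ hp0.le]
          gcongr
          exact rpow_add_le_two_rpow_mul _ _ hp0
      _ = c ^ p * (2 ^ p * ((∫⁻ x, (ENNReal.ofReal t⁻¹ * ballAverage (osc Γ u x) x t) ^ p) +
          ∫⁻ x, (w t * ballAverage (fun y => ‖u y‖ₑ) x t) ^ p)) := by
          rw [lintegral_const_mul' _ _ hcp, lintegral_const_mul' _ _ h2p,
            lintegral_add_left ((hm'.const_mul _).pow_const p)]
      _ ≤ _ := by
          gcongr
          simp only [ENNReal.mul_rpow_of_nonneg _ _ hp0.le]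
          rw [lintegral_const_mul _ (hm.pow_const p)]
          gcongr
          exact lintegral_ballAverage_rpow_le hp hu.enorm.measurable ht
  refine (setLIntegral_mono' measurableSet_Ioi key).trans ?_
  rw [lintegral_const_mul' _ _ hcp, lintegral_const_mul' _ _ h2p,
    lintegral_add_right _ ((hw.pow_const p).mul_const _), lintegral_mul_const _ (hw.pow_const p)]
  gcongr
  exact hΓ.lintegral_ballAverage_osc_le hp hu

end CutExtension

/-! ### Energy estimates for the extension -/

section ExtensionEstimates

theorem abs_cutoff_le_one (s : ℝ) : |cutoff s| ≤ 1 := by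
  rw [abs_of_nonneg (cutoff_nonneg s)]
  exact cutoff_le_one s

theorem contDiff_cutoff_mul (r : ℝ) : ContDiff ℝ 1 fun t => cutoff (r * t) :=
  contDiff_cutoff.comp (contDiff_const.mul contDiff_id)

/-- The derivative of the cutoff vanishes unless `r * t ≤ 2`, so the factor `r` may be traded for `2
/ t`, uniformly in `r`. -/
theorem mul_abs_deriv_cutoff_le {r t : ℝ} (ht : 0 < t) :
    r * |deriv cutoff (r * t)| ≤ 2 * cutoffConst * t⁻¹ := by
  have hM := cutoffConst_nonneg
  by_cases h : 2 < r * t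
  · rw [deriv_cutoff_eq_zero_of_gt h, abs_zero, mul_zero]
    positivity
  · have h1 : r ≤ 2 * t⁻¹ := by
      rw [← div_eq_mul_inv, le_div_iff₀ ht]
      exact not_lt.1 h
    calc _ ≤ (2 * t⁻¹) * cutoffConst := by
          gcongr
          exact abs_deriv_cutoff_le _
      _ = _ := by ring

theorem lintegral_indicator_Iic_rpow {p : ℝ} (hp : 0 < p) {a : ℝ} (c : ℝ≥0∞) :
    ∫⁻ t in Ioi (0 : ℝ), (Iic a).indicator (fun _ => c) t ^ p = c ^ p * ENNReal.ofReal a := by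
  have : ∀ t, (Iic a).indicator (fun _ => c) t ^ p = (Iic a).indicator (fun _ => c ^ p) t := by
    intro t
    by_cases h : t ∈ Iic a
    · rw [indicator_of_mem h, indicator_of_mem h]
    · rw [indicator_of_notMem h, indicator_of_notMem h, ENNReal.zero_rpow_of_pos hp]
  simp only [this]
  rw [lintegral_indicator measurableSet_Iic, setLIntegral_const,
    Measure.restrict_apply measurableSet_Iic, Iic_inter_Ioi, Real.volume_Ioc, sub_zero]

theorem lintegral_indicator_Ici_rpow {p : ℝ} (hp : 1 < p) {r c : ℝ} (hr : 0 < r) (hc : 0 ≤ c) :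
    ∫⁻ t in Ioi (0 : ℝ), (Ici r⁻¹).indicator (fun t => ENNReal.ofReal (c * t⁻¹)) t ^ p =
      ENNReal.ofReal (c ^ p / (p - 1)) * ENNReal.ofReal (r ^ (p - 1)) := by
  have hp0 : 0 < p := by linarith
  have hr' : 0 < r⁻¹ := inv_pos.2 hr
  have : ∀ t, (Ici r⁻¹).indicator (fun t => ENNReal.ofReal (c * t⁻¹)) t ^ p =
      (Ici r⁻¹).indicator (fun t => ENNReal.ofReal (c ^ p) * ENNReal.ofReal (t ^ (-p))) t := by
    intro t
    by_cases h : t ∈ Ici r⁻¹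
    · have ht : 0 < t := hr'.trans_le h
      rw [indicator_of_mem h, indicator_of_mem h, ENNReal.ofReal_rpow_of_nonneg (by positivity)
        hp0.le, Real.mul_rpow hc (by positivity), Real.inv_rpow ht.le, ← Real.rpow_neg ht.le,
        ENNReal.ofReal_mul (by positivity)]
    · rw [indicator_of_notMem h, indicator_of_notMem h, ENNReal.zero_rpow_of_pos hp0]
  simp only [this]
  rw [lintegral_indicator measurableSet_Ici, Measure.restrict_restrict measurableSet_Ici,
    inter_eq_left.2 (show Ici r⁻¹ ⊆ Ioi 0 from fun t ht => hr'.trans_le ht),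
    setLIntegral_congr Ioi_ae_eq_Ici.symm, lintegral_const_mul' _ _ ENNReal.ofReal_ne_top,
    lintegral_Ioi_rpow (by linarith) hr', ← ENNReal.ofReal_mul (by positivity),
    ← ENNReal.ofReal_mul (by have : 0 < p - 1 := by linarith
                             positivity), Real.inv_rpow hr.le, ← Real.rpow_neg hr.le]
  congr 1
  rw [show -(-p + 1) = p - 1 by ring, show - -p - 1 = p - 1 by ring]
  ring

variable {n : ℕ} {F : Type*} [NormedAddCommGroup F] [InnerProductSpace ℝ F]

/-- The extension from the boundary, cut off at height `2 / r`. -/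
def cutExt (r : ℝ) (Γ : EuclideanSpace ℝ (Fin (n + 1)) → EuclideanSpace ℝ (Fin (n + 1)) →L[ℝ] F →L[ℝ] F)
    (u : EuclideanSpace ℝ (Fin n) → F) (z : EuclideanSpace ℝ (Fin (n + 1))) : F :=
  cutoff (r * height n z) • smoothExt Γ u z

variable [FiniteDimensional ℝ F]
  {Γ : EuclideanSpace ℝ (Fin (n + 1)) → EuclideanSpace ℝ (Fin (n + 1)) →L[ℝ] F →L[ℝ] F}

theorem IsSkewForm.contDiff_cutExt (hΓ : IsSkewForm Γ) {u : EuclideanSpace ℝ (Fin n) → F}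
    (hu : ContDiff ℝ 1 u) (r : ℝ) : ContDiff ℝ 1 (cutExt r Γ u) :=
  ((contDiff_cutoff_mul r).comp (height n).contDiff).smul (hΓ.contDiff_smoothExt hu)

theorem IsSkewForm.cutExt_boundaryIncl (hΓ : IsSkewForm Γ) (u : EuclideanSpace ℝ (Fin n) → F)
    (r : ℝ) (x : EuclideanSpace ℝ (Fin n)) : cutExt r Γ u (boundaryIncl n x) = u x := by
  rw [cutExt, height_boundaryIncl, mul_zero, cutoff_eq_one zero_le_one, one_smul,
    hΓ.smoothExt_boundaryIncl]

theorem IsSkewForm.cutExt_mem (hΓ : IsSkewForm Γ) {u : EuclideanSpace ℝ (Fin n) → F}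
    (hu : u ∈ C1c n F) {r : ℝ} (hr : 0 < r) : cutExt r Γ u ∈ C1cHalfSpace n F := by
  obtain ⟨R, hR⟩ := hu.2.isBounded.subset_closedBall 0
  -- Where the cutoff survives the height is below `2 / r`, and mollification spreads the support
  -- horizontally by at most the height; the two contributions give `4 / r`.
  refine ⟨(hΓ.contDiff_cutExt hu.1 r).contDiffOn, closedHalfSpace n ∩
    Metric.closedBall 0 (R + 4 / r), inter_subset_left,
    (isCompact_closedBall _ _).inter_left isClosed_closedHalfSpace, fun z hz hzK => ?_⟩
  have ht : 0 ≤ height n z := mem_closedHalfSpace.1 hz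
  by_cases h : 2 ≤ r * height n z
  · rw [cutExt, cutoff_eq_zero h, zero_smul]
  have ht2 : height n z < 2 / r := by
    rw [lt_div_iff₀ hr, mul_comm]
    exact not_le.1 h
  have hzn : R + 4 / r < ‖z‖ := by
    by_contra hc
    exact hzK ⟨hz, by simpa using hc⟩
  have hz' : ‖z‖ ≤ ‖horizontal n z‖ + height n z := by
    conv_lhs => rw [← pt_horizontal_height z]
    refine (norm_pt_le _ _).trans ?_
    rw [abs_of_nonneg ht]
  rw [cutExt, smoothExt_eq_zero, smul_zero]
  intro y hy
  rw [abs_of_nonneg ht, norm_sub_rev] at hy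
  by_contra hne
  have hyR : ‖y‖ ≤ R := by simpa using hR (subset_tsupport _ hne)
  have h1 := norm_le_norm_add_norm_sub y (horizontal n z)
  have h2 : 4 / r = 2 / r + 2 / r := by ring
  linarith

/-- The constant of the gradient bound. -/
def gradConst (n : ℕ) (p : ℝ) : ℝ≥0∞ :=
  extConst n ^ p * (2 ^ p * (ballVolume n ^ (p - 1) * ENNReal.ofReal (n + p - 1)⁻¹ +
    ENNReal.ofReal ((8 + cutoffConst) ^ p * 2) * ballVolume n ^ p))

theorem gradConst_ne_top (n : ℕ) {p : ℝ} (hp : 1 < p) : gradConst n p ≠ ⊤ := by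
  have h1 := extConst_ne_top n
  have h2 := ballVolume_ne_top n
  have h3 : ballVolume n ^ (p - 1) ≠ ⊤ := ENNReal.rpow_ne_top_of_nonneg (by linarith) h2
  have h4 : ballVolume n ^ p ≠ ⊤ := ENNReal.rpow_ne_top_of_nonneg (by linarith) h2
  have h5 : extConst n ^ p ≠ ⊤ := ENNReal.rpow_ne_top_of_nonneg (by linarith) h1
  unfold gradConst
  finiteness

theorem ofReal_rpow_mul_ofReal_div {p : ℝ} (hp : 0 < p) {c r : ℝ} (hc : 0 ≤ c) (hr : 0 < r) :
    ENNReal.ofReal (c * r) ^ p * ENNReal.ofReal (2 / r) =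
      ENNReal.ofReal (c ^ p * 2) * ENNReal.ofReal (r ^ (p - 1)) := by
  rw [ENNReal.ofReal_rpow_of_nonneg (by positivity) hp.le, ← ENNReal.ofReal_mul (by positivity),
    ← ENNReal.ofReal_mul (by positivity), Real.mul_rpow hc hr.le, Real.rpow_sub_one hr.ne']
  congr 1
  ring

/-- When the curvature bound is `r ^ 2`, the curvature error and the derivative of the cutoff are
both of order `r` at heights up to `2 / r` and absent above. Their energy is therefore of order `r ^
p * (2 / r)` times the mass of `u`, which is the power `r ^ (p - 1)`. -/
theorem HalfSpaceForm.halfEnergy_covNorm_cutExt_le {r : ℝ} (hr : 0 < r)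
    (hΓ : HalfSpaceForm Γ (r ^ 2)) {p : ℝ} (hp : 1 < p) {u : EuclideanSpace ℝ (Fin n) → F}
    (hu : ContDiff ℝ 1 u) :
    halfEnergy p (covNorm Γ (cutExt r Γ u)) ≤ gradConst n p *
      (gagEnergy p Γ u + ENNReal.ofReal (r ^ (p - 1)) * lpEnergy p u) := by
  have hp0 : 0 < p := by linarith
  have hM := cutoffConst_nonneg
  -- The `8` comes from `4 * r ^ 2 * t` with `r * t ≤ 2`.
  set w : ℝ → ℝ≥0∞ := (Iic (2 / r)).indicator fun _ => ENNReal.ofReal ((8 + cutoffConst) * r)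
    with hw
  have hpt : ∀ t, 0 < t → ∀ x, ‖covNorm Γ (cutExt r Γ u) (pt x t)‖ₑ ≤ extConst n *
      (ENNReal.ofReal t⁻¹ * ballAverage (osc Γ u x) x t +
        w t * ballAverage (fun y => ‖u y‖ₑ) x t) := by
    intro t ht x
    refine (hΓ.enorm_covNorm_smul_le_osc hu (contDiff_cutoff_mul r) x ht).trans ?_
    simp only [deriv_cutoff_mul]
    refine mul_le_mul' le_rfl (add_le_add ?_ (mul_le_mul' ?_ le_rfl))
    · refine mul_le_of_le_one_left zero_le ?_
      rw [← ofReal_norm, Real.norm_eq_abs]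
      exact ENNReal.ofReal_le_one.2 (abs_cutoff_le_one _)
    · by_cases h : t ∈ Iic (2 / r)
      · rw [hw, indicator_of_mem h, ← ofReal_norm, ← ofReal_norm, Real.norm_eq_abs, Real.norm_eq_abs,
          ← ENNReal.ofReal_mul (abs_nonneg _), ← ENNReal.ofReal_add (by positivity) (abs_nonneg _)]
        refine ENNReal.ofReal_le_ofReal ?_
        have h1 := abs_cutoff_le_one (r * t)
        have h2 := abs_deriv_cutoff_le (r * t)
        have h3 : r * t ≤ 2 := by
          rw [mem_Iic, le_div_iff₀ hr] at h
          linarith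
        rw [abs_mul, abs_of_pos hr]
        calc |cutoff (r * t)| * (4 * r ^ 2 * t) + r * |deriv cutoff (r * t)|
            ≤ 1 * (4 * r ^ 2 * t) + r * cutoffConst := by gcongr
          _ = 1 * (4 * r * (r * t)) + r * cutoffConst := by ring
          _ ≤ 1 * (4 * r * 2) + r * cutoffConst := by gcongr
          _ = _ := by ring
      · have h3 : 2 < r * t := by
          rw [mem_Iic, not_le, div_lt_iff₀ hr] at h
          linarith
        rw [cutoff_eq_zero h3.le, deriv_cutoff_eq_zero_of_gt h3]
        simp
  refine (hΓ.halfEnergy_le_of_ballAverage_osc hp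
    (hΓ.continuous_covNorm (hΓ.contDiff_cutExt hu r)) hu.continuous
    (measurable_const.indicator measurableSet_Iic) (extConst_ne_top n) hpt).trans ?_
  rw [lintegral_indicator_Iic_rpow hp0, ofReal_rpow_mul_ofReal_div hp0 (by positivity) hr]
  rw [gradConst, mul_assoc (extConst n ^ p), mul_assoc (2 ^ p), add_mul]
  gcongr _ * (_ * (?_ + ?_))
  · exact mul_le_mul' le_rfl le_self_add
  · calc _ = ENNReal.ofReal ((8 + cutoffConst) ^ p * 2) * ballVolume n ^ p *
          (ENNReal.ofReal (r ^ (p - 1)) * lpEnergy p u) := by ring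
      _ ≤ _ := by
          gcongr
          exact le_add_self

/-- The constant of the mass bound. -/
def massConst (n : ℕ) (p : ℝ) : ℝ≥0∞ :=
  ENNReal.ofReal (kernConst n ^ p * 2) * ballVolume n ^ p

theorem massConst_ne_top (n : ℕ) {p : ℝ} (hp : 1 < p) : massConst n p ≠ ⊤ :=
  ENNReal.mul_ne_top ENNReal.ofReal_ne_top
    (ENNReal.rpow_ne_top_of_nonneg (by linarith) (ballVolume_ne_top n))

theorem IsSkewForm.rpow_mul_halfEnergy_cutExt_le {r : ℝ} (hr : 0 < r)
    (hΓ : IsSkewForm Γ) {p : ℝ} (hp : 1 < p) {u : EuclideanSpace ℝ (Fin n) → F}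
    (hu : ContDiff ℝ 1 u) :
    ENNReal.ofReal (r ^ p) * halfEnergy p (cutExt r Γ u) ≤ massConst n p *
      (ENNReal.ofReal (r ^ (p - 1)) * lpEnergy p u) := by
  have hp0 : 0 < p := by linarith
  have hk := (kernConst_pos n).le
  have h := halfEnergy_le_of_ballAverage hp (hΓ.contDiff_cutExt hu r).continuous hu.continuous
    (w := (Iic (2 / r)).indicator fun _ => ENNReal.ofReal (kernConst n))
    (measurable_const.indicator measurableSet_Iic) (fun t ht x => by
      rw [cutExt, enorm_smul, height_pt]
      have h1 : 0 < height n (pt x t) := by rwa [height_pt]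
      have h2 := hΓ.enorm_smoothExt_le u h1
      rw [height_pt, horizontal_pt] at h2
      by_cases h : t ∈ Iic (2 / r)
      · rw [indicator_of_mem h]
        refine (mul_le_mul' (b := (1 : ℝ≥0∞)) ?_ h2).trans (le_of_eq (one_mul _))
        rw [← ofReal_norm, Real.norm_eq_abs]
        exact ENNReal.ofReal_le_one.2 (abs_cutoff_le_one _)
      · have h3 : 2 < r * t := by
          rw [mem_Iic, not_le, div_lt_iff₀ hr] at h
          linarith
        rw [cutoff_eq_zero h3.le, enorm_zero, zero_mul]
        exact zero_le)
  rw [lintegral_indicator_Iic_rpow hp0] at h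
  calc _ ≤ ENNReal.ofReal (r ^ p) * (ENNReal.ofReal (kernConst n) ^ p * ENNReal.ofReal (2 / r) *
        (ballVolume n ^ p * lpEnergy p u)) := by gcongr
    _ = (ENNReal.ofReal (kernConst n * r) ^ p * ENNReal.ofReal (2 / r)) *
        (ballVolume n ^ p * lpEnergy p u) := by
        rw [ENNReal.ofReal_mul hk, ENNReal.mul_rpow_of_nonneg _ _ hp0.le,
          ENNReal.ofReal_rpow_of_nonneg hr.le hp0.le]
        ring
    _ = _ := by
        rw [ofReal_rpow_mul_ofReal_div hp0 hk hr, massConst]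
        ring

/-- The constant of the bound for differences of extensions. -/
def diffConst (n : ℕ) (p : ℝ) : ℝ≥0∞ :=
  extConst n ^ p * (ENNReal.ofReal ((1 + 4 * cutoffConst) ^ p / (p - 1)) * ballVolume n ^ p)

theorem diffConst_ne_top (n : ℕ) {p : ℝ} (hp : 1 < p) : diffConst n p ≠ ⊤ :=
  ENNReal.mul_ne_top (ENNReal.rpow_ne_top_of_nonneg (by linarith) (extConst_ne_top n))
    (ENNReal.mul_ne_top ENNReal.ofReal_ne_top
      (ENNReal.rpow_ne_top_of_nonneg (by linarith) (ballVolume_ne_top n)))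

/-- For a flat connection, the difference of two extensions is controlled by the `L^p` norm. -/
theorem HalfSpaceForm.halfEnergy_covNorm_cutExt_sub_le {r r' : ℝ} (hr' : 0 < r') (hrr : r' ≤ r)
    (hΓ : HalfSpaceForm Γ 0) {p : ℝ} (hp : 1 < p) {u : EuclideanSpace ℝ (Fin n) → F}
    (hu : ContDiff ℝ 1 u) :
    halfEnergy p (covNorm Γ (cutExt r Γ u - cutExt r' Γ u)) ≤ diffConst n p *
      (ENNReal.ofReal (r ^ (p - 1)) * lpEnergy p u) := by
  have hp0 : 0 < p := by linarith
  have hr : 0 < r := hr'.trans_le hrr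
  have hM := cutoffConst_nonneg
  -- Since `r' ≤ r`, both cutoffs equal one below height `r⁻¹`, so `η` vanishes there. Above, the
  -- crude bound of order `t⁻¹` suffices, since `t ^ (-p)` has the tail integral `r ^ (p - 1) / (p -
  -- 1)`, which does not involve `r'`.
  set η : ℝ → ℝ := fun t => cutoff (r * t) - cutoff (r' * t) with hη
  have hηc : ContDiff ℝ 1 η := (contDiff_cutoff_mul r).sub (contDiff_cutoff_mul r')
  have he : cutExt r Γ u - cutExt r' Γ u = fun z => η (height n z) • smoothExt Γ u z := by
    ext1 z
    simp only [Pi.sub_apply, cutExt, hη, sub_smul]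
  have hηd : ∀ t, deriv η t = r * deriv cutoff (r * t) - r' * deriv cutoff (r' * t) := fun t => by
    rw [hη, deriv_fun_sub ((contDiff_cutoff_mul r).differentiable one_ne_zero t)
      ((contDiff_cutoff_mul r').differentiable one_ne_zero t), deriv_cutoff_mul, deriv_cutoff_mul]
  have h := halfEnergy_le_of_ballAverage hp (W := covNorm Γ (cutExt r Γ u - cutExt r' Γ u))
    (hΓ.continuous_covNorm ((hΓ.contDiff_cutExt hu r).sub (hΓ.contDiff_cutExt hu r')))
    hu.continuous (w := fun t => extConst n *
      (Ici r⁻¹).indicator (fun t => ENNReal.ofReal ((1 + 4 * cutoffConst) * t⁻¹)) t)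
    (Measurable.const_mul (Measurable.indicator (by fun_prop) measurableSet_Ici) _)
    (fun t ht x => by
      rw [he]
      refine (hΓ.enorm_covNorm_smul_le_crude hu hηc x ht).trans ?_
      rw [mul_assoc (extConst n)]
      refine mul_le_mul' le_rfl (mul_le_mul' ?_ le_rfl)
      by_cases h : t ∈ Ici r⁻¹
      · rw [indicator_of_mem h, ← ofReal_norm, ← ofReal_norm, Real.norm_eq_abs, Real.norm_eq_abs,
          ← ENNReal.ofReal_mul (abs_nonneg _), ← ENNReal.ofReal_add (by positivity) (abs_nonneg _)]
        refine ENNReal.ofReal_le_ofReal ?_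
        have h1 : |η t| ≤ 1 := by
          rw [hη, abs_le]
          have := cutoff_nonneg (r * t)
          have := cutoff_nonneg (r' * t)
          have := cutoff_le_one (r * t)
          have := cutoff_le_one (r' * t)
          constructor <;> linarith
        have h2 : |deriv η t| ≤ 4 * cutoffConst * t⁻¹ := by
          rw [hηd]
          refine (abs_sub _ _).trans ?_
          rw [abs_mul, abs_mul, abs_of_pos hr, abs_of_pos hr']
          have := mul_abs_deriv_cutoff_le (r := r) ht
          have := mul_abs_deriv_cutoff_le (r := r') ht
          linarith
        calc |η t| * (t⁻¹ + 2 * 0 * t) + |deriv η t| ≤ 1 * (t⁻¹ + 2 * 0 * t) +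
              4 * cutoffConst * t⁻¹ := by gcongr
          _ = _ := by ring
      · have h3 : r * t < 1 := by
          rw [mem_Ici, not_le, lt_inv_comm₀ ht hr] at h
          rwa [← lt_inv_mul_iff₀ hr, mul_one, lt_inv_comm₀ ht hr]
        have h4 : r' * t < 1 := lt_of_le_of_lt (by gcongr) h3
        rw [hηd, deriv_cutoff_eq_zero_of_lt h3, deriv_cutoff_eq_zero_of_lt h4, hη]
        simp [cutoff_eq_one h3.le, cutoff_eq_one h4.le])
  refine h.trans (le_of_eq ?_)
  simp only [ENNReal.mul_rpow_of_nonneg _ _ hp0.le]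
  rw [lintegral_const_mul' _ _ (ENNReal.rpow_ne_top_of_nonneg hp0.le (extConst_ne_top n)),
    lintegral_indicator_Ici_rpow hp hr (by positivity), diffConst]
  ring

end ExtensionEstimates

/-! ### Minkowski's inequality for covariant energies -/

section Minkowski

theorem hilbertSchmidtNorm_add_le {k : ℕ} {F : Type*} [NormedAddCommGroup F]
    [InnerProductSpace ℝ F] (S T : EuclideanSpace ℝ (Fin k) →L[ℝ] F) :
    hilbertSchmidtNorm (S + T) ≤ hilbertSchmidtNorm S + hilbertSchmidtNorm T := by
  set g : (EuclideanSpace ℝ (Fin k) →L[ℝ] F) → PiLp 2 fun _ : Fin k => F := fun T =>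
    WithLp.toLp 2 fun i => T (EuclideanSpace.single i 1) with hg
  have h : ∀ T, hilbertSchmidtNorm T = ‖g T‖ := fun T => by
    rw [PiLp.norm_eq_of_L2]
    rfl
  have hadd : g (S + T) = g S + g T := rfl
  rw [h, h, h, hadd]
  exact norm_add_le _ _

variable {n : ℕ} {F : Type*} [NormedAddCommGroup F] [InnerProductSpace ℝ F]
  {Γ : EuclideanSpace ℝ (Fin (n + 1)) → EuclideanSpace ℝ (Fin (n + 1)) →L[ℝ] F →L[ℝ] F}

theorem covNorm_add_le {U V : EuclideanSpace ℝ (Fin (n + 1)) → F} (hU : ContDiff ℝ 1 U)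
    (hV : ContDiff ℝ 1 V) (z : EuclideanSpace ℝ (Fin (n + 1))) :
    covNorm Γ (U + V) z ≤ covNorm Γ U z + covNorm Γ V z := by
  have e : fderiv ℝ (U + V) z + (Γ z).flip ((U + V) z) =
      (fderiv ℝ U z + (Γ z).flip (U z)) + (fderiv ℝ V z + (Γ z).flip (V z)) := by
    rw [fderiv_add (hU.differentiable one_ne_zero z) (hV.differentiable one_ne_zero z),
      Pi.add_apply, map_add]
    abel
  rw [covNorm, e]
  exact hilbertSchmidtNorm_add_le _ _

variable [FiniteDimensional ℝ F]

theorem IsSkewForm.halfEnergy_covNorm_add_le (hΓ : IsSkewForm Γ) {p : ℝ} (hp : 1 ≤ p)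
    {U V : EuclideanSpace ℝ (Fin (n + 1)) → F} (hU : ContDiff ℝ 1 U) (hV : ContDiff ℝ 1 V) :
    halfEnergy p (covNorm Γ (U + V)) ^ (1 / p) ≤
      halfEnergy p (covNorm Γ U) ^ (1 / p) + halfEnergy p (covNorm Γ V) ^ (1 / p) := by
  have hp0 : 0 < p := by linarith
  refine le_trans (ENNReal.rpow_le_rpow (lintegral_mono fun z => ENNReal.rpow_le_rpow ?_ hp0.le)
    (by positivity)) (ENNReal.lintegral_Lp_add_le (hΓ.continuous_covNorm hU).enorm.aemeasurable
      (hΓ.continuous_covNorm hV).enorm.aemeasurable hp)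
  rw [Pi.add_apply, Real.enorm_of_nonneg (covNorm_nonneg _ _),
    Real.enorm_of_nonneg (covNorm_nonneg _ _), Real.enorm_of_nonneg (covNorm_nonneg _ _),
    ← ENNReal.ofReal_add (covNorm_nonneg _ _) (covNorm_nonneg _ _)]
  exact ENNReal.ofReal_le_ofReal (covNorm_add_le hU hV z)

theorem IsSkewForm.halfEnergy_covNorm_sum_le (hΓ : IsSkewForm Γ) {p : ℝ} (hp : 1 ≤ p)
    {f : ℕ → EuclideanSpace ℝ (Fin (n + 1)) → F} (hf : ∀ j, ContDiff ℝ 1 (f j)) (J : ℕ) :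
    halfEnergy p (covNorm Γ (∑ j ∈ Finset.range J, f j)) ^ (1 / p) ≤
      ∑ j ∈ Finset.range J, halfEnergy p (covNorm Γ (f j)) ^ (1 / p) := by
  have hp0 : 0 < p := by linarith
  have hs : ∀ J : ℕ, ContDiff ℝ 1 (∑ j ∈ Finset.range J, f j) := fun J => by
    induction J with
    | zero => exact contDiff_const (c := (0 : F))
    | succ J ih =>
      rw [Finset.sum_range_succ]
      exact ih.add (hf J)
  induction J with
  | zero =>
    have h0 : ∀ z, covNorm Γ (0 : EuclideanSpace ℝ (Fin (n + 1)) → F) z = 0 := fun z => by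
      simp [covNorm, hilbertSchmidtNorm]
    simp [halfEnergy, h0, hp0]
  | succ J ih =>
    rw [Finset.sum_range_succ, Finset.sum_range_succ]
    exact (hΓ.halfEnergy_covNorm_add_le hp (hs J) (hf J)).trans (add_le_add ih le_rfl)

end Minkowski

/-! ### Linearity, and the curved case -/

section LinearExtension

variable {n : ℕ} {F : Type*} [NormedAddCommGroup F] [InnerProductSpace ℝ F]
  [FiniteDimensional ℝ F]
  {Γ Γ' : EuclideanSpace ℝ (Fin (n + 1)) → EuclideanSpace ℝ (Fin (n + 1)) →L[ℝ] F →L[ℝ] F}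

/-- The cut off extension as a linear map. -/
def cutExtLinear (hΓ : IsSkewForm Γ) {r : ℝ} (hr : 0 < r) : C1c n F →ₗ[ℝ] C1cHalfSpace n F where
  toFun u := ⟨cutExt r Γ u.1, hΓ.cutExt_mem u.2 hr⟩
  map_add' u v := by
    ext z
    simp only [cutExt, Submodule.coe_add, Pi.add_apply,
      hΓ.smoothExt_add u.2.1.continuous v.2.1.continuous, smul_add]
  map_smul' c u := by
    ext z
    simp only [cutExt, Submodule.coe_smul, Pi.smul_apply, smoothExt_smul, RingHom.id_apply,
      smul_comm c]

theorem HalfSpaceForm.interiorNorm_cutExt_le {β : ℝ≥0} (hΓ' : HalfSpaceForm Γ' β)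
    (he : ∀ z ∈ closedHalfSpace n, Γ' z = Γ z) (hβ : 0 < β) {p : ℝ} (hp : 1 < p) (u : C1c n F) :
    interiorNorm p β Γ (cutExt ((β : ℝ) ^ (1 / 2 : ℝ)) Γ' u.1) ≤
      (gradConst n p ^ (1 / p) + massConst n p ^ (1 / p)) * boundaryNorm p β Γ u.1 := by
  have hp0 : 0 < p := by linarith
  have hip : 0 ≤ 1 / p := by positivity
  have hβ' : (0 : ℝ) < β := hβ
  -- The natural scale: `r ^ 2` is the curvature bound, and `r ^ (p - 1)` and `r ^ p` become the
  -- weights of the boundary and interior masses.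
  set r := (β : ℝ) ^ (1 / 2 : ℝ) with hrdef
  have hr : 0 < r := Real.rpow_pos_of_pos hβ' _
  have hr2 : r ^ 2 = β := by
    rw [hrdef, ← Real.rpow_natCast, ← Real.rpow_mul hβ'.le]
    norm_num
  have hpow : ∀ a : ℝ, r ^ a = (β : ℝ) ^ (a / 2) := fun a => by
    rw [hrdef, ← Real.rpow_mul hβ'.le]
    congr 1
    ring
  have e1 : (p - 1) / (2 * p) * p = (p - 1) / 2 := by field_simp
  have e2 : 1 / 2 * p = p / 2 := by ring
  rw [hΓ'.boundaryNorm_eq hp0 β he, interiorNorm_eq hp0 β he (hΓ'.contDiff_cutExt u.2.1 r)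
    (fun _ _ => rfl), coe_rpow_mul_rpow hp0, coe_rpow_mul_rpow hp0, e1, e2, ← hpow, ← hpow]
  have h1 := (hr2 ▸ hΓ' : HalfSpaceForm Γ' (r ^ 2)).halfEnergy_covNorm_cutExt_le hr hp u.2.1
  have h2 := hΓ'.rpow_mul_halfEnergy_cutExt_le hr hp u.2.1
  set D := ENNReal.ofReal (r ^ (p - 1)) * lpEnergy p u.1
  rw [add_mul]
  refine add_le_add ((ENNReal.rpow_le_rpow h1 hip).trans ?_)
    ((ENNReal.rpow_le_rpow h2 hip).trans ?_)
  · rw [ENNReal.mul_rpow_of_nonneg _ _ hip]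
    gcongr
    exact ENNReal.rpow_add_le_add_rpow _ _ hip (by rw [div_le_one hp0]; exact hp.le)
  · rw [ENNReal.mul_rpow_of_nonneg _ _ hip]
    gcongr
    exact le_add_self

/-- A pointwise eventually constant sequence of linear maps has a linear limit. -/
theorem exists_linearMap_eventually_eq {M N : Type*} [AddCommGroup M] [Module ℝ M]
    [AddCommGroup N] [Module ℝ N] (f : ℕ → M →ₗ[ℝ] N)
    (h : ∀ m, ∃ J, ∀ j, J ≤ j → f (j + 1) m = f j m) :
    ∃ E : M →ₗ[ℝ] N, ∀ m, ∃ J, ∀ j, J ≤ j → f j m = E m := by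
  choose J hJ using h
  have hJ' : ∀ m j, J m ≤ j → f j m = f (J m) m := fun m j hj => by
    induction j, hj using Nat.le_induction with
    | base => rfl
    | succ j hj ih => rw [hJ m j hj, ih]
  refine ⟨{ toFun := fun m => f (J m) m, map_add' := fun a b => ?_, map_smul' := fun c a => ?_ },
    fun m => ⟨J m, hJ' m⟩⟩
  · set k := max (J (a + b)) (max (J a) (J b))
    rw [← hJ' (a + b) k (le_max_left _ _), ← hJ' a k (by simp [k]), ← hJ' b k (by simp [k]),
      map_add]
  · set k := max (J (c • a)) (J a)
    rw [← hJ' (c • a) k (le_max_left _ _), ← hJ' a k (le_max_right _ _), map_smul]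
    rfl

end LinearExtension

/-! ### Linear localization with control by the seminorm -/

section Localization

variable {n : ℕ} {F : Type*} [NormedAddCommGroup F] [InnerProductSpace ℝ F]

/-- The function `u` minus the average near `c` of its parallel transports, localized to a ball. -/
def localize (Γ : EuclideanSpace ℝ (Fin (n + 1)) → EuclideanSpace ℝ (Fin (n + 1)) →L[ℝ] F →L[ℝ] F)
    (R : ℝ) (c : EuclideanSpace ℝ (Fin n)) (u : EuclideanSpace ℝ (Fin n) → F)
    (x : EuclideanSpace ℝ (Fin n)) : F :=
  cutoff (R⁻¹ ^ 2 * ‖x‖ ^ 2) • (u x - ∫ y, mollifier n (y - c) •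
    transport Γ (boundaryIncl n y, boundaryIncl n x) (u y))

variable [FiniteDimensional ℝ F]
  {Γ : EuclideanSpace ℝ (Fin (n + 1)) → EuclideanSpace ℝ (Fin (n + 1)) →L[ℝ] F →L[ℝ] F}

local instance : CompleteSpace F := FiniteDimensional.complete ℝ F

theorem mollifier_sub_eq_zero {c y : EuclideanSpace ℝ (Fin n)} (hy : y ∉ Metric.closedBall c 1) :
    mollifier n (y - c) = 0 := by
  rw [Metric.mem_closedBall, dist_eq_norm, not_le] at hy
  exact mollifier_eq_zero hy.le

theorem cutoff_norm_eq_zero {R : ℝ} (hR : 0 < R) {x : EuclideanSpace ℝ (Fin n)}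
    (hx : 2 * R < ‖x‖) : cutoff (R⁻¹ ^ 2 * ‖x‖ ^ 2) = 0 := by
  refine cutoff_eq_zero ?_
  have h1 : 2 < R⁻¹ * ‖x‖ := by
    rw [inv_mul_eq_div, lt_div_iff₀ hR]
    exact hx
  rw [← mul_pow]
  nlinarith

theorem IsSkewForm.localize_mem (hΓ : IsSkewForm Γ) {R : ℝ} (hR : 0 < R)
    (c : EuclideanSpace ℝ (Fin n)) {u : EuclideanSpace ℝ (Fin n) → F} (hu : u ∈ C1c n F) :
    localize Γ R c u ∈ C1c n F := by
  have hT := hΓ.contDiff_transport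
  have hm := contDiff_mollifier n
  have hu1 := hu.1
  refine ⟨ContDiff.smul ?_ (hu.1.sub ?_), HasCompactSupport.intro (isCompact_closedBall 0 (2 * R))
    fun x hx => ?_⟩
  -- The squared norm is used because it is smooth at the origin.
  · exact contDiff_cutoff.comp (contDiff_const.mul (contDiff_norm_sq ℝ))
  · exact contDiff_integral_of_contDiff (f := fun q : EuclideanSpace ℝ (Fin n) ×
      EuclideanSpace ℝ (Fin n) => mollifier n (q.2 - c) •
        transport Γ (boundaryIncl n q.2, boundaryIncl n q.1) (u q.2))
      (isCompact_closedBall c 1) (by fun_prop) fun x y hy => by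
        simp only [mollifier_sub_eq_zero hy, zero_smul]
  · rw [mem_closedBall_zero_iff, not_le] at hx
    rw [localize, cutoff_norm_eq_zero hR hx, zero_smul]

theorem hasCompactSupport_mollifier_sub (c : EuclideanSpace ℝ (Fin n)) :
    HasCompactSupport fun y => mollifier n (y - c) :=
  HasCompactSupport.intro (isCompact_closedBall c 1) fun _ hy => mollifier_sub_eq_zero hy

theorem IsSkewForm.integrable_localize (hΓ : IsSkewForm Γ) (c : EuclideanSpace ℝ (Fin n))
    {u : EuclideanSpace ℝ (Fin n) → F} (hu : Continuous u) (x : EuclideanSpace ℝ (Fin n)) :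
    Integrable fun y => mollifier n (y - c) •
      transport Γ (boundaryIncl n y, boundaryIncl n x) (u y) := by
  have hT := hΓ.continuous_transport
  have hm := (contDiff_mollifier n).continuous
  exact Continuous.integrable_of_hasCompactSupport (by fun_prop)
    (hasCompactSupport_mollifier_sub c).smul_right

/-- The localization as a linear map. -/
def localizeLinear (hΓ : IsSkewForm Γ) {R : ℝ} (hR : 0 < R) (c : EuclideanSpace ℝ (Fin n)) :
    C1c n F →ₗ[ℝ] C1c n F where
  toFun u := ⟨localize Γ R c u.1, hΓ.localize_mem hR c u.2⟩
  map_add' u v := by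
    ext1
    funext x
    simp only [localize, Submodule.coe_add, Pi.add_apply, map_add, smul_add]
    rw [integral_add (hΓ.integrable_localize c u.2.1.continuous x)
      (hΓ.integrable_localize c v.2.1.continuous x), ← smul_add]
    congr 1
    abel
  map_smul' a u := by
    ext1
    funext x
    simp only [localize, Submodule.coe_smul, Pi.smul_apply, map_smul, RingHom.id_apply,
      smul_comm _ a]
    rw [integral_smul, ← smul_sub, smul_comm]

/-- The mollifier centred at `c` lives in a unit ball that meets the ball of radius `R` containing
the support of `u` at most where the mollifier vanishes. So the subtracted average is zero, and the
cutoff equals one wherever `u` does not vanish. -/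
theorem localize_eq_self {R : ℝ} (hR : 0 < R) {c : EuclideanSpace ℝ (Fin n)} (hc : R + 1 ≤ ‖c‖)
    {u : EuclideanSpace ℝ (Fin n) → F} (hu : ∀ x, R < ‖x‖ → u x = 0) : localize Γ R c u = u := by
  ext1 x
  have h0 : ∀ y, mollifier n (y - c) • transport Γ (boundaryIncl n y, boundaryIncl n x) (u y) =
      0 := fun y => by
    by_cases hy : R < ‖y‖
    · rw [hu y hy, map_zero, smul_zero]
    · rw [mollifier_eq_zero, zero_smul]
      have := norm_sub_norm_le c y
      rw [norm_sub_rev] at this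
      linarith
  rw [localize]
  simp only [h0, integral_zero, sub_zero]
  by_cases hx : R < ‖x‖
  · rw [hu x hx, smul_zero]
  · have h1 : R⁻¹ * ‖x‖ ≤ 1 := by
      rw [inv_mul_eq_div, div_le_one hR]
      exact not_lt.1 hx
    rw [cutoff_eq_one, one_smul]
    rw [← mul_pow]
    exact pow_le_one₀ (by positivity) h1

/-- A Poincaré inequality: after subtraction of the average, the value at `x` is itself an average
of covariant differences with `y` near `c`. For `x` in the support of the cutoff these distances are
bounded, so the Gagliardo kernel is bounded below. The constant depends on `R` and `c`, but not on
`u`. -/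
theorem IsSkewForm.exists_lpEnergy_localize_le (hΓ : IsSkewForm Γ) {p : ℝ} (hp : 1 < p) {R : ℝ}
    (hR : 0 < R) (c : EuclideanSpace ℝ (Fin n)) :
    ∃ N : ℝ≥0, ∀ u ∈ C1c n F, lpEnergy p (localize Γ R c u) ≤ N * gagEnergy p Γ u := by
  have hp0 : 0 < p := by linarith
  have hn0 : (0 : ℝ) ≤ n := Nat.cast_nonneg n
  have hq : 0 < (n : ℝ) + p - 1 := by linarith
  obtain ⟨M, hM⟩ := (hasCompactSupport_mollifier (n := n)).exists_bound_of_continuous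
    (contDiff_mollifier n).continuous
  set B := Metric.closedBall c 1 with hB
  -- Bounds `‖x - y‖` for `‖x‖ ≤ 2 * R` and `y` in the unit ball about `c`.
  set D : ℝ := 2 * R + ‖c‖ + 1 with hD
  have hD0 : 0 < D := by positivity
  set K : ℝ≥0∞ := ENNReal.ofReal M ^ p * (volume B ^ (p - 1) *
    ENNReal.ofReal D ^ ((n : ℝ) + p - 1)) with hK
  have hBt : volume B ≠ ⊤ := (isCompact_closedBall c 1).measure_ne_top
  have hK1 : volume B ^ (p - 1) ≠ ⊤ := ENNReal.rpow_ne_top_of_nonneg (by linarith) hBt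
  have hKt : K ≠ ⊤ := by finiteness
  refine ⟨K.toNNReal, fun u hu => ?_⟩
  rw [ENNReal.coe_toNNReal hKt]
  have hosc : ∀ x, Measurable (osc Γ u x) := fun x =>
    (hΓ.measurable_osc hu.1.continuous).comp (measurable_prodMk_left (x := x))
  have hpt : ∀ x, ‖localize Γ R c u x‖ₑ ^ p ≤
      K * ∫⁻ y, osc Γ u x y ^ p / ‖x - y‖ₑ ^ ((n : ℝ) + p - 1) := by
    intro x
    by_cases hx : 2 * R < ‖x‖
    · rw [localize, cutoff_norm_eq_zero hR hx, zero_smul, enorm_zero, ENNReal.zero_rpow_of_pos hp0]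
      exact zero_le
    have e1 : u x = ∫ y, mollifier n (y - c) • u x := by
      rw [integral_smul_const, integral_sub_right_eq_self (mollifier n) c, integral_mollifier,
        one_smul]
    have hi : Integrable fun y => mollifier n (y - c) • u x := by
      have hm := (contDiff_mollifier n).continuous
      exact Continuous.integrable_of_hasCompactSupport (by fun_prop)
        (hasCompactSupport_mollifier_sub c).smul_right
    have h1 : ‖localize Γ R c u x‖ₑ ≤ ENNReal.ofReal M * ∫⁻ y in B, osc Γ u x y := by
      have e2 : u x - ∫ y, mollifier n (y - c) • transport Γ (boundaryIncl n y, boundaryIncl n x)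
          (u y) = ∫ y in B, mollifier n (y - c) • (u x - transport Γ (boundaryIncl n y,
            boundaryIncl n x) (u y)) := by
        rw [setIntegral_eq_integral_of_forall_compl_eq_zero fun y hy => by
          rw [mollifier_sub_eq_zero hy, zero_smul]]
        conv_lhs => rw [e1]
        rw [← integral_sub hi (hΓ.integrable_localize c hu.1.continuous x)]
        simp only [smul_sub]
      rw [localize, enorm_smul, e2, ← lintegral_const_mul' _ _ ENNReal.ofReal_ne_top]
      refine (mul_le_of_le_one_left zero_le ?_).trans
        ((enorm_integral_le_lintegral_enorm _).trans (lintegral_mono fun y => ?_))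
      · rw [← ofReal_norm, Real.norm_eq_abs]
        exact ENNReal.ofReal_le_one.2 (abs_cutoff_le_one _)
      · rw [enorm_smul, ← ofReal_norm (mollifier n _)]
        exact mul_le_mul' (ENNReal.ofReal_le_ofReal (hM _)) le_rfl
    have h2 : ∀ y ∈ B, osc Γ u x y ^ p ≤ ENNReal.ofReal D ^ ((n : ℝ) + p - 1) *
        (osc Γ u x y ^ p / ‖x - y‖ₑ ^ ((n : ℝ) + p - 1)) := by
      intro y hy
      by_cases hxy : x = y
      · subst hxy
        rw [hΓ.osc_self, ENNReal.zero_rpow_of_pos hp0]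
        exact zero_le
      rw [hB, Metric.mem_closedBall, dist_eq_norm] at hy
      have h3 : ‖x - y‖ ≤ D := by
        have a1 := norm_sub_le x y
        have a2 := norm_le_norm_add_norm_sub c y
        rw [norm_sub_rev] at a2
        rw [hD]
        linarith
      have h4 : ‖x - y‖ₑ ^ ((n : ℝ) + p - 1) ≠ 0 := by
        rw [Ne, ENNReal.rpow_eq_zero_iff_of_pos hq, enorm_eq_zero, sub_eq_zero]
        exact hxy
      have h5 : ‖x - y‖ₑ ^ ((n : ℝ) + p - 1) ≠ ⊤ := by finiteness
      calc osc Γ u x y ^ p = ‖x - y‖ₑ ^ ((n : ℝ) + p - 1) *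
            (osc Γ u x y ^ p / ‖x - y‖ₑ ^ ((n : ℝ) + p - 1)) :=
            (ENNReal.mul_div_cancel h4 h5).symm
        _ ≤ _ := by
            gcongr
            rw [← ofReal_norm]
            exact ENNReal.ofReal_le_ofReal h3
    calc _ ≤ (ENNReal.ofReal M * ∫⁻ y in B, osc Γ u x y) ^ p := ENNReal.rpow_le_rpow h1 hp0.le
      _ ≤ ENNReal.ofReal M ^ p * (volume B ^ (p - 1) * ∫⁻ y in B, osc Γ u x y ^ p) := by
          rw [ENNReal.mul_rpow_of_nonneg _ _ hp0.le]
          gcongr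
          refine (rpow_lintegral_le _ hp (hosc x).aemeasurable).trans ?_
          rw [Measure.restrict_apply_univ]
      _ ≤ ENNReal.ofReal M ^ p * (volume B ^ (p - 1) * ∫⁻ y in B,
            ENNReal.ofReal D ^ ((n : ℝ) + p - 1) *
              (osc Γ u x y ^ p / ‖x - y‖ₑ ^ ((n : ℝ) + p - 1))) := by
          exact mul_le_mul' le_rfl (mul_le_mul' le_rfl
            (setLIntegral_mono' Metric.isClosed_closedBall.measurableSet h2))
      _ = K * ∫⁻ y in B, osc Γ u x y ^ p / ‖x - y‖ₑ ^ ((n : ℝ) + p - 1) := by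
          rw [lintegral_const_mul' _ _ (by finiteness), hK]
          ring
      _ ≤ _ := by
          gcongr
          exact Measure.restrict_le_self
  refine (lintegral_mono hpt).trans (le_of_eq ?_)
  rw [lintegral_const_mul' _ _ hKt]
  rfl

end Localization

/-! ### The flat case and the extension theorem -/

section FlatExtension

/-- Scales decreasing fast compared to a given sequence. -/
theorem exists_scales {p : ℝ} (hp : 1 < p) (N : ℕ → ℝ≥0) :
    ∃ r : ℕ → ℝ, (∀ j, 0 < r j) ∧ Antitone r ∧
      ∀ j, ENNReal.ofReal (r j ^ (p - 1)) * N j ≤ ((1 / 2) ^ j) ^ p := by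
  have hp0 : 0 < p := by linarith
  have hp1 : 0 < p - 1 := by linarith
  -- A positive increasing majorant of `N`. Dividing by it, rather than by `N j`, makes the scales
  -- antitone.
  set S : ℕ → ℝ≥0 := fun j => 1 + ∑ i ∈ Finset.range (j + 1), N i with hS
  have hS0 : ∀ j, 0 < S j := fun j => by positivity
  have hSm : Monotone S := fun i j hij => by
    simp only [hS]
    gcongr
  set a : ℕ → ℝ≥0 := fun j => ((1 / 2) ^ j) ^ p / S j with ha
  have ha0 : ∀ j, 0 < a j := fun j => by
    have := hS0 j
    positivity
  refine ⟨fun j => (a j : ℝ) ^ (1 / (p - 1)), fun j => Real.rpow_pos_of_pos (ha0 j) _,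
    fun i j hij => ?_, fun j => ?_⟩
  · have h1 : a j ≤ a i := by
      have h2 : ((1 / 2 : ℝ≥0) ^ j) ^ p ≤ ((1 / 2) ^ i) ^ p := by
        refine NNReal.rpow_le_rpow (pow_le_pow_of_le_one zero_le ?_ hij) hp0.le
        rw [← NNReal.coe_le_coe]
        norm_num
      exact div_le_div₀ zero_le h2 (hS0 i) (hSm hij)
    have h2 : (a j : ℝ) ≤ a i := h1
    exact Real.rpow_le_rpow (a j).2 h2 (by positivity)
  · simp only
    rw [← Real.rpow_mul (NNReal.coe_nonneg (a j)), one_div_mul_cancel hp1.ne', Real.rpow_one,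
      ENNReal.ofReal_coe_nnreal]
    have h1 : N j ≤ S j := by
      have := Finset.single_le_sum (f := N) (fun _ _ => zero_le) (Finset.self_mem_range_succ j)
      exact this.trans le_add_self
    have h2 : a j * N j ≤ ((1 / 2) ^ j) ^ p := by
      calc a j * N j ≤ a j * S j := by gcongr
        _ = _ := div_mul_cancel₀ _ (hS0 j).ne'
    have h3 : (((1 / 2 : ℝ≥0) ^ j) ^ p : ℝ≥0) = (((1 / 2 : ℝ≥0∞) ^ j) ^ p : ℝ≥0∞) := by
      rw [ENNReal.coe_rpow_of_nonneg _ hp0.le]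
      push_cast
      norm_num
    rw [← h3]
    exact_mod_cast h2

variable {n : ℕ} {F : Type*} [NormedAddCommGroup F] [InnerProductSpace ℝ F]
  [FiniteDimensional ℝ F]
  {Γ Γ' : EuclideanSpace ℝ (Fin (n + 1)) → EuclideanSpace ℝ (Fin (n + 1)) →L[ℝ] F →L[ℝ] F}

theorem sum_half_pow_le (J : ℕ) : ∑ j ∈ Finset.range J, (1 / 2 : ℝ≥0∞) ^ j ≤ 2 := by
  have h := ENNReal.sum_le_tsum (f := fun j : ℕ => (1 / 2 : ℝ≥0∞) ^ j) (Finset.range J)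
  refine h.trans (le_of_eq ?_)
  rw [one_div, ENNReal.tsum_geometric, ENNReal.one_sub_inv_two, inv_inv]

/-- Localization replaces the missing mass term by the seminorm, with constants `N j` that the
scales `r j` compensate: the `j`-th mass contribution is at most `2 ^ (-j * p)` times the Gagliardo
energy. Every operator involved is linear in `u`, and the choice of scales does not depend on `u`.
-/
theorem HalfSpaceForm.exists_flat_extension (hn : 1 ≤ n) (hΓ' : HalfSpaceForm Γ' 0) {p : ℝ}
    (hp : 1 < p) :
    ∃ E : C1c n F →ₗ[ℝ] C1cHalfSpace n F, ∀ u : C1c n F,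
      (∀ x, (E u).1 (boundaryIncl n x) = u.1 x) ∧ ContDiff ℝ 1 (E u).1 ∧
      halfEnergy p (covNorm Γ' (E u).1) ^ (1 / p) ≤
        ((2 * gradConst n p) ^ (1 / p) + 2 * diffConst n p ^ (1 / p)) *
          gagEnergy p Γ' u.1 ^ (1 / p) := by
  have hp0 : 0 < p := by linarith
  have hip : 0 ≤ 1 / p := by positivity
  have hΓ := hΓ'.toIsSkewForm
  -- The norm `j + 2` exceeds the localization radius `j + 1` by exactly the radius of the
  -- mollifier. A direction to move in exists because `n ≥ 1`.
  set c : ℕ → EuclideanSpace ℝ (Fin n) := fun j =>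
    ((j : ℝ) + 2) • EuclideanSpace.single (⟨0, hn⟩ : Fin n) (1 : ℝ) with hc
  have hcn : ∀ j, ‖c j‖ = j + 2 := fun j => by
    simp only [hc]
    rw [norm_smul, PiLp.norm_single, norm_one, mul_one,
      Real.norm_of_nonneg (by positivity)]
  have hR : ∀ j : ℕ, 0 < (j : ℝ) + 1 := fun j => by positivity
  choose N hN using fun j : ℕ => hΓ.exists_lpEnergy_localize_le hp (hR j) (c j)
  obtain ⟨r, hr0, hra, hrN⟩ := exists_scales hp N
  set S : ℕ → C1c n F →ₗ[ℝ] C1c n F := fun j => localizeLinear hΓ (hR j) (c j) with hS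
  set X : ℕ → C1c n F →ₗ[ℝ] C1cHalfSpace n F := fun j => cutExtLinear hΓ (hr0 j) with hX
  -- Once `S J` and `S (J + 1)` both fix `u`, the new summand `X J u - X (J + 1) u` compensates the
  -- change of the leading term.
  set E : ℕ → C1c n F →ₗ[ℝ] C1cHalfSpace n F := fun J =>
    X J ∘ₗ S J + ∑ j ∈ Finset.range J, (X j - X (j + 1)) ∘ₗ S j with hE
  have hSu : ∀ u : C1c n F, ∃ J₀, ∀ j, J₀ ≤ j → S j u = u := by
    intro u
    obtain ⟨R, hRu⟩ := u.2.2.isBounded.subset_closedBall 0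
    refine ⟨⌈R⌉₊, fun j hj => Subtype.ext ?_⟩
    have hRj : R ≤ j := (Nat.le_ceil R).trans (by exact_mod_cast hj)
    refine localize_eq_self (hR j) (by rw [hcn]; linarith) fun x hx => ?_
    by_contra hne
    have : ‖x‖ ≤ R := by simpa using hRu (subset_tsupport _ hne)
    linarith
  have hEu : ∀ u, ∃ J₀, ∀ j, J₀ ≤ j → E (j + 1) u = E j u := by
    intro u
    obtain ⟨J₀, hJ⟩ := hSu u
    refine ⟨J₀, fun j hj => ?_⟩
    simp only [hE, LinearMap.add_apply, LinearMap.comp_apply, Finset.sum_range_succ,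
      LinearMap.sub_apply, hJ j hj, hJ (j + 1) (by omega)]
    abel
  obtain ⟨L, hL⟩ := exists_linearMap_eventually_eq E hEu
  refine ⟨L, fun u => ?_⟩
  obtain ⟨J₁, hJ₁⟩ := hSu u
  obtain ⟨J₂, hJ₂⟩ := hL u
  set J := max J₁ J₂
  have hSJ : S J u = u := hJ₁ J (le_max_left _ _)
  set f : ℕ → EuclideanSpace ℝ (Fin (n + 1)) → F := fun j =>
    cutExt (r j) Γ' (S j u).1 - cutExt (r (j + 1)) Γ' (S j u).1 with hf
  have hfc : ∀ j, ContDiff ℝ 1 (f j) := fun j =>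
    (hΓ.contDiff_cutExt (S j u).2.1 _).sub (hΓ.contDiff_cutExt (S j u).2.1 _)
  have hLu : (L u).1 = cutExt (r J) Γ' u.1 + ∑ j ∈ Finset.range J, f j := by
    rw [← hJ₂ J (le_max_right _ _)]
    simp only [hE, LinearMap.add_apply, LinearMap.comp_apply, hSJ, LinearMap.sum_apply,
      LinearMap.sub_apply, Submodule.coe_add, Submodule.coe_sum, Submodule.coe_sub]
    rfl
  have hsumc : ContDiff ℝ 1 (∑ j ∈ Finset.range J, f j) := by
    have : (∑ j ∈ Finset.range J, f j) = fun z => ∑ j ∈ Finset.range J, f j z := by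
      ext1 z
      simp
    rw [this]
    exact ContDiff.sum fun j _ => hfc j
  have hcut := hΓ.contDiff_cutExt u.2.1 (r J)
  have hlp : ∀ j, ENNReal.ofReal (r j ^ (p - 1)) * lpEnergy p (S j u).1 ≤
      ((1 / 2) ^ j) ^ p * gagEnergy p Γ' u.1 := fun j => by
    calc _ ≤ ENNReal.ofReal (r j ^ (p - 1)) * (N j * gagEnergy p Γ' u.1) := by
          gcongr
          exact hN j u.1 u.2
      _ ≤ _ := by
          rw [← mul_assoc]
          exact mul_le_mul' (hrN j) le_rfl
  refine ⟨fun x => ?_, ?_, ?_⟩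
  -- The differences have zero trace, since cut off extensions of the same function at two scales
  -- agree on the boundary.
  · rw [hLu, Pi.add_apply, hΓ.cutExt_boundaryIncl, Finset.sum_apply]
    simp [hf, hΓ.cutExt_boundaryIncl]
  · rw [hLu]
    exact hcut.add hsumc
  rw [hLu]
  refine (hΓ.halfEnergy_covNorm_add_le hp.le hcut hsumc).trans ?_
  rw [add_mul]
  refine add_le_add ?_ ((hΓ.halfEnergy_covNorm_sum_le hp.le hfc J).trans ?_)
  -- A flat form also satisfies the curvature bound `r J ^ 2`, so the estimate of the curved case
  -- applies at this artificial scale. Its mass term is absorbed because `u = S J u`, which accounts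
  -- for `2 * gradConst n p`.
  · have h1 := (hΓ'.mono (sq_nonneg (r J))).halfEnergy_covNorm_cutExt_le (hr0 J) hp u.2.1
    have h2 := hlp J
    rw [hSJ] at h2
    have h3 : ((1 / 2 : ℝ≥0∞) ^ J) ^ p ≤ 1 := by
      refine ENNReal.rpow_le_one (pow_le_one₀ zero_le ?_) hp0.le
      rw [one_div]
      exact ENNReal.inv_le_one.2 one_le_two
    rw [← ENNReal.mul_rpow_of_nonneg _ _ hip]
    refine ENNReal.rpow_le_rpow (h1.trans ?_) hip
    calc _ ≤ gradConst n p * (gagEnergy p Γ' u.1 + 1 * gagEnergy p Γ' u.1) := by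
          exact mul_le_mul' le_rfl (add_le_add le_rfl (h2.trans (mul_le_mul' h3 le_rfl)))
      _ = _ := by ring
  · have h1 : ∀ j, halfEnergy p (covNorm Γ' (f j)) ^ (1 / p) ≤
        diffConst n p ^ (1 / p) * gagEnergy p Γ' u.1 ^ (1 / p) * (1 / 2) ^ j := fun j => by
      have h2 := hΓ'.halfEnergy_covNorm_cutExt_sub_le (hr0 (j + 1)) (hra j.le_succ) hp
        (S j u).2.1
      calc _ ≤ (diffConst n p * (((1 / 2) ^ j) ^ p * gagEnergy p Γ' u.1)) ^ (1 / p) :=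
            ENNReal.rpow_le_rpow (h2.trans (mul_le_mul' le_rfl (hlp j))) hip
        _ = _ := by
            rw [ENNReal.mul_rpow_of_nonneg _ _ hip, ENNReal.mul_rpow_of_nonneg _ _ hip,
              ← ENNReal.rpow_mul, mul_one_div_cancel hp0.ne', ENNReal.rpow_one]
            ring
    calc _ ≤ ∑ j ∈ Finset.range J,
          diffConst n p ^ (1 / p) * gagEnergy p Γ' u.1 ^ (1 / p) * (1 / 2) ^ j :=
          Finset.sum_le_sum fun j _ => h1 j
      _ ≤ diffConst n p ^ (1 / p) * gagEnergy p Γ' u.1 ^ (1 / p) * 2 := by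
          rw [← Finset.mul_sum]
          exact mul_le_mul' le_rfl (sum_half_pow_le J)
      _ = _ := by ring

/-- The constant of the extension theorem. -/
def extensionConst (n : ℕ) (p : ℝ) : ℝ≥0∞ :=
  gradConst n p ^ (1 / p) + massConst n p ^ (1 / p) +
    ((2 * gradConst n p) ^ (1 / p) + 2 * diffConst n p ^ (1 / p))

theorem extensionConst_ne_top (n : ℕ) {p : ℝ} (hp : 1 < p) : extensionConst n p ≠ ⊤ := by
  have h1 := gradConst_ne_top n hp
  have h2 := massConst_ne_top n hp
  have h3 := diffConst_ne_top n hp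
  have hip : 0 ≤ 1 / p := by
    have : 0 < p := by linarith
    positivity
  unfold extensionConst
  finiteness

/-- For positive `β` a single cutoff at scale `β ^ (1/2)` suffices. For `β = 0` both mass terms
disappear and the bound must come from the seminorm alone. -/
theorem exists_extension (hn : 1 ≤ n) {p : ℝ} (hp : 1 < p) (β : ℝ≥0)
    (hΓ : IsMetricConnectionForm Γ) (hβ : curvatureSupNorm Γ ≤ β) :
    ∃ E : C1c n F →ₗ[ℝ] C1cHalfSpace n F, ∀ u : C1c n F,
      (∀ x, (E u).1 (boundaryIncl n x) = u.1 x) ∧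
      interiorNorm p β Γ (E u).1 ≤ extensionConst n p * boundaryNorm p β Γ u.1 := by
  have hp0 : 0 < p := by linarith
  obtain ⟨Γ', hΓ', he⟩ := hΓ.exists_extension hβ
  rcases (zero_le : 0 ≤ β).eq_or_lt with rfl | hβ0
  · obtain ⟨E, hE⟩ := HalfSpaceForm.exists_flat_extension hn hΓ' hp
    refine ⟨E, fun u => ⟨(hE u).1, ?_⟩⟩
    rw [interiorNorm_eq hp0 0 he (hE u).2.1 (fun _ _ => rfl), hΓ'.boundaryNorm_eq hp0 0 he,
      NNReal.zero_rpow (by norm_num), NNReal.zero_rpow (by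
        have : 0 < p - 1 := by linarith
        positivity), ENNReal.coe_zero, zero_mul, zero_mul, add_zero, add_zero]
    exact (hE u).2.2.trans (mul_le_mul' le_add_self le_rfl)
  · refine ⟨cutExtLinear hΓ'.toIsSkewForm (Real.rpow_pos_of_pos hβ0 (1 / 2)),
      fun u => ⟨fun x => hΓ'.cutExt_boundaryIncl _ _ _, ?_⟩⟩
    exact (hΓ'.interiorNorm_cutExt_le he hβ0 hp u).trans (mul_le_mul' le_self_add le_rfl)

end FlatExtension

end GaugeTrace

end

theorem theorem1 (n : ℕ) (hn : 1 ≤ n) (p : ℝ) (hp : 1 < p) :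
    ∃ C : ℝ≥0, 0 < C ∧
      ∀ (F : Type*) [NormedAddCommGroup F] [InnerProductSpace ℝ F] [FiniteDimensional ℝ F]
        (Γ : EuclideanSpace ℝ (Fin (n + 1)) → EuclideanSpace ℝ (Fin (n + 1)) →L[ℝ] F →L[ℝ] F)
        (β : ℝ≥0),
        GaugeTrace.IsMetricConnectionForm Γ → GaugeTrace.curvatureSupNorm Γ ≤ β →
        (∀ U ∈ GaugeTrace.C1cHalfSpace n F,
          GaugeTrace.boundaryNorm p β Γ (fun x => U (GaugeTrace.boundaryIncl n x)) ≤
            C * GaugeTrace.interiorNorm p β Γ U) ∧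
        (∃ E : GaugeTrace.C1c n F →ₗ[ℝ] GaugeTrace.C1cHalfSpace n F,
          ∀ u : GaugeTrace.C1c n F,
            (∀ x, (E u).1 (GaugeTrace.boundaryIncl n x) = u.1 x) ∧
            GaugeTrace.interiorNorm p β Γ (E u).1 ≤
              C * GaugeTrace.boundaryNorm p β Γ u.1) := by
  obtain ⟨C, hC⟩ := GaugeTrace.trace_estimate hn hp
  have hK := GaugeTrace.extensionConst_ne_top n hp
  have h1 : (C : ℝ≥0∞) ≤ ((C + (GaugeTrace.extensionConst n p).toNNReal + 1 : ℝ≥0) : ℝ≥0∞) := by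
    rw [ENNReal.coe_le_coe, add_assoc]
    exact le_self_add
  have h2 : GaugeTrace.extensionConst n p ≤
      ((C + (GaugeTrace.extensionConst n p).toNNReal + 1 : ℝ≥0) : ℝ≥0∞) := by
    conv_lhs => rw [← ENNReal.coe_toNNReal hK]
    rw [ENNReal.coe_le_coe]
    exact le_add_self.trans le_self_add
  -- The summand `1` only ensures positivity.
  refine ⟨C + (GaugeTrace.extensionConst n p).toNNReal + 1, by positivity, ?_⟩
  intro F _ _ _ Γ β hΓ hβ
  refine ⟨fun U hU => (hC F Γ β hΓ hβ U hU).trans (mul_le_mul' h1 le_rfl), ?_⟩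
  obtain ⟨E, hE⟩ := GaugeTrace.exists_extension hn hp β hΓ hβ
  exact ⟨E, fun u => ⟨(hE u).1, (hE u).2.trans (mul_le_mul' h2 le_rfl)⟩⟩
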